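/- Let $(\Omega,\mathcal F,\mathbb P)$ be a probability space and let $W=\{W(h):h\in\mathfrak H\}$ be an isonormal Gaussian process on it over a real separable Hilbert space $\mathfrak H$, i.e. a centered jointly Gaussian family with $E[W(h)W(g)]=\langle h,g\rangle_{\mathfrak H}$. For $q\ge 1$ let $C_q\subset L^2(\Omega)$ be the $q$th Wiener chaos of $W$, that is, the closed linear span of $\{H_q(W(h)):\|h\|_{\mathfrak H}=1\}$, where $H_q$ is the $q$th (probabilists') Hermite polynomial, and let $J_q$ be the orthogonal projection of $L^2(\Omega)$ onto $C_q$. Let $D$ be the Malliavin derivative of $W$ (the closure in $L^2(\Omega)\times L^2(\Omega;\mathfrak H)$ of the operator $g(W(\phi_1),\dots,W(\phi_n))\mapsto\sum_i \partial_i g(W(\phi_1),\dots,W(\phi_n))\,\phi_i$, with $g$ smooth and all its derivatives of polynomial growth), and let $L^{-1}F=-\sum_{q\ge1}\frac1q J_qF$. Set $\Gamma_0(F)=F$ and $\Gamma_i(F)=\langle DF,-DL^{-1}\Gamma_{i-1}(F)\rangle_{\mathfrak H}$ for $i\ge1$. For $F$ with finite moments let $\kappa_r(F)=(-i)^r\frac{d^r}{dt^r}\log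 E[e^{itF}]\big|_{t=0}$ be its $r$th cumulant. Let $\alpha_1,\dots,\alpha_k$ be pairwise distinct non-zero real numbers, let $N_1,\dots,N_k$ be independent $\mathcal N(0,1)$ random variables (on any probability space), and put $$F_\infty=\sum_{i=1}^k\alpha_i(N_i^2-1),\qquad P(x)=x\prod_{i=1}^k(x-\alpha_i).$$ Let $F$ be a (necessarily centered) random variable living in a finite sum of Wiener chaoses, $F\in\bigoplus_{i=1}^M C_i$. Suppose that (i) $\kappa_r(F)=\kappa_r(F_\infty)$ for all $2\le r\le k+1=\deg P$, and (ii) $\displaystyle E\Bigg(\sum_{r=1}^{k+1}\frac{P^{(r)}(0)}{r!\,2^{r-1}}\big(\Gamma_{r-1}(F)-E(\Gamma_{r-1}(F))\big)\Bigg)^2=0.$ Then $F$ has the same law as $F_\infty$, and moreover $F\in C_2$. -/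

import Mathlib

open MeasureTheory ProbabilityTheory Polynomial
open scoped RealInnerProductSpace

namespace WienerChaos

section Isonormal

variable {Ω H : Type*} [MeasurableSpace Ω] [NormedAddCommGroup H] [InnerProductSpace ℝ H]

/-- `W = {W(h) : h ∈ H}` is an isonormal Gaussian process over the Hilbert space `H`: a centered
(jointly) Gaussian family with `E[W(h) W(g)] = ⟨h, g⟩`. -/
structure IsIsonormal (W : H → Ω → ℝ) (P : Measure Ω) : Prop where
  gaussian : IsGaussianProcess W P
  centered : ∀ h : H, ∫ ω, W h ω ∂P = 0
  covariance : ∀ h g : H, ∫ ω, W h ω * W g ω ∂P = ⟪h, g⟫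

/-- The `q`-th Wiener chaos of `W`: the closed linear subspace of `L²(P)` generated by the
variables `H_q(W(h))`, `‖h‖ = 1`, where `H_q` is the `q`-th (probabilists') Hermite polynomial.
As `H_0 = 1`, the norm of `h` plays no role for `q = 0`; not restricting it there makes the
chaos of order zero the space of constants, also when `H` is trivial. -/
noncomputable def chaos (W : H → Ω → ℝ) (P : Measure Ω) (q : ℕ) : Submodule ℝ (Lp ℝ 2 P) :=
  (Submodule.span ℝ {X : Lp ℝ 2 P | ∃ h : H, (q = 0 ∨ ‖h‖ = 1) ∧
    X =ᵐ[P] fun ω => aeval (W h ω) (hermite q)}).topologicalClosure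

instance chaos.completeSpace (W : H → Ω → ℝ) (P : Measure Ω) (q : ℕ) :
    CompleteSpace (chaos W P q) :=
  (Submodule.isClosed_topologicalClosure _).completeSpace_coe

/-- `L⁻¹ F = ∑_{q ≥ 1} -(1/q) J_q F`, the pseudo-inverse of the generator of the
Ornstein-Uhlenbeck semigroup; `J_q` is the orthogonal projection of `L²(P)` on the `q`-th chaos. -/
noncomputable def pseudoInverse (W : H → Ω → ℝ) (P : Measure Ω) (F : Lp ℝ 2 P) : Lp ℝ 2 P :=
  ∑' q : ℕ, (-(1 / ((q : ℝ) + 1))) • (chaos W P (q + 1)).starProjection F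

/-- The Malliavin derivative on smooth cylindrical random variables, as a graph: all pairs
`(F, DF)` with `F = g(W(φ_1), …, W(φ_n))` and `DF = ∑ i, ∂_i g(W(φ_1), …, W(φ_n)) φ_i`, where
`g` is smooth and `g` and its partial derivatives of all orders have polynomial growth. -/
def cylindricalGraph (W : H → Ω → ℝ) (P : Measure Ω) : Set (Lp ℝ 2 P × Lp H 2 P) :=
  {p | ∃ (n : ℕ) (φ : Fin n → H) (g : (Fin n → ℝ) → ℝ), g.HasTemperateGrowth ∧
    (p.1 =ᵐ[P] fun ω => g fun i => W (φ i) ω) ∧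
    (p.2 =ᵐ[P] fun ω => ∑ i, (fderiv ℝ g (fun j => W (φ j) ω) (Pi.single i 1)) • φ i)}

open Classical in
/-- The Malliavin derivative `D : 𝔻^{1,2} → L²(Ω; H)`: the closed operator whose graph is the
closure of the graph of `D` on smooth cylindrical variables (extended by `0` outside `𝔻^{1,2}`). -/
noncomputable def malliavinDeriv (W : H → Ω → ℝ) (P : Measure Ω) (F : Lp ℝ 2 P) : Lp H 2 P :=
  if h : ∃ U : Lp H 2 P, (F, U) ∈ closure (cylindricalGraph W P) then h.choose else 0

open Classical in
/-- The class in `L²(P)` of a square integrable function (`0` for other functions). -/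
noncomputable def toL2 {P : Measure Ω} (f : Ω → ℝ) : Lp ℝ 2 P :=
  if h : MemLp f 2 P then h.toLp f else 0

/-- `Γ_0(F) = F` and `Γ_{i+1}(F) = ⟨DF, -D L⁻¹ Γ_i(F)⟩_H`. -/
noncomputable def Gam (W : H → Ω → ℝ) (P : Measure Ω) (F : Lp ℝ 2 P) : ℕ → Lp ℝ 2 P
  | 0 => F
  | i + 1 => toL2 fun ω =>
      ⟪malliavinDeriv W P F ω, -(malliavinDeriv W P (pseudoInverse W P (Gam W P F i)) ω)⟫

end Isonormal

/-- The `j`-th cumulant `κ_j(F) = (-i)^j (d^j/dt^j) log φ_F(t) |_{t = 0}`, where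
`φ_F(t) = E[e^{itF}]`. The right-hand side is a real number. -/
noncomputable def cumulant {Ω : Type*} [MeasurableSpace Ω] (F : Ω → ℝ) (P : Measure Ω)
    (j : ℕ) : ℝ :=
  ((-Complex.I) ^ j *
    iteratedDeriv j (fun t : ℝ => Complex.log (charFun (P.map F) t)) 0).re

/-- The polynomial `P(x) = x ∏ i, (x - α_i)`. -/
noncomputable def targetPoly {k : ℕ} (α : Fin k → ℝ) : ℝ[X] :=
  X * ∏ i, (X - C (α i))

end WienerChaos

/-! Condition (ii) is an identity in L²: the centred iterates Γ_i, weighted by p_{i+1} / 2^i with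
p_j the coefficients of P, sum to zero (`GamRelation`). It is exploited in three ways.

Chaos order. Let F have components up to order n = r + 2 with r ≥ 1. Then Γ_i reaches order at most
n + i r, so the top order of Γ_k occurs in no other summand and its component there vanishes. Encode
the top component of F by its symbol f(h) = E[F H_n(W(h))] on the unit sphere. The symbol of Γ(F, G)
is a positive multiple of the inner product of the gradients of the two symbols
(`inner_hermiteL2_gammaCLM`). Where |f| is maximal the gradient is radial, so there the symbol of
Γ_k is a positive multiple of f^(k+1). In infinite dimension the supremum need not be attained;
almost critical points suffice (`exists_almost_critical`, `exists_le_abs_inner_Gam`). Hence f = 0,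
and repeating this brings F down to order at most 2 (`mem_chaosLE_of_gamRelation`).

First chaos. A variable of order at most 2 is described, up to its mean, by an operator A and a
vector v on the Hilbert space. On these data Γ is algebraic (`opCLM_gammaCLM`, `vecCLM_gammaCLM`):
the operator of Γ_i is 2^i A^(i+1), its vector is (i+2)/2 · 2^i A^i v. The relation becomes P(A) = 0
and (P' + P/x)(A) v = 0. The roots of P being simple, P and P' + P/x are coprime
(`isCoprime_targetPoly`), so v = 0 and F lies in the second chaos (`mem_chaos_two`).

Law. Integration by parts gives E[G e^{itF}] - E[G] E[e^{itF}] = it E[Γ(F, G) e^{itF}]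
(`expMean_gammaCLM`). Inserted in the relation, it yields for the characteristic function φ an
equation a(it) φ' = i b(it) φ with a(s) = ∏ (1/2 - s α_i), deg b ≤ k and b(0) = 0. The
characteristic function of F_∞ satisfies an equation with the same a. The cumulants of orders 2, …,
k+1 determine the k remaining coefficients of b (`SolvesODE.numerator_eq`), so the equations
coincide, and so do the solutions with value 1 at 0.

All this needs D and Γ to be bounded on finite sums of chaoses, so that identities may be checked on
Hermite variables. The key estimate is an L⁴–L² comparison for vector valued chaoses, obtained from
Gaussian integration by parts alone (`integral_norm_pow_four_hermite_le`). -/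

namespace WienerChaos

/-! ### Gaussian integration by parts for isonormal processes. -/

section Stein

variable {Ω H : Type*} [MeasurableSpace Ω] [NormedAddCommGroup H] [InnerProductSpace ℝ H]
  {P : Measure Ω} {W : H → Ω → ℝ}

/-- Functions of temperate growth of a Gaussian vector have moments of all orders. -/
lemma memLp_of_temperate {E F : Type*} [NormedAddCommGroup E] [NormedSpace ℝ E]
    [CompleteSpace E] [SecondCountableTopology E] [MeasurableSpace E] [BorelSpace E] [NormedAddCommGroup F]
    [NormedSpace ℝ F] {X : Ω → E} (hX : HasGaussianLaw X P) {g : E → F}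
    (hg : g.HasTemperateGrowth) {p : ENNReal} (hp : p ≠ ⊤) :
    MemLp (fun ω => g (X ω)) p P := by
  have := hX.isProbabilityMeasure
  obtain ⟨k, C, hC⟩ := hg.2 0
  have hmeas : AEStronglyMeasurable (fun ω => g (X ω)) P :=
    hg.1.continuous.comp_aestronglyMeasurable hX.aemeasurable.aestronglyMeasurable
  have hX' : MemLp X (p * k) P := hX.memLp (ENNReal.mul_ne_top hp (by simp))
  have h1 : MemLp (fun ω => 1 + ‖X ω‖) (p * k) P := MemLp.add (memLp_const (1 : ℝ)) hX'.norm
  have h2 : MemLp (fun ω => (1 + ‖X ω‖) ^ k) p P := by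
    rcases Nat.eq_zero_or_pos k with hk | hk
    · simp only [hk, pow_zero]
      exact memLp_const (1 : ℝ)
    · have h3 := h1.norm_rpow_div k
      have : p * (k : ENNReal) / (k : ENNReal) = p :=
        ENNReal.mul_div_cancel_right (by simp; omega) (by simp)
      rw [this] at h3
      refine h3.congr_norm (h1.aestronglyMeasurable.pow k)
        (Filter.Eventually.of_forall fun ω => ?_)
      simp [abs_of_nonneg (show (0 : ℝ) ≤ 1 + ‖X ω‖ by positivity)]
  refine (h2.const_mul C).mono' hmeas (Filter.Eventually.of_forall fun ω => ?_)
  simpa using hC (X ω)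

lemma temperate_fderiv {E F : Type*} [NormedAddCommGroup E] [NormedSpace ℝ E]
    [NormedAddCommGroup F] [NormedSpace ℝ F] {g : E → F} (hg : g.HasTemperateGrowth) :
    (fderiv ℝ g).HasTemperateGrowth := by
  refine ⟨hg.1.fderiv_right (by simp), fun n => ?_⟩
  obtain ⟨k, C, h⟩ := hg.2 (n + 1)
  exact ⟨k, C, fun x => by simpa [norm_iteratedFDeriv_fderiv] using h x⟩

lemma temperate_fderiv_apply {E F : Type*} [NormedAddCommGroup E] [NormedSpace ℝ E]
    [NormedAddCommGroup F] [NormedSpace ℝ F] {g : E → F} (hg : g.HasTemperateGrowth) (v : E) :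
    (fun x => fderiv ℝ g x v).HasTemperateGrowth :=
  (ContinuousLinearMap.hasTemperateGrowth (ContinuousLinearMap.apply ℝ F v)).comp
    (temperate_fderiv hg)

/-- **Stein's identity** for a centered real Gaussian measure. -/
lemma stein_gaussianReal (v : NNReal) {f : ℝ → ℝ} (hf : f.HasTemperateGrowth) :
    ∫ x, x * f x ∂(gaussianReal 0 v) = v * ∫ x, deriv f x ∂(gaussianReal 0 v) := by
  rcases eq_or_ne v 0 with rfl | hv
  · simp [gaussianReal_zero_var]
  have hlaw : HasGaussianLaw (id : ℝ → ℝ) (gaussianReal 0 v) := IsGaussian.hasGaussianLaw_id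
  have hderiv : (deriv f).HasTemperateGrowth := by
    simpa using temperate_fderiv_apply hf (1 : ℝ)
  have hi1 : Integrable (fun x => x * f x) (gaussianReal 0 v) :=
    memLp_one_iff_integrable.1 (memLp_of_temperate hlaw (g := fun x => x * f x)
      (by fun_prop) (by simp))
  have hi2 : Integrable (deriv f) (gaussianReal 0 v) :=
    memLp_one_iff_integrable.1 (memLp_of_temperate hlaw hderiv (by simp))
  have hi3 : Integrable f (gaussianReal 0 v) :=
    memLp_one_iff_integrable.1 (memLp_of_temperate hlaw hf (by simp))
  have hvol : ∀ g : ℝ → ℝ, Integrable g (gaussianReal 0 v) →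
      Integrable (fun x => g x * gaussianPDFReal 0 v x) := by
    intro g hg
    rw [gaussianReal_of_var_ne_zero _ hv] at hg
    rw [integrable_withDensity_iff_integrable_smul' (measurable_gaussianPDF 0 v)
      (Filter.Eventually.of_forall fun x => gaussianPDF_lt_top)] at hg
    refine hg.congr (Filter.Eventually.of_forall fun x => ?_)
    simp [toReal_gaussianPDF, mul_comm]
  have hpdf : ∀ x, HasDerivAt (gaussianPDFReal 0 v) (-(x / v) * gaussianPDFReal 0 v x) x := by
    intro x
    have h1 : HasDerivAt (fun x : ℝ => -(x - 0) ^ 2 / (2 * (v : ℝ))) (-(x / v)) x := by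
      have := (((hasDerivAt_id x).sub_const 0).pow 2).neg.div_const (2 * (v : ℝ))
      refine this.congr_deriv ?_
      have : (v : ℝ) ≠ 0 := by exact_mod_cast hv
      simp; field_simp
    have h2 := (h1.exp).const_mul (√(2 * Real.pi * v))⁻¹
    rw [gaussianPDFReal_def]
    refine h2.congr_deriv ?_
    ring
  -- The density ρ satisfies ρ' = -(x/v) ρ, so the identity is an integration by parts on the line;
  -- integrability disposes of the boundary terms.
  have key := integral_mul_deriv_eq_deriv_mul_of_integrable (u := f) (v := gaussianPDFReal 0 v)
    (u' := deriv f) (v' := fun x => -(x / v) * gaussianPDFReal 0 v x)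
    (fun x _ => (hf.1.differentiable (by simp) x).hasDerivAt) (fun x _ => hpdf x)
    (by
      refine ((hvol _ hi1).mul_const (-(1 / (v : ℝ)))).congr (Filter.Eventually.of_forall fun x => ?_)
      simp; ring)
    (hvol _ hi2) (hvol _ hi3)
  rw [integral_gaussianReal_eq_integral_smul hv, integral_gaussianReal_eq_integral_smul hv]
  have hv' : (v : ℝ) ≠ 0 := by exact_mod_cast hv
  have h4 : ∫ x, f x * (-(x / v) * gaussianPDFReal 0 v x)
      = -(1 / (v : ℝ)) * ∫ x, gaussianPDFReal 0 v x • (x * f x) := by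
    rw [← integral_const_mul]; congr 1; ext x; simp; ring
  rw [h4] at key
  have h5 : ∫ x, deriv f x * gaussianPDFReal 0 v x = ∫ x, gaussianPDFReal 0 v x • deriv f x := by
    congr 1; ext x; simp [mul_comm]
  rw [h5] at key
  field_simp at key
  linarith

namespace IsIsonormal

lemma isProbabilityMeasure (hW : IsIsonormal W P) : IsProbabilityMeasure P :=
  hW.gaussian.isProbabilityMeasure

lemma memLp (hW : IsIsonormal W P) (h : H) {p : ENNReal} (hp : p ≠ ⊤) : MemLp (W h) p P :=
  (hW.gaussian.hasGaussianLaw_eval h).memLp hp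

lemma integrable_mul (hW : IsIsonormal W P) (h g : H) :
    Integrable (fun ω => W h ω * W g ω) P :=
  (hW.memLp h (p := 2) (by simp)).integrable_mul (hW.memLp g (p := 2) (by simp))

/-- `W` is linear up to null sets. -/
lemma add_smul_ae (hW : IsIsonormal W P) (x y : H) (c : ℝ) :
    W (x + c • y) =ᵐ[P] fun ω => W x ω + c * W y ω := by
  set z := x + c • y with hz
  have hL : MemLp (fun ω => W z ω - (W x ω + c * W y ω)) 2 P :=
    (hW.memLp z (by simp)).sub ((hW.memLp x (by simp)).add ((hW.memLp y (by simp)).const_mul c))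
  -- Expanding the square and using the covariance gives ‖z - (x + c y)‖² = 0.
  have hsq : ∫ ω, (W z ω - (W x ω + c * W y ω)) ^ 2 ∂P = 0 := by
    have e : ∀ ω, (W z ω - (W x ω + c * W y ω)) ^ 2 = W z ω * W z ω - 2 * (W z ω * W x ω)
        - 2 * c * (W z ω * W y ω) + (W x ω * W x ω + 2 * c * (W x ω * W y ω)
          + c ^ 2 * (W y ω * W y ω)) := fun ω => by ring
    have I := hW.integrable_mul
    have I2 : ∀ (a : ℝ) (h g : H), Integrable (fun ω => a * (W h ω * W g ω)) P :=
      fun a h g => (I h g).const_mul a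
    simp_rw [e]
    rw [integral_add (by fun_prop) (by fun_prop), integral_sub (by fun_prop) (by fun_prop),
      integral_sub (by fun_prop) (by fun_prop), integral_add (by fun_prop) (by fun_prop),
      integral_add (by fun_prop) (by fun_prop)]
    simp only [integral_const_mul, hW.covariance]
    simp only [hz, inner_add_left, inner_add_right, inner_smul_left, inner_smul_right,
      real_inner_comm x y, RCLike.conj_to_real]
    ring
  have h0 := (integral_eq_zero_iff_of_nonneg (fun ω => sq_nonneg _) hL.integrable_sq).1 hsq
  filter_upwards [h0] with ω hω
  have : W z ω - (W x ω + c * W y ω) = 0 := by simpa using hω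
  linarith

lemma smul_ae (hW : IsIsonormal W P) (y : H) (c : ℝ) :
    W (c • y) =ᵐ[P] fun ω => c * W y ω := by
  have h0 : W (0 : H) =ᵐ[P] fun _ => 0 := by
    filter_upwards [hW.add_smul_ae 0 0 1] with ω hω
    simp at hω
    simpa using hω
  filter_upwards [hW.add_smul_ae 0 y c, h0] with ω h1 h2
  simpa [h2] using h1

lemma add_ae (hW : IsIsonormal W P) (x y : H) :
    W (x + y) =ᵐ[P] fun ω => W x ω + W y ω := by
  simpa using hW.add_smul_ae x y 1

lemma hasGaussianLaw_pi (hW : IsIsonormal W P) {ι : Type*} [Fintype ι] (φ : ι → H) :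
    HasGaussianLaw (fun ω i => W (φ i) ω) P := by
  have h := (hW.gaussian.comp_right φ).hasGaussianLaw (Finset.univ : Finset ι)
  let L : (↥(Finset.univ : Finset ι) → ℝ) →L[ℝ] (ι → ℝ) :=
    ContinuousLinearMap.pi fun i =>
      ContinuousLinearMap.proj (⟨i, Finset.mem_univ i⟩ : (Finset.univ : Finset ι))
  exact h.map_fun L

lemma memLp_comp (hW : IsIsonormal W P) {ι F : Type*} [Fintype ι] [NormedAddCommGroup F]
    [NormedSpace ℝ F] (φ : ι → H) {g : (ι → ℝ) → F} (hg : g.HasTemperateGrowth)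
    {p : ENNReal} (hp : p ≠ ⊤) : MemLp (fun ω => g fun i => W (φ i) ω) p P :=
  memLp_of_temperate (hW.hasGaussianLaw_pi φ) hg hp

/-- Jointly Gaussian families with vanishing cross-covariances are independent. -/
lemma indepFun_of_orthogonal (hW : IsIsonormal W P) {ι : Type*} (ψ : ι → H) (h : H)
    (ho : ∀ i, ⟪h, ψ i⟫ = 0) : IndepFun (fun ω i => W (ψ i) ω) (W h) P := by
  have := hW.isProbabilityMeasure
  have hg : IsGaussianProcess (Sum.elim (fun i => W (ψ i)) (fun _ : Unit => W h)) P := by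
    have := hW.gaussian.comp_right (Sum.elim ψ fun _ : Unit => h)
    refine this.congr fun t => ?_
    rcases t with t | t <;> exact Filter.EventuallyEq.rfl
  have hi := hg.indepFun_of_covariance_eq_zero
    (fun i => (hW.gaussian.aemeasurable _)) (fun i => (hW.gaussian.aemeasurable _)) (by
      intro i _
      rw [covariance_eq_sub (hW.memLp _ (by simp)) (hW.memLp _ (by simp))]
      simp only [Pi.mul_apply, hW.covariance, hW.centered]
      rw [real_inner_comm, ho i]; simp)
  exact hi.comp measurable_id (measurable_pi_apply ())

lemma map_eq_gaussianReal (hW : IsIsonormal W P) (h : H) :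
    P.map (W h) = gaussianReal 0 (‖h‖₊ ^ 2) := by
  have := hW.isProbabilityMeasure
  rw [(hW.gaussian.hasGaussianLaw_eval h).map_eq_gaussianReal, hW.centered,
    variance_of_integral_eq_zero (hW.gaussian.aemeasurable h) (hW.centered h)]
  congr 1
  have : ∫ ω, W h ω ^ 2 ∂P = ‖h‖ ^ 2 := by
    simp_rw [pow_two (W h _), hW.covariance, real_inner_self_eq_norm_sq]
  rw [this]
  ext; simp

/-- **Gaussian integration by parts** for cylinder functions of an isonormal process. -/
theorem integral_mul_temperate (hW : IsIsonormal W P) {ι : Type*} [Fintype ι] [DecidableEq ι]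
    (φ : ι → H) {g : (ι → ℝ) → ℝ} (hg : g.HasTemperateGrowth) (h : H) :
    ∫ ω, W h ω * g (fun i => W (φ i) ω) ∂P
      = ∑ i, ⟪φ i, h⟫ * ∫ ω, fderiv ℝ g (fun j => W (φ j) ω) (Pi.single i 1) ∂P := by
  have := hW.isProbabilityMeasure
  have hI : ∀ i, Integrable (fun ω => fderiv ℝ g (fun j => W (φ j) ω) (Pi.single i 1)) P :=
    fun i => memLp_one_iff_integrable.1 (hW.memLp_comp φ (temperate_fderiv_apply hg _) (by simp))
  rcases eq_or_ne h 0 with rfl | hh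
  · have h0 : W (0 : H) =ᵐ[P] fun _ => 0 := by simpa using hW.smul_ae (0 : H) 0
    rw [integral_congr_ae (g := fun _ => (0 : ℝ)) (by filter_upwards [h0] with ω hω; simp [hω])]
    simp
  have hn : ‖h‖ ^ 2 ≠ 0 := by simpa using hh
  -- Split φ_i into c_i h and a part ψ_i orthogonal to h. Then (W(ψ_i))_i is independent of W(h),
  -- and for frozen values of it the claim is the one-dimensional identity in the variable W(h),
  -- along the direction c.
  set c : ι → ℝ := fun i => ⟪φ i, h⟫ / ‖h‖ ^ 2 with hc
  set ψ : ι → H := fun i => φ i + (-(c i)) • h with hψ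
  have ho : ∀ i, ⟪h, ψ i⟫ = 0 := by
    intro i
    simp only [hψ, hc, inner_add_right, inner_smul_right, real_inner_self_eq_norm_sq]
    rw [real_inner_comm]; field_simp; ring
  have hind := hW.indepFun_of_orthogonal ψ h ho
  set Y : Ω → ι → ℝ := fun ω i => W (ψ i) ω with hY
  have hYm : AEMeasurable Y P := (hW.hasGaussianLaw_pi ψ).aemeasurable
  have hhm : AEMeasurable (W h) P := hW.gaussian.aemeasurable h
  have hae : ∀ᵐ ω ∂P, (fun i => W (φ i) ω) = Y ω + W h ω • c := by
    have : ∀ᵐ ω ∂P, ∀ i, W (ψ i) ω = W (φ i) ω + -(c i) * W h ω :=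
      ae_all_iff.2 fun i => hW.add_smul_ae (φ i) h (-(c i))
    filter_upwards [this] with ω hω
    ext i
    simp [hY, hω i]; ring
  have hprod : P.map (fun ω => (Y ω, W h ω)) = (P.map Y).prod (P.map (W h)) :=
    (indepFun_iff_map_prod_eq_prod_map_map hYm hhm).1 hind
  have hYp : IsProbabilityMeasure (P.map Y) := Measure.isProbabilityMeasure_map hYm
  have hhp : IsProbabilityMeasure (P.map (W h)) := Measure.isProbabilityMeasure_map hhm
  have hpm : AEMeasurable (fun ω => (Y ω, W h ω)) P := hYm.prodMk hhm
  -- transfer of expectations to the product space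
  have trans : ∀ G : (ι → ℝ) × ℝ → ℝ, Continuous G →
      Integrable (fun ω => G (Y ω, W h ω)) P →
      ∫ ω, G (Y ω, W h ω) ∂P = ∫ y, ∫ t, G (y, t) ∂(P.map (W h)) ∂(P.map Y) := by
    intro G hG hGi
    have h1 : Integrable G ((P.map Y).prod (P.map (W h))) := by
      rw [← hprod, integrable_map_measure hG.aestronglyMeasurable hpm]
      exact hGi
    rw [← integral_prod _ h1, ← hprod, integral_map hpm hG.aestronglyMeasurable]
  have hgc := hg.1.continuous
  have hgd := (hg.1.continuous_fderiv (by simp))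
  have e1 : ∫ ω, W h ω * g (fun i => W (φ i) ω) ∂P
      = ∫ y, ∫ t, t * g (y + t • c) ∂(P.map (W h)) ∂(P.map Y) := by
    rw [← trans (fun z => z.2 * g (z.1 + z.2 • c)) (by fun_prop)]
    · exact integral_congr_ae (by filter_upwards [hae] with ω hω; rw [hω])
    · have : Integrable (fun ω => W h ω * g (fun i => W (φ i) ω)) P :=
        (hW.memLp h (p := 2) (by simp)).integrable_mul (hW.memLp_comp φ hg (p := 2) (by simp))
      exact this.congr (by filter_upwards [hae] with ω hω; simp only [hω])
  have e2 : ∫ ω, fderiv ℝ g (fun i => W (φ i) ω) c ∂P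
      = ∫ y, ∫ t, fderiv ℝ g (y + t • c) c ∂(P.map (W h)) ∂(P.map Y) := by
    rw [← trans (fun z => fderiv ℝ g (z.1 + z.2 • c) c) (by fun_prop)]
    · exact integral_congr_ae (by filter_upwards [hae] with ω hω; rw [hω])
    · have : Integrable (fun ω => fderiv ℝ g (fun i => W (φ i) ω) c) P :=
        memLp_one_iff_integrable.1
          (hW.memLp_comp φ (temperate_fderiv_apply hg c) (p := 1) (by simp))
      exact this.congr (by filter_upwards [hae] with ω hω; simp only [hω])
  have e3 : ∀ y : ι → ℝ, ∫ t, t * g (y + t • c) ∂(P.map (W h))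
      = ‖h‖ ^ 2 * ∫ t, fderiv ℝ g (y + t • c) c ∂(P.map (W h)) := by
    intro y
    have haff : (fun t : ℝ => y + t • c).HasTemperateGrowth := by fun_prop
    have := stein_gaussianReal (‖h‖₊ ^ 2) (f := fun t => g (y + t • c)) (hg.comp haff)
    rw [hW.map_eq_gaussianReal h, this]
    have hd : ∀ t : ℝ, deriv (fun t : ℝ => g (y + t • c)) t = fderiv ℝ g (y + t • c) c := by
      intro t
      have h1 : HasDerivAt (fun t : ℝ => y + t • c) c t := by
        simpa using ((hasDerivAt_id t).smul_const c).const_add y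
      exact ((hg.1.differentiable (by simp) _).hasFDerivAt.comp_hasDerivAt t h1).deriv
    simp_rw [hd]
    simp
  simp_rw [e3] at e1
  rw [integral_const_mul, ← e2] at e1
  rw [e1]
  have hcs : c = ∑ i, c i • (Pi.single i (1 : ℝ) : ι → ℝ) := by
    ext j; simp [Finset.sum_apply, Pi.single_apply]
  have : ∀ ω, fderiv ℝ g (fun i => W (φ i) ω) c
      = ∑ i, c i * fderiv ℝ g (fun i => W (φ i) ω) (Pi.single i 1) := by
    intro ω
    conv_lhs => rw [hcs]
    simp
  simp_rw [this]
  rw [integral_finsetSum _ fun i _ => (hI i).const_mul _, Finset.mul_sum]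
  refine Finset.sum_congr rfl fun i _ => ?_
  rw [integral_const_mul, ← mul_assoc]
  congr 1
  simp only [hc]; field_simp

end IsIsonormal

end Stein


/-! ### Hermite polynomials as functions of temperate growth. -/

section Hermite

/-- The probabilists' Hermite polynomials as real functions. -/
noncomputable def hermiteFun (q : ℕ) (x : ℝ) : ℝ := aeval x (hermite q)

@[simp] lemma hermiteFun_zero (x : ℝ) : hermiteFun 0 x = 1 := by simp [hermiteFun]

@[simp] lemma hermiteFun_one (x : ℝ) : hermiteFun 1 x = x := by simp [hermiteFun]

lemma derivative_hermite_succ (n : ℕ) :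
    derivative (hermite (n + 1)) = (n + 1 : ℤ[X]) * hermite n := by
  induction n with
  | zero => simp
  | succ n ih =>
    rw [hermite_succ (n + 1), derivative_sub, derivative_mul, ih, derivative_X, derivative_mul]
    have h2 := hermite_succ n
    have h1 : derivative (n + 1 : ℤ[X]) = 0 := by
      rw [show (n + 1 : ℤ[X]) = ((n + 1 : ℕ) : ℤ[X]) by push_cast; rfl, derivative_natCast]
    rw [h1]
    push_cast
    linear_combination -(n + 1 : ℤ[X]) * h2

lemma hermiteFun_succ (n : ℕ) (x : ℝ) :
    hermiteFun (n + 1) x = x * hermiteFun n x - n * hermiteFun (n - 1) x := by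
  unfold hermiteFun
  rw [hermite_succ]
  cases n with
  | zero => simp
  | succ n =>
    rw [derivative_hermite_succ, map_sub, map_mul, map_mul, aeval_X]
    simp

lemma temperate_aeval (p : ℤ[X]) : (fun x : ℝ => aeval x p).HasTemperateGrowth := by
  induction p using Polynomial.induction_on' with
  | add p q hp hq => simpa using hp.fun_add hq
  | monomial n a =>
    simp only [aeval_monomial]
    have := (Function.HasTemperateGrowth.const (E := ℝ) (a : ℝ)).fun_mul
      (Function.HasTemperateGrowth.id'.fun_pow n)
    simpa using this

lemma temperate_hermiteFun (q : ℕ) : (hermiteFun q).HasTemperateGrowth := temperate_aeval _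

lemma deriv_hermiteFun (q : ℕ) (x : ℝ) : deriv (hermiteFun q) x = q * hermiteFun (q - 1) x := by
  have : deriv (hermiteFun q) x = aeval x (derivative (hermite q)) :=
    (Polynomial.hasDerivAt_aeval (hermite q) x).deriv
  rw [this]
  cases q with
  | zero => simp
  | succ n =>
    rw [derivative_hermite_succ, map_mul]
    simp [hermiteFun]

end Hermite

/-! ### Calculus of cylindrical variables and moments of Hermite variables. -/

section Cylinder

variable {Ω H : Type*} {mΩ : MeasurableSpace Ω} [NormedAddCommGroup H] [InnerProductSpace ℝ H]
  {P : Measure Ω} {W : H → Ω → ℝ}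

/-- `U` is a smooth cylindrical variable (of temperate growth) and `DU` is its derivative. -/
def IsCyl (W : H → Ω → ℝ) (U : Ω → ℝ) (DU : Ω → H) : Prop :=
  ∃ (n : ℕ) (φ : Fin n → H) (g : (Fin n → ℝ) → ℝ), g.HasTemperateGrowth ∧
    (∀ ω, U ω = g fun i => W (φ i) ω) ∧
    ∀ ω, DU ω = ∑ i, (fderiv ℝ g (fun j => W (φ j) ω) (Pi.single i 1)) • φ i

namespace IsCyl

/-- Extension of a representation to a larger family of variables. -/
lemma extend_rep {n m : ℕ} (φ : Fin n → H) (ψ : Fin m → H) (f : Fin n → Fin m)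
    (hf : Function.Injective f)
    (hφ : ∀ i, ψ (f i) = φ i) {g : (Fin n → ℝ) → ℝ} (hg : g.HasTemperateGrowth) :
    ∃ g' : (Fin m → ℝ) → ℝ, g'.HasTemperateGrowth ∧
      (∀ ω, g (fun i => W (φ i) ω) = g' fun i => W (ψ i) ω) ∧
      ∀ ω, ∑ i, (fderiv ℝ g (fun j => W (φ j) ω) (Pi.single i 1)) • φ i
        = ∑ i, (fderiv ℝ g' (fun j => W (ψ j) ω) (Pi.single i 1)) • ψ i := by
  let L : (Fin m → ℝ) →L[ℝ] (Fin n → ℝ) :=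
    ContinuousLinearMap.pi fun i => ContinuousLinearMap.proj (f i)
  have hL : ∀ ω, L (fun i => W (ψ i) ω) = fun i => W (φ i) ω := by
    intro ω; ext i; simp [L, hφ]
  refine ⟨fun x => g (L x), hg.comp L.hasTemperateGrowth, fun ω => by simp only [hL], fun ω => ?_⟩
  have hd : ∀ x v, fderiv ℝ (fun x => g (L x)) x v = fderiv ℝ g (L x) (L v) := by
    intro x v
    have := ((hg.1.differentiable (by simp) (L x)).hasFDerivAt.comp x L.hasFDerivAt).fderiv
    simp only [Function.comp_def] at this
    rw [this]; rfl
  simp only [hd, hL]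
  rw [← Finset.sum_subset (Finset.subset_univ (Finset.univ.image f)),
    Finset.sum_image hf.injOn]
  · refine Finset.sum_congr rfl fun i _ => ?_
    rw [hφ]
    congr 2
    ext k
    simp [L, Pi.single_apply, hf.eq_iff]
  · intro k _ hk
    have : L (Pi.single k 1) = 0 := by
      ext i
      have : f i ≠ k := fun h => hk (by simp [← h])
      simp [L, this]
    simp [this]

/-- Two cylindrical variables can be represented over a common family. -/
lemma common {U V : Ω → ℝ} {DU DV : Ω → H} (hU : IsCyl W U DU) (hV : IsCyl W V DV) :
    ∃ (n : ℕ) (φ : Fin n → H) (g g' : (Fin n → ℝ) → ℝ),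
      g.HasTemperateGrowth ∧ g'.HasTemperateGrowth ∧
      (∀ ω, U ω = g fun i => W (φ i) ω) ∧ (∀ ω, V ω = g' fun i => W (φ i) ω) ∧
      (∀ ω, DU ω = ∑ i, (fderiv ℝ g (fun j => W (φ j) ω) (Pi.single i 1)) • φ i) ∧
      ∀ ω, DV ω = ∑ i, (fderiv ℝ g' (fun j => W (φ j) ω) (Pi.single i 1)) • φ i := by
  obtain ⟨n, φ, g, hg, h1, h2⟩ := hU
  obtain ⟨m, ψ, g', hg', h1', h2'⟩ := hV
  obtain ⟨k, hk, e1, e2⟩ := extend_rep (W := W) φ (Fin.append φ ψ) (Fin.castAdd m)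
    (Fin.castAdd_injective _ _) (by simp) hg
  obtain ⟨k', hk', e1', e2'⟩ := extend_rep (W := W) ψ (Fin.append φ ψ) (Fin.natAdd n)
    (Fin.natAdd_injective _ _) (by simp) hg'
  exact ⟨_, _, k, k', hk, hk', fun ω => (h1 ω).trans (e1 ω), fun ω => (h1' ω).trans (e1' ω),
    fun ω => (h2 ω).trans (e2 ω), fun ω => (h2' ω).trans (e2' ω)⟩

lemma const (c : ℝ) : IsCyl W (fun _ => c) (fun _ => 0) :=
  ⟨0, Fin.elim0, fun _ => c, .const c, by simp, by simp⟩

lemma of_apply (h : H) : IsCyl W (W h) (fun _ => h) := by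
  refine ⟨1, fun _ => h, fun x => x 0,
    (ContinuousLinearMap.proj (R := ℝ) (φ := fun _ : Fin 1 => ℝ) 0).hasTemperateGrowth,
    by simp, fun ω => ?_⟩
  have : fderiv ℝ (fun x : Fin 1 → ℝ => x 0) (fun _ => W h ω)
      = ContinuousLinearMap.proj (R := ℝ) (φ := fun _ : Fin 1 => ℝ) 0 :=
    (ContinuousLinearMap.proj (R := ℝ) (φ := fun _ : Fin 1 => ℝ) 0).fderiv
  simp [this]

lemma add {U V : Ω → ℝ} {DU DV : Ω → H} (hU : IsCyl W U DU) (hV : IsCyl W V DV) :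
    IsCyl W (fun ω => U ω + V ω) (fun ω => DU ω + DV ω) := by
  obtain ⟨n, φ, g, g', hg, hg', h1, h1', h2, h2'⟩ := hU.common hV
  refine ⟨n, φ, fun x => g x + g' x, hg.fun_add hg', fun ω => by simp only [h1, h1'], fun ω => ?_⟩
  dsimp only
  rw [h2, h2', ← Finset.sum_add_distrib]
  refine Finset.sum_congr rfl fun i _ => ?_
  rw [fderiv_fun_add (hg.1.differentiable (by simp) _) (hg'.1.differentiable (by simp) _)]
  simp [add_smul]

lemma mul {U V : Ω → ℝ} {DU DV : Ω → H} (hU : IsCyl W U DU) (hV : IsCyl W V DV) :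
    IsCyl W (fun ω => U ω * V ω) (fun ω => U ω • DV ω + V ω • DU ω) := by
  obtain ⟨n, φ, g, g', hg, hg', h1, h1', h2, h2'⟩ := hU.common hV
  refine ⟨n, φ, fun x => g x * g' x, hg.fun_mul hg', fun ω => by simp only [h1, h1'], fun ω => ?_⟩
  dsimp only
  rw [h2, h2', Finset.smul_sum, Finset.smul_sum, ← Finset.sum_add_distrib]
  refine Finset.sum_congr rfl fun i _ => ?_
  rw [fderiv_fun_mul (hg.1.differentiable (by simp) _) (hg'.1.differentiable (by simp) _)]
  simp [add_smul, h1, h1', mul_smul]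

lemma comp {U : Ω → ℝ} {DU : Ω → H} (hU : IsCyl W U DU) {f : ℝ → ℝ}
    (hf : f.HasTemperateGrowth) :
    IsCyl W (fun ω => f (U ω)) (fun ω => deriv f (U ω) • DU ω) := by
  obtain ⟨n, φ, g, hg, h1, h2⟩ := hU
  refine ⟨n, φ, fun x => f (g x), hf.comp hg, fun ω => by simp only [h1], fun ω => ?_⟩
  dsimp only
  rw [h2, Finset.smul_sum]
  refine Finset.sum_congr rfl fun i _ => ?_
  have := ((hf.1.differentiable (by simp) (g fun j => W (φ j) ω)).hasDerivAt.comp_hasFDerivAt _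
    (hg.1.differentiable (by simp) _).hasFDerivAt).fderiv
  simp only [Function.comp_def] at this
  rw [this, h1]
  simp [mul_smul]

lemma const_mul {U : Ω → ℝ} {DU : Ω → H} (hU : IsCyl W U DU) (c : ℝ) :
    IsCyl W (fun ω => c * U ω) (fun ω => c • DU ω) := by
  simpa using (const c).mul hU

lemma sum {ι : Type*} (s : Finset ι) {U : ι → Ω → ℝ} {DU : ι → Ω → H}
    (h : ∀ i ∈ s, IsCyl W (U i) (DU i)) :
    IsCyl W (fun ω => ∑ i ∈ s, U i ω) (fun ω => ∑ i ∈ s, DU i ω) := by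
  classical
  induction s using Finset.induction_on with
  | empty => simpa using const 0
  | insert a s ha ih =>
    simp only [Finset.sum_insert ha]
    exact (h a (by simp)).add (ih fun i hi => h i (by simp [hi]))

lemma hermite (q : ℕ) (h : H) : IsCyl W (fun ω => hermiteFun q (W h ω))
    (fun ω => (q * hermiteFun (q - 1) (W h ω)) • h) := by
  simpa only [deriv_hermiteFun] using (of_apply h).comp (temperate_hermiteFun q)

lemma inner_deriv {U : Ω → ℝ} {DU : Ω → H} (hU : IsCyl W U DU) (v : H) :
    ∃ D, IsCyl W (fun ω => ⟪DU ω, v⟫) D := by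
  obtain ⟨n, φ, g, hg, h1, h2⟩ := hU
  refine ⟨_, n, φ, fun x => ∑ i, fderiv ℝ g x (Pi.single i 1) * ⟪φ i, v⟫, ?_, fun ω => ?_,
    fun ω => rfl⟩
  · exact .sum fun i _ => (temperate_fderiv_apply hg _).fun_mul (.const _)
  · dsimp only
    rw [h2, sum_inner]
    simp [inner_smul_left]




lemma memLp (hW : IsIsonormal W P) {U : Ω → ℝ} {DU : Ω → H} (hU : IsCyl W U DU) {p : ENNReal} (hp : p ≠ ⊤) :
    MemLp U p P := by
  obtain ⟨n, φ, g, hg, h1, h2⟩ := hU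
  rw [funext h1]
  exact hW.memLp_comp φ hg hp

lemma memLp_deriv (hW : IsIsonormal W P) {U : Ω → ℝ} {DU : Ω → H} (hU : IsCyl W U DU) {p : ENNReal} (hp : p ≠ ⊤) :
    MemLp DU p P := by
  obtain ⟨n, φ, g, hg, h1, h2⟩ := hU
  rw [funext h2]
  refine hW.memLp_comp φ (g := fun x => ∑ i, fderiv ℝ g x (Pi.single i 1) • φ i) ?_ hp
  exact .sum fun i _ => (temperate_fderiv_apply hg _).fun_smul (.const _)

lemma integrable (hW : IsIsonormal W P) {U : Ω → ℝ} {DU : Ω → H} (hU : IsCyl W U DU) : Integrable U P :=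
  memLp_one_iff_integrable.1 (hU.memLp hW (by simp))

lemma stein (hW : IsIsonormal W P) {U : Ω → ℝ} {DU : Ω → H} (hU : IsCyl W U DU) (h : H) :
    ∫ ω, W h ω * U ω ∂P = ∫ ω, ⟪DU ω, h⟫ ∂P := by
  obtain ⟨n, φ, g, hg, h1, h2⟩ := hU
  simp_rw [h1, h2, sum_inner, inner_smul_left]
  rw [hW.integral_mul_temperate φ hg h, integral_finsetSum]
  · refine Finset.sum_congr rfl fun i _ => ?_
    rw [integral_mul_const, mul_comm]
    rfl
  · intro i _
    exact (memLp_one_iff_integrable.1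
      (hW.memLp_comp φ (temperate_fderiv_apply hg _) (by simp))).mul_const _

/-- Integration by parts against a Hermite polynomial: `E[H_{q+1}(W(h)) U] = E[H_q(W(h)) D_h U]`
for a unit vector `h`. -/
lemma stein_hermite (hW : IsIsonormal W P) {U : Ω → ℝ} {DU : Ω → H} (hU : IsCyl W U DU) {h : H} (hh : ‖h‖ = 1) (q : ℕ) :
    ∫ ω, hermiteFun (q + 1) (W h ω) * U ω ∂P
      = ∫ ω, hermiteFun q (W h ω) * ⟪DU ω, h⟫ ∂P := by
  have h1 := ((IsCyl.hermite q h).mul hU).stein hW h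
  obtain ⟨D, hD⟩ := hU.inner_deriv h
  have i1 : Integrable (fun ω => W h ω * (hermiteFun q (W h ω) * U ω)) P :=
    ((of_apply h).mul ((IsCyl.hermite q h).mul hU)).integrable hW
  have i2 : Integrable (fun ω => q * hermiteFun (q - 1) (W h ω) * U ω) P :=
    (((IsCyl.hermite (q - 1) h).const_mul q).mul hU).integrable hW
  have i3 : Integrable (fun ω => hermiteFun q (W h ω) * ⟪DU ω, h⟫) P :=
    ((IsCyl.hermite q h).mul hD).integrable hW
  -- By the three-term recursion; as h is a unit vector, the derivative of H_q(W(h)) along h cancels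
  -- the term with H_{q-1} exactly.
  have e : ∀ ω, hermiteFun (q + 1) (W h ω) * U ω
      = W h ω * (hermiteFun q (W h ω) * U ω) - q * hermiteFun (q - 1) (W h ω) * U ω := by
    intro ω; rw [hermiteFun_succ]; ring
  simp_rw [e]
  rw [integral_sub i1 i2, h1]
  have e2 : ∀ ω, ⟪hermiteFun q (W h ω) • DU ω + U ω • (↑q * hermiteFun (q - 1) (W h ω)) • h, h⟫
      = hermiteFun q (W h ω) * ⟪DU ω, h⟫ + q * hermiteFun (q - 1) (W h ω) * U ω := by
    intro ω
    simp [inner_add_left, inner_smul_left, hh]; ring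
  simp_rw [e2]
  rw [integral_add i3 i2]; ring

end IsCyl

/-- The triple products of Hermite variables of top order. -/
lemma integral_hermite_triple (hW : IsIsonormal W P) {h : H} (hh : ‖h‖ = 1) (u v : H) (n : ℕ) :
    ∀ a b, a + b ≤ n →
    ∫ ω, hermiteFun n (W h ω) * (hermiteFun a (W u ω) * hermiteFun b (W v ω)) ∂P
      = if a + b = n then n.factorial * ⟪u, h⟫ ^ a * ⟪v, h⟫ ^ b else 0 := by
  have := hW.isProbabilityMeasure
  induction n with
  | zero =>
    intro a b hab
    obtain ⟨rfl, rfl⟩ : a = 0 ∧ b = 0 := by omega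
    simp
  | succ n ih =>
    intro a b hab
    have hD := (IsCyl.hermite (W := W) a u).mul (IsCyl.hermite b v)
    rw [hD.stein_hermite hW hh n]
    have e : ∀ ω, hermiteFun n (W h ω) * ⟪hermiteFun a (W u ω) • (↑b * hermiteFun (b - 1) (W v ω)) • v
        + hermiteFun b (W v ω) • (↑a * hermiteFun (a - 1) (W u ω)) • u, h⟫
        = b * ⟪v, h⟫ * (hermiteFun n (W h ω) * (hermiteFun a (W u ω) * hermiteFun (b - 1) (W v ω)))
        + a * ⟪u, h⟫ * (hermiteFun n (W h ω) * (hermiteFun (a - 1) (W u ω) * hermiteFun b (W v ω))) := by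
      intro ω
      simp [inner_add_left, inner_smul_left]; ring
    simp_rw [e]
    have i : ∀ a b, Integrable (fun ω => hermiteFun n (W h ω) *
        (hermiteFun a (W u ω) * hermiteFun b (W v ω))) P := fun a b =>
      ((IsCyl.hermite n h).mul ((IsCyl.hermite a u).mul (IsCyl.hermite b v))).integrable hW
    rw [integral_add ((i _ _).const_mul _) ((i _ _).const_mul _), integral_const_mul,
      integral_const_mul]
    -- Differentiating lowers a or b by one. The truncated differences at 0 are harmless because
    -- they carry the factor a or b.
    rcases a with _ | a <;> rcases b with _ | b
    · simp
    · rw [ih _ _ (by omega)]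
      simp only [Nat.cast_zero, zero_mul, add_zero]
      by_cases hn : 0 + (b + 1) = n + 1
      · have : 0 + b = n := by omega
        simp only [Nat.add_sub_cancel, this, hn, if_true]
        have hbn : b = n := by omega
        subst hbn
        push_cast [Nat.factorial_succ]; ring
      · rw [if_neg hn, if_neg (by omega)]; simp
    · rw [ih (a + 1 - 1) _ (by omega)]
      simp only [Nat.cast_zero, zero_mul, zero_add]
      by_cases hn : (a + 1) + 0 = n + 1
      · simp only [Nat.add_sub_cancel, hn, if_true]
        have hbn : a = n := by omega
        subst hbn
        simp only [add_zero, if_true]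
        push_cast [Nat.factorial_succ]; ring
      · rw [if_neg hn, if_neg (by omega)]; simp
    · rw [ih _ _ (by omega), ih _ _ (by omega)]
      by_cases hn : (a + 1) + (b + 1) = n + 1
      · have h1 : a + 1 + (b + 1 - 1) = n := by omega
        have h2 : a + 1 - 1 + (b + 1) = n := by omega
        simp only [h1, h2, hn, if_true]
        have hbn : n = a + 1 + b := by omega
        simp only [Nat.add_sub_cancel]
        subst hbn
        push_cast [Nat.factorial_succ]; ring
      · rw [if_neg hn, if_neg (by omega), if_neg (by omega)]; simp

/-- The moments `E[H_n(W(h)) H_a(W(u))]`. -/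
lemma integral_hermite_mul (hW : IsIsonormal W P) {h : H} (hh : ‖h‖ = 1) (u : H) {n a : ℕ}
    (han : a ≤ n) :
    ∫ ω, hermiteFun n (W h ω) * hermiteFun a (W u ω) ∂P
      = if a = n then n.factorial * ⟪u, h⟫ ^ a else 0 := by
  simpa using integral_hermite_triple hW hh u 0 n a 0 (by omega)

end Cylinder


/-! ### Fourth moments against second moments for vector valued chaoses. -/

section Hypercontractivity

open TensorProduct

universe u

variable {Ω : Type*} {H : Type u} {mΩ : MeasurableSpace Ω} [NormedAddCommGroup H]
  [InnerProductSpace ℝ H] {P : Measure Ω} {W : H → Ω → ℝ}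

/-- Contracting a tensor with x costs at most a factor ‖x‖. With y the contraction, ‖y‖² is the
inner product of the tensor with y ⊗ x, and Cauchy–Schwarz applies. The map t stands for the tensor
product; only its inner product rule is needed. -/
lemma norm_sum_inner_smul_le {V V' ι : Type*} [NormedAddCommGroup V] [InnerProductSpace ℝ V]
    [NormedAddCommGroup V'] [InnerProductSpace ℝ V'] {t : H → V → V'}
    (ht : ∀ x y a b, ⟪t x a, t y b⟫ = ⟪x, y⟫ * ⟪a, b⟫)
    (s : Finset ι) (a : ι → ℝ) (h : ι → H) (v : ι → V) (x : V) :
    ‖∑ j ∈ s, (a j * ⟪v j, x⟫) • h j‖ ^ 2 ≤ ‖x‖ ^ 2 * ‖∑ j ∈ s, a j • t (h j) (v j)‖ ^ 2 := by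
  set y := ∑ j ∈ s, (a j * ⟪v j, x⟫) • h j with hy
  set w := ∑ j ∈ s, a j • t (h j) (v j) with hw
  have h1 : ‖y‖ ^ 2 = ⟪w, t y x⟫ := by
    rw [hw, sum_inner, ← real_inner_self_eq_norm_sq]
    nth_rewrite 1 [hy]
    rw [sum_inner]
    refine Finset.sum_congr rfl fun j _ => ?_
    simp only [inner_smul_left, ht, RCLike.conj_to_real]
    ring
  have hn : ‖t y x‖ = ‖y‖ * ‖x‖ := by
    have : ‖t y x‖ ^ 2 = (‖y‖ * ‖x‖) ^ 2 := by
      rw [← real_inner_self_eq_norm_sq, ht, real_inner_self_eq_norm_sq,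
        real_inner_self_eq_norm_sq]; ring
    exact (pow_left_inj₀ (norm_nonneg _) (by positivity) (by norm_num)).1 this
  have h2 : ‖y‖ ^ 2 ≤ ‖w‖ * (‖y‖ * ‖x‖) := by
    rw [h1, ← hn]
    exact real_inner_le_norm _ _
  rcases eq_or_lt_of_le (norm_nonneg y) with h0 | h0
  · rw [← h0, zero_pow two_ne_zero]; positivity
  · have h3 : ‖y‖ ≤ ‖w‖ * ‖x‖ := by
      refine le_of_mul_le_mul_left ?_ h0
      calc ‖y‖ * ‖y‖ = ‖y‖ ^ 2 := by ring
        _ ≤ _ := h2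
        _ = _ := by ring
    calc ‖y‖ ^ 2 ≤ (‖w‖ * ‖x‖) ^ 2 := by gcongr
      _ = _ := by ring

lemma norm_sum_smul_sq {V ι : Type*} [NormedAddCommGroup V] [InnerProductSpace ℝ V]
    (s : Finset ι) (a : ι → ℝ) (v : ι → V) :
    ‖∑ j ∈ s, a j • v j‖ ^ 2 = ∑ j ∈ s, ∑ i ∈ s, a j * (a i * ⟪v j, v i⟫) := by
  rw [← real_inner_self_eq_norm_sq, sum_inner]
  refine Finset.sum_congr rfl fun j _ => ?_
  rw [inner_sum]
  refine Finset.sum_congr rfl fun i _ => ?_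
  simp only [inner_smul_left, inner_smul_right, RCLike.conj_to_real]; ring

lemma isCyl_inner_hermite_sum {V ι : Type*} [NormedAddCommGroup V] [InnerProductSpace ℝ V]
    (s : Finset ι) (h : ι → H) (v : ι → V) (k : ℕ) (x : V) :
    IsCyl W (fun ω => ⟪x, ∑ j ∈ s, hermiteFun k (W (h j) ω) • v j⟫)
      (fun ω => ∑ j ∈ s, ⟪x, v j⟫ • (k * hermiteFun (k - 1) (W (h j) ω)) • h j) := by
  have := IsCyl.sum s fun j _ => (IsCyl.hermite (W := W) k (h j)).const_mul ⟪x, v j⟫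
  convert this using 2 with ω
  rw [inner_sum]
  exact Finset.sum_congr rfl fun j _ => by rw [inner_smul_right, mul_comm]

lemma isCyl_norm_sq_hermite_sum {V ι : Type*} [NormedAddCommGroup V] [InnerProductSpace ℝ V]
    (s : Finset ι) (h : ι → H) (v : ι → V) (k : ℕ) :
    IsCyl W (fun ω => ‖∑ j ∈ s, hermiteFun k (W (h j) ω) • v j‖ ^ 2)
      (fun ω => (2 * k : ℝ) • ∑ j ∈ s, (hermiteFun (k - 1) (W (h j) ω) *
        ⟪v j, ∑ i ∈ s, hermiteFun k (W (h i) ω) • v i⟫) • h j) := by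
  have := IsCyl.sum s fun j _ => (IsCyl.hermite (W := W) k (h j)).mul
    (isCyl_inner_hermite_sum s h v k (v j))
  convert this using 2 with ω ω
  · rw [← real_inner_self_eq_norm_sq, sum_inner]
    exact Finset.sum_congr rfl fun j _ => by rw [inner_smul_left]; simp
  · rw [Finset.sum_add_distrib, two_mul, add_smul]
    have h2 : ∑ j ∈ s, ⟪v j, ∑ i ∈ s, hermiteFun k (W (h i) ω) • v i⟫ •
        (↑k * hermiteFun (k - 1) (W (h j) ω)) • h j = (k : ℝ) • ∑ j ∈ s,
        (hermiteFun (k - 1) (W (h j) ω) * ⟪v j, ∑ i ∈ s, hermiteFun k (W (h i) ω) • v i⟫) • h j := by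
      rw [Finset.smul_sum]
      refine Finset.sum_congr rfl fun j _ => ?_
      rw [smul_smul, smul_smul]; congr 1; ring
    rw [h2]
    congr 1
    rw [← h2]
    simp_rw [Finset.smul_sum]
    rw [Finset.sum_comm]
    refine Finset.sum_congr rfl fun j _ => ?_
    simp_rw [smul_smul]
    rw [← Finset.sum_smul]
    congr 1
    rw [inner_sum, Finset.sum_mul]
    refine Finset.sum_congr rfl fun i _ => ?_
    rw [inner_smul_right, real_inner_comm]; ring


/-- `E‖∑ H_{k+1}(W(h_j)) v_j‖² = (k+1) E‖∑ H_k(W(h_j)) h_j ⊗ v_j‖²`. -/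
lemma integral_norm_sq_hermite_succ (hW : IsIsonormal W P)
    {V V' ι : Type*} [NormedAddCommGroup V] [InnerProductSpace ℝ V]
    [NormedAddCommGroup V'] [InnerProductSpace ℝ V'] {t : H → V → V'}
    (ht : ∀ x y a b, ⟪t x a, t y b⟫ = ⟪x, y⟫ * ⟪a, b⟫)
    (s : Finset ι) (h : ι → H) (hh : ∀ j ∈ s, ‖h j‖ = 1) (v : ι → V) (k : ℕ) :
    ∫ ω, ‖∑ j ∈ s, hermiteFun (k + 1) (W (h j) ω) • v j‖ ^ 2 ∂P
      = (k + 1) * ∫ ω, ‖∑ j ∈ s, hermiteFun k (W (h j) ω) • t (h j) (v j)‖ ^ 2 ∂P := by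
  have hc := fun x : V => isCyl_inner_hermite_sum (W := W) s h v (k + 1) x
  have e1 : ∀ ω, ‖∑ j ∈ s, hermiteFun (k + 1) (W (h j) ω) • v j‖ ^ 2
      = ∑ j ∈ s, hermiteFun (k + 1) (W (h j) ω) *
        ⟪v j, ∑ i ∈ s, hermiteFun (k + 1) (W (h i) ω) • v i⟫ := by
    intro ω
    rw [← real_inner_self_eq_norm_sq, sum_inner]
    exact Finset.sum_congr rfl fun j _ => by rw [inner_smul_left]; simp
  simp_rw [e1]
  rw [integral_finsetSum _ fun j _ => ((IsCyl.hermite _ _).mul (hc _)).integrable hW,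
    Finset.sum_congr rfl fun j hj => (hc (v j)).stein_hermite hW (hh j hj) k]
  have hi : ∀ j, Integrable (fun ω => hermiteFun k (W (h j) ω) * ⟪∑ i ∈ s, ⟪v j, v i⟫ •
      (((k + 1 : ℕ) : ℝ) * hermiteFun (k + 1 - 1) (W (h i) ω)) • h i, h j⟫) P := fun j => by
    obtain ⟨D, hD⟩ := (hc (v j)).inner_deriv (h j)
    exact ((IsCyl.hermite k (h j)).mul hD).integrable hW
  rw [← integral_finsetSum _ fun j _ => hi j, ← integral_const_mul]
  congr 1
  ext ω
  rw [norm_sum_smul_sq, Finset.mul_sum]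
  refine Finset.sum_congr rfl fun j _ => ?_
  rw [sum_inner, Finset.mul_sum, Finset.mul_sum]
  refine Finset.sum_congr rfl fun i _ => ?_
  simp only [inner_smul_left, ht, RCLike.conj_to_real, Nat.add_sub_cancel,
    real_inner_comm (h i) (h j)]
  push_cast; ring

/-- Write u for the sum on the left and w for the one on the right. Integrating by parts in E⟨u,
u⟩‖u‖² lowers one Hermite factor and produces (k+1) E[2‖y‖² + ‖u‖²‖w‖²], where y is the contraction
of w with u; so ‖y‖² ≤ ‖u‖²‖w‖². The inequality 3(k+1)‖u‖²‖w‖² ≤ ½‖u‖⁴ + (9/2)(k+1)²‖w‖⁴ then lets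
half of the left side be absorbed. -/
lemma integral_norm_pow_four_hermite_succ (hW : IsIsonormal W P)
    {V V' ι : Type*} [NormedAddCommGroup V] [InnerProductSpace ℝ V]
    [NormedAddCommGroup V'] [InnerProductSpace ℝ V'] {t : H → V → V'}
    (ht : ∀ x y a b, ⟪t x a, t y b⟫ = ⟪x, y⟫ * ⟪a, b⟫)
    (s : Finset ι) (h : ι → H) (hh : ∀ j ∈ s, ‖h j‖ = 1) (v : ι → V) (k : ℕ) :
    ∫ ω, ‖∑ j ∈ s, hermiteFun (k + 1) (W (h j) ω) • v j‖ ^ 4 ∂P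
      ≤ 9 * (k + 1) ^ 2 *
        ∫ ω, ‖∑ j ∈ s, hermiteFun k (W (h j) ω) • t (h j) (v j)‖ ^ 4 ∂P := by
  have hc := fun x : V => isCyl_inner_hermite_sum (W := W) s h v (k + 1) x
  have hS := isCyl_norm_sq_hermite_sum (W := W) s h v (k + 1)
  have hT := isCyl_norm_sq_hermite_sum (W := W) s h (fun j => t (h j) (v j)) k
  set u : Ω → V := fun ω => ∑ j ∈ s, hermiteFun (k + 1) (W (h j) ω) • v j with hu
  set w : Ω → V' := fun ω => ∑ j ∈ s, hermiteFun k (W (h j) ω) • t (h j) (v j) with hw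
  set y : Ω → H := fun ω => ∑ j ∈ s, (hermiteFun k (W (h j) ω) * ⟪v j, u ω⟫) • h j with hy
  have hi1 : Integrable (fun ω => ‖u ω‖ ^ 4) P := by
    refine ((hS.mul hS).integrable hW).congr (Filter.Eventually.of_forall fun ω => ?_)
    simp only [hu]; ring
  have hi2 : Integrable (fun ω => ‖w ω‖ ^ 4) P := by
    refine ((hT.mul hT).integrable hW).congr (Filter.Eventually.of_forall fun ω => ?_)
    simp only [hw]; ring
  have key : ∫ ω, ‖u ω‖ ^ 4 ∂P
      = ∫ ω, (k + 1) * (2 * ‖y ω‖ ^ 2 + ‖u ω‖ ^ 2 * ‖w ω‖ ^ 2) ∂P := by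
    have e1 : ∀ ω, ‖u ω‖ ^ 4 = ∑ j ∈ s, hermiteFun (k + 1) (W (h j) ω) *
        (⟪v j, u ω⟫ * ‖u ω‖ ^ 2) := by
      intro ω
      rw [show ‖u ω‖ ^ 4 = ‖u ω‖ ^ 2 * ‖u ω‖ ^ 2 by ring]
      nth_rewrite 1 [← real_inner_self_eq_norm_sq]
      nth_rewrite 1 [hu]
      rw [sum_inner, Finset.sum_mul]
      exact Finset.sum_congr rfl fun j _ => by rw [inner_smul_left]; simp; ring
    have hU := fun j => (hc (v j)).mul hS
    simp_rw [e1]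
    rw [integral_finsetSum _ fun j _ => ((IsCyl.hermite _ _).mul (hU j)).integrable hW,
      Finset.sum_congr rfl fun j hj => (hU j).stein_hermite hW (hh j hj) k]
    rw [← integral_finsetSum]
    · congr 1
      ext ω
      simp only [Nat.add_sub_cancel, inner_add_left, inner_smul_left, RCLike.conj_to_real]
      have e2 : ∑ j ∈ s, hermiteFun k (W (h j) ω) * (⟪v j, u ω⟫ * (2 * ((k + 1 : ℕ) : ℝ) *
          ⟪y ω, h j⟫)) = (k + 1) * (2 * ‖y ω‖ ^ 2) := by
        rw [← real_inner_self_eq_norm_sq]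
        nth_rewrite 3 [hy]
        rw [inner_sum, Finset.mul_sum, Finset.mul_sum]
        refine Finset.sum_congr rfl fun j _ => ?_
        rw [inner_smul_right]; push_cast; ring
      have e3 : ∑ j ∈ s, hermiteFun k (W (h j) ω) * (‖u ω‖ ^ 2 * ⟪∑ i ∈ s, ⟪v j, v i⟫ •
          (((k + 1 : ℕ) : ℝ) * hermiteFun k (W (h i) ω)) • h i, h j⟫)
          = (k + 1) * (‖u ω‖ ^ 2 * ‖w ω‖ ^ 2) := by
        rw [show ‖w ω‖ ^ 2 = _ from norm_sum_smul_sq s _ _, Finset.mul_sum, Finset.mul_sum]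
        refine Finset.sum_congr rfl fun j _ => ?_
        rw [sum_inner, Finset.mul_sum, Finset.mul_sum, Finset.mul_sum, Finset.mul_sum]
        refine Finset.sum_congr rfl fun i _ => ?_
        simp only [inner_smul_left, ht, RCLike.conj_to_real,
          real_inner_comm (h i) (h j)]
        push_cast; ring
      rw [mul_add, ← e2, ← e3, ← Finset.sum_add_distrib]
      exact Finset.sum_congr rfl fun j _ => by rw [mul_add]
    · intro j _
      obtain ⟨D, hD⟩ := (hU j).inner_deriv (h j)
      exact ((IsCyl.hermite k (h j)).mul hD).integrable hW
  have hle : ∫ ω, (k + 1) * (2 * ‖y ω‖ ^ 2 + ‖u ω‖ ^ 2 * ‖w ω‖ ^ 2) ∂P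
      ≤ ∫ ω, (1 / 2 * ‖u ω‖ ^ 4 + 9 * (k + 1) ^ 2 / 2 * ‖w ω‖ ^ 4) ∂P := by
    refine integral_mono_of_nonneg (Filter.Eventually.of_forall fun ω => by positivity)
      ((hi1.const_mul _).add (hi2.const_mul _)) (Filter.Eventually.of_forall fun ω => ?_)
    have h1 : ‖y ω‖ ^ 2 ≤ ‖u ω‖ ^ 2 * ‖w ω‖ ^ 2 := norm_sum_inner_smul_le ht s _ h v (u ω)
    have h2 : (k + 1 : ℝ) * (2 * ‖y ω‖ ^ 2 + ‖u ω‖ ^ 2 * ‖w ω‖ ^ 2)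
        ≤ (k + 1) * (3 * (‖u ω‖ ^ 2 * ‖w ω‖ ^ 2)) := by gcongr; linarith
    have h3 := sq_nonneg (‖u ω‖ ^ 2 - 3 * (k + 1) * ‖w ω‖ ^ 2)
    dsimp only
    nlinarith
  rw [← key, integral_add (hi1.const_mul _) (hi2.const_mul _), integral_const_mul,
    integral_const_mul] at hle
  linarith

/-- The coefficient space grows by a tensor factor H at each step of the induction on the order; the
common universe keeps the induction hypothesis applicable to the new space. -/
lemma exists_tensor (V : Type u) [NormedAddCommGroup V] [InnerProductSpace ℝ V] :
    ∃ (V' : Type u) (_ : NormedAddCommGroup V') (_ : InnerProductSpace ℝ V') (t : H → V → V'),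
      ∀ x y a b, ⟪t x a, t y b⟫ = ⟪x, y⟫ * ⟪a, b⟫ :=
  ⟨H ⊗[ℝ] V, TensorProduct.instNormedAddCommGroup, TensorProduct.instInnerProductSpace,
    fun x a => x ⊗ₜ[ℝ] a, fun x y a b => TensorProduct.inner_tmul (𝕜 := ℝ) x y a b⟩

/-- **Hypercontractivity** (fourth moments) for vector valued elements of a Wiener chaos. -/
theorem integral_norm_pow_four_hermite_le (hW : IsIsonormal W P)
    {ι : Type*} (s : Finset ι) (h : ι → H)
    (hh : ∀ j ∈ s, ‖h j‖ = 1) (k : ℕ) :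
    ∀ {V : Type u} [NormedAddCommGroup V] [InnerProductSpace ℝ V] (v : ι → V),
    ∫ ω, ‖∑ j ∈ s, hermiteFun k (W (h j) ω) • v j‖ ^ 4 ∂P
      ≤ 9 ^ k * (∫ ω, ‖∑ j ∈ s, hermiteFun k (W (h j) ω) • v j‖ ^ 2 ∂P) ^ 2 := by
  have := hW.isProbabilityMeasure
  induction k with
  | zero => intro V _ _ v; simp; apply le_of_eq; ring
  | succ k ih =>
    intro V _ _ v
    obtain ⟨V', _, _, t, ht⟩ := exists_tensor (H := H) V
    rw [integral_norm_sq_hermite_succ hW ht s h hh v k]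
    refine (integral_norm_pow_four_hermite_succ hW ht s h hh v k).trans ?_
    refine (mul_le_mul_of_nonneg_left (ih fun j => t (h j) (v j)) (by positivity)).trans ?_
    apply le_of_eq
    ring

theorem eLpNorm_four_hermite_le (hW : IsIsonormal W P)
    {ι : Type*} (s : Finset ι) (h : ι → H)
    (hh : ∀ j ∈ s, ‖h j‖ = 1) (k : ℕ) {V : Type u} [NormedAddCommGroup V] [InnerProductSpace ℝ V]
    (v : ι → V) :
    eLpNorm (fun ω => ∑ j ∈ s, hermiteFun k (W (h j) ω) • v j) 4 P
      ≤ ENNReal.ofReal (3 ^ k) *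
        eLpNorm (fun ω => ∑ j ∈ s, hermiteFun k (W (h j) ω) • v j) 2 P := by
  have hm : ∀ p : ENNReal, p ≠ ⊤ →
      MemLp (fun ω => ∑ j ∈ s, hermiteFun k (W (h j) ω) • v j) p P := by
    intro p hp
    refine memLp_finsetSum s fun j _ => ?_
    have hm : MemLp (fun ω => hermiteFun k (W (h j) ω)) p P := (IsCyl.hermite k (h j)).memLp hW hp
    exact (ContinuousLinearMap.toSpanSingleton ℝ (v j)).comp_memLp' hm
  rw [(hm 4 (by simp)).eLpNorm_eq_integral_rpow_norm (by simp) (by simp),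
    (hm 2 (by simp)).eLpNorm_eq_integral_rpow_norm (by simp) (by simp),
    ← ENNReal.ofReal_mul (by positivity)]
  refine ENNReal.ofReal_le_ofReal ?_
  have h4 : (4 : ENNReal).toReal = (4 : ℕ) := by simp
  have h2 : (2 : ENNReal).toReal = (2 : ℕ) := by simp
  rw [h4, h2]
  simp only [Real.rpow_natCast]
  have key := integral_norm_pow_four_hermite_le hW s h hh k v
  set a := ∫ ω, ‖∑ j ∈ s, hermiteFun k (W (h j) ω) • v j‖ ^ 4 ∂P
  set b := ∫ ω, ‖∑ j ∈ s, hermiteFun k (W (h j) ω) • v j‖ ^ 2 ∂P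
  have ha : 0 ≤ a := integral_nonneg fun ω => by positivity
  have hb : 0 ≤ b := integral_nonneg fun ω => by positivity
  rw [Real.rpow_inv_le_iff_of_pos ha (by positivity) (by norm_num), Real.rpow_natCast]
  refine key.trans ?_
  have hb4 : (b ^ (((2 : ℕ) : ℝ)⁻¹)) ^ 4 = b ^ 2 := by
    rw [show (4 : ℕ) = 2 * 2 by norm_num, pow_mul, Real.rpow_inv_natCast_pow hb (by norm_num)]
  -- The sharp consequence of the fourth moment bound has constant 3^(k/2); the cruder 3^k only
  -- requires 9 ≤ 3^4.
  rw [mul_pow, hb4, ← pow_mul, mul_comm k 4, pow_mul]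
  gcongr
  norm_num

end Hypercontractivity


/-! ### Closed sums of chaoses, orthogonality, and the inverse generator. -/

section ChaosSpaces

universe u

variable {Ω : Type*} {H : Type u} {mΩ : MeasurableSpace Ω} [NormedAddCommGroup H]
  [InnerProductSpace ℝ H] {P : Measure Ω} {W : H → Ω → ℝ}

/-- The class of `H_q(W(h))` in `L²(P)`. -/
noncomputable def hermiteL2 (hW : IsIsonormal W P) (q : ℕ) (h : H) : Lp ℝ 2 P :=
  ((IsCyl.hermite q h).memLp hW (p := 2) (by simp)).toLp

lemma coeFn_hermiteL2 (hW : IsIsonormal W P) (q : ℕ) (h : H) :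
    hermiteL2 hW q h =ᵐ[P] fun ω => hermiteFun q (W h ω) := MemLp.coeFn_toLp _

lemma hermiteL2_zero (hW : IsIsonormal W P) (h h' : H) :
    hermiteL2 hW 0 h = hermiteL2 hW 0 h' := by
  refine Lp.ext ?_
  filter_upwards [coeFn_hermiteL2 hW 0 h, coeFn_hermiteL2 hW 0 h'] with ω h1 h2
  rw [h1, h2]; simp

/-- Indices of the generators of the chaoses of order at most `n`. -/
abbrev GenIdx (H : Type*) [NormedAddCommGroup H] (n : ℕ) : Type _ :=
  {p : ℕ × H // p.1 ≤ n ∧ (p.1 = 0 ∨ ‖p.2‖ = 1)}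

/-- The generators of the chaoses of order at most `n`. -/
noncomputable def gen (hW : IsIsonormal W P) (n : ℕ) (p : GenIdx H n) : Lp ℝ 2 P :=
  hermiteL2 hW p.1.1 p.1.2

/-- The closed sum of the Wiener chaoses of order at most `n`. -/
noncomputable def chaosLE (hW : IsIsonormal W P) (n : ℕ) : Submodule ℝ (Lp ℝ 2 P) :=
  (Submodule.span ℝ (Set.range (gen hW n))).topologicalClosure

instance (hW : IsIsonormal W P) (n : ℕ) : CompleteSpace (chaosLE hW n) :=
  (Submodule.isClosed_topologicalClosure _).completeSpace_coe

lemma isClosed_chaosLE (hW : IsIsonormal W P) (n : ℕ) :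
    IsClosed (chaosLE hW n : Set (Lp ℝ 2 P)) := Submodule.isClosed_topologicalClosure _

lemma hermiteL2_mem_chaosLE (hW : IsIsonormal W P) {n q : ℕ} (hq : q ≤ n) {h : H}
    (hh : q = 0 ∨ ‖h‖ = 1) : hermiteL2 hW q h ∈ chaosLE hW n :=
  Submodule.le_topologicalClosure _ (Submodule.subset_span ⟨⟨(q, h), hq, hh⟩, rfl⟩)

lemma chaosLE_le_of_closed (hW : IsIsonormal W P) {n : ℕ} {S : Submodule ℝ (Lp ℝ 2 P)}
    (hS : IsClosed (S : Set (Lp ℝ 2 P)))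
    (h : ∀ q ≤ n, ∀ h : H, (q = 0 ∨ ‖h‖ = 1) → hermiteL2 hW q h ∈ S) : chaosLE hW n ≤ S := by
  refine Submodule.topologicalClosure_minimal _ (Submodule.span_le.2 ?_) hS
  rintro _ ⟨⟨⟨q, g⟩, hq, hg⟩, rfl⟩
  exact h q hq g hg

/-- The density principle behind most identities below: once both sides are bounded operators, only
Hermite variables need checking. -/
lemma chaosLE_ext (hW : IsIsonormal W P) {n : ℕ} {E : Type*} [NormedAddCommGroup E]
    [NormedSpace ℝ E] {T S : Lp ℝ 2 P →L[ℝ] E}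
    (h : ∀ q ≤ n, ∀ h : H, (q = 0 ∨ ‖h‖ = 1) → T (hermiteL2 hW q h) = S (hermiteL2 hW q h))
    {F : Lp ℝ 2 P} (hF : F ∈ chaosLE hW n) : T F = S F := by
  have := chaosLE_le_of_closed hW (n := n) (S := LinearMap.ker (T - S).toLinearMap)
    (T - S).isClosed_ker (fun q hq g hg => by simp [h q hq g hg]) hF
  simpa [sub_eq_zero] using this

lemma chaosLE_map_mem (hW : IsIsonormal W P) {n : ℕ} {E : Type*} [NormedAddCommGroup E]
    [NormedSpace ℝ E] {T : Lp ℝ 2 P →L[ℝ] E} {S : Submodule ℝ E} (hS : IsClosed (S : Set E))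
    (h : ∀ q ≤ n, ∀ h : H, (q = 0 ∨ ‖h‖ = 1) → T (hermiteL2 hW q h) ∈ S)
    {F : Lp ℝ 2 P} (hF : F ∈ chaosLE hW n) : T F ∈ S :=
  chaosLE_le_of_closed hW (n := n) (S := S.comap T.toLinearMap)
    (hS.preimage T.continuous) (fun q hq g hg => h q hq g hg) hF

lemma chaosLE_mono (hW : IsIsonormal W P) {m n : ℕ} (h : m ≤ n) :
    chaosLE hW m ≤ chaosLE hW n :=
  chaosLE_le_of_closed hW (isClosed_chaosLE hW n)
    fun _ hq _ hg => hermiteL2_mem_chaosLE hW (hq.trans h) hg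

lemma hermiteL2_mem_chaos (hW : IsIsonormal W P) {q : ℕ} {h : H}
    (hh : q = 0 ∨ ‖h‖ = 1) : hermiteL2 hW q h ∈ chaos W P q :=
  Submodule.le_topologicalClosure _ (Submodule.subset_span ⟨h, hh, coeFn_hermiteL2 hW q h⟩)

lemma chaos_le_of_closed (hW : IsIsonormal W P) {q : ℕ} {S : Submodule ℝ (Lp ℝ 2 P)}
    (hS : IsClosed (S : Set (Lp ℝ 2 P)))
    (h : ∀ h : H, (q = 0 ∨ ‖h‖ = 1) → hermiteL2 hW q h ∈ S) : chaos W P q ≤ S := by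
  refine Submodule.topologicalClosure_minimal _ (Submodule.span_le.2 ?_) hS
  rintro X ⟨g, hg, hX⟩
  have : X = hermiteL2 hW q g := Lp.ext (hX.trans (coeFn_hermiteL2 hW q g).symm)
  rw [this]
  exact h g hg

lemma chaos_le_chaosLE (hW : IsIsonormal W P) {q n : ℕ} (hq : q ≤ n) :
    chaos W P q ≤ chaosLE hW n :=
  chaos_le_of_closed hW (isClosed_chaosLE hW n) fun _ hg => hermiteL2_mem_chaosLE hW hq hg

lemma iSup_chaos_le (hW : IsIsonormal W P) (M : ℕ) :
    ⨆ q ∈ Finset.Icc 1 M, chaos W P q ≤ chaosLE hW M :=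
  iSup₂_le fun _ hq => chaos_le_chaosLE hW (Finset.mem_Icc.1 hq).2

lemma inner_toLp_toLp {V : Type*} [NormedAddCommGroup V] [InnerProductSpace ℝ V] {f g : Ω → V}
    (hf : MemLp f 2 P) (hg : MemLp g 2 P) : ⟪hf.toLp f, hg.toLp g⟫ = ∫ ω, ⟪f ω, g ω⟫ ∂P := by
  rw [L2.inner_def]
  refine integral_congr_ae ?_
  filter_upwards [hf.coeFn_toLp, hg.coeFn_toLp] with ω h1 h2
  rw [h1, h2]

lemma inner_hermiteL2 (hW : IsIsonormal W P) (p q : ℕ) (h g : H) :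
    ⟪hermiteL2 hW p h, hermiteL2 hW q g⟫
      = ∫ ω, hermiteFun p (W h ω) * hermiteFun q (W g ω) ∂P := by
  rw [hermiteL2, hermiteL2, inner_toLp_toLp]
  simp [mul_comm]

/-- Integration by parts moves all n derivatives onto the factor of lower order, so only the vector
of the higher order factor must be normalised. -/
lemma inner_hermiteL2_of_le (hW : IsIsonormal W P) {n q : ℕ} (hqn : q ≤ n) {h : H}
    (hh : n = 0 ∨ ‖h‖ = 1) (g : H) :
    ⟪hermiteL2 hW n h, hermiteL2 hW q g⟫ = if q = n then n.factorial * ⟪g, h⟫ ^ q else 0 := by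
  have := hW.isProbabilityMeasure
  rw [inner_hermiteL2]
  rcases eq_or_ne n 0 with rfl | hn
  · obtain rfl : q = 0 := by omega
    simp
  · exact integral_hermite_mul hW (hh.resolve_left hn) g hqn

lemma inner_hermiteL2_of_ne (hW : IsIsonormal W P) {p q : ℕ} (hpq : p ≠ q) {h g : H}
    (hh : p = 0 ∨ ‖h‖ = 1) (hg : q = 0 ∨ ‖g‖ = 1) :
    ⟪hermiteL2 hW p h, hermiteL2 hW q g⟫ = 0 := by
  rcases lt_or_gt_of_ne hpq with h1 | h1
  · rw [real_inner_comm, inner_hermiteL2_of_le hW h1.le hg, if_neg hpq]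
  · rw [inner_hermiteL2_of_le hW h1.le hh, if_neg hpq.symm]

lemma starProjection_chaos_hermiteL2 (hW : IsIsonormal W P) (r q : ℕ) {h : H}
    (hh : q = 0 ∨ ‖h‖ = 1) :
    (chaos W P r).starProjection (hermiteL2 hW q h) = if q = r then hermiteL2 hW q h else 0 := by
  split_ifs with hqr
  · subst hqr
    exact Submodule.starProjection_eq_self_iff.2 (hermiteL2_mem_chaos hW hh)
  · rw [Submodule.starProjection_apply_eq_zero_iff, Submodule.mem_orthogonal]
    intro X hX
    have : chaos W P r ≤ (Submodule.span ℝ {hermiteL2 hW q h})ᗮ :=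
      chaos_le_of_closed hW (Submodule.isClosed_orthogonal _) fun g hg => by
        rw [Submodule.mem_orthogonal_singleton_iff_inner_left]
        exact inner_hermiteL2_of_ne hW (Ne.symm hqr) hg hh
    exact Submodule.mem_orthogonal_singleton_iff_inner_left.1 (this hX)

lemma starProjection_chaos_mem_chaosLE (hW : IsIsonormal W P) {n : ℕ} (r : ℕ) {F : Lp ℝ 2 P}
    (hF : F ∈ chaosLE hW n) : (chaos W P r).starProjection F ∈ chaosLE hW n := by
  refine chaosLE_map_mem hW (isClosed_chaosLE hW n) (fun q hq h hh => ?_) hF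
  rw [starProjection_chaos_hermiteL2 hW r q hh]
  split_ifs
  · exact hermiteL2_mem_chaosLE hW hq hh
  · exact zero_mem _

lemma starProjection_chaos_eq_zero (hW : IsIsonormal W P) {n r : ℕ} (hnr : n < r)
    {F : Lp ℝ 2 P} (hF : F ∈ chaosLE hW n) : (chaos W P r).starProjection F = 0 := by
  have := chaosLE_ext hW (T := (chaos W P r).starProjection) (S := 0) (fun q hq h hh => by
    rw [starProjection_chaos_hermiteL2 hW r q hh, if_neg (by omega)]; simp) hF
  simpa using this

lemma starProjection_chaos_of_mem_ne (hW : IsIsonormal W P) {q r : ℕ} (hqr : q ≠ r)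
    {F : Lp ℝ 2 P} (hF : F ∈ chaos W P q) : (chaos W P r).starProjection F = 0 := by
  have := chaos_le_of_closed hW (S := LinearMap.ker (chaos W P r).starProjection.toLinearMap)
    ((chaos W P r).starProjection).isClosed_ker (fun h hh => by
      change (chaos W P r).starProjection _ = 0
      rw [starProjection_chaos_hermiteL2 hW r q hh, if_neg hqr]) hF
  exact this

lemma sub_starProjection_chaos_mem (hW : IsIsonormal W P) {n : ℕ} {F : Lp ℝ 2 P}
    (hF : F ∈ chaosLE hW (n + 1)) :
    F - (chaos W P (n + 1)).starProjection F ∈ chaosLE hW n := by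
  refine chaosLE_map_mem hW (T := .id ℝ _ - (chaos W P (n + 1)).starProjection)
    (isClosed_chaosLE hW n) (fun q hq h hh => ?_) hF
  simp only [sub_apply, ContinuousLinearMap.id_apply,
    starProjection_chaos_hermiteL2 hW (n + 1) q hh]
  split_ifs with h1
  · simp
  · simpa using hermiteL2_mem_chaosLE hW (by omega) hh

/-- The decomposition of an element of a finite sum of chaoses. -/
lemma sum_starProjection_chaos (hW : IsIsonormal W P) {n : ℕ} {F : Lp ℝ 2 P}
    (hF : F ∈ chaosLE hW n) :
    ∑ q ∈ Finset.range (n + 1), (chaos W P q).starProjection F = F := by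
  have := chaosLE_ext hW (T := ∑ q ∈ Finset.range (n + 1), (chaos W P q).starProjection)
    (S := .id ℝ _) (fun q hq h hh => by
      simp only [sum_apply, starProjection_chaos_hermiteL2 hW _ q hh]
      simp; omega) hF
  simpa using this

/-- `L⁻¹` on a finite sum of chaoses, as a bounded operator. -/
noncomputable def invGen (W : H → Ω → ℝ) (P : Measure Ω) (n : ℕ) : Lp ℝ 2 P →L[ℝ] Lp ℝ 2 P :=
  ∑ q ∈ Finset.range n, (-(1 / ((q : ℝ) + 1))) • (chaos W P (q + 1)).starProjection

lemma pseudoInverse_eq (hW : IsIsonormal W P) {n : ℕ} {F : Lp ℝ 2 P} (hF : F ∈ chaosLE hW n) :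
    pseudoInverse W P F = invGen W P n F := by
  rw [pseudoInverse, tsum_eq_sum (s := Finset.range n)]
  · simp [invGen]
  · intro q hq
    rw [starProjection_chaos_eq_zero hW (by simpa using hq) hF, smul_zero]

/-- For q = 0 the convention 1 / 0 = 0 expresses that L⁻¹ kills constants. -/
lemma invGen_hermiteL2 (hW : IsIsonormal W P) {n q : ℕ} (hq : q ≤ n) {h : H}
    (hh : q = 0 ∨ ‖h‖ = 1) :
    invGen W P n (hermiteL2 hW q h) = (-(1 / (q : ℝ))) • hermiteL2 hW q h := by
  simp only [invGen, sum_apply, smul_apply,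
    starProjection_chaos_hermiteL2 hW _ q hh]
  rcases q with _ | q
  · simp
  · rw [Finset.sum_eq_single q]
    · simp
    · intro b _ hb
      rw [if_neg (by omega), smul_zero]
    · intro h; simp at h; omega

lemma invGen_mem (hW : IsIsonormal W P) {m n : ℕ} {F : Lp ℝ 2 P} (hF : F ∈ chaosLE hW n) :
    invGen W P m F ∈ chaosLE hW n := by
  rw [invGen, sum_apply]
  exact Submodule.sum_mem _ fun q _ => Submodule.smul_mem _ _
    (starProjection_chaos_mem_chaosLE hW _ hF)

end ChaosSpaces


/-! ### Closability of D and its boundedness on finite sums of chaoses. -/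

section Derivative

instance : Fact ((1 : ENNReal) ≤ 4) := ⟨by norm_num⟩

universe u

variable {Ω : Type*} {H : Type u} {mΩ : MeasurableSpace Ω} [NormedAddCommGroup H]
  [InnerProductSpace ℝ H] {P : Measure Ω} {W : H → Ω → ℝ}

lemma mem_cylindricalGraph_iff {p : Lp ℝ 2 P × Lp H 2 P} :
    p ∈ cylindricalGraph W P ↔ ∃ U DU, IsCyl W U DU ∧ p.1 =ᵐ[P] U ∧ p.2 =ᵐ[P] DU := by
  constructor
  · rintro ⟨n, φ, g, hg, h1, h2⟩
    exact ⟨_, _, ⟨n, φ, g, hg, fun _ => rfl, fun _ => rfl⟩, h1, h2⟩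
  · rintro ⟨U, DU, ⟨n, φ, g, hg, h1, h2⟩, h3, h4⟩
    refine ⟨n, φ, g, hg, ?_, ?_⟩
    · rwa [← funext h1]
    · rwa [← funext h2]

/-- Integration by parts for the closure of the derivative. -/
lemma inner_of_mem_closure (hW : IsIsonormal W P) {p : Lp ℝ 2 P × Lp H 2 P}
    (hp : p ∈ closure (cylindricalGraph W P)) {V : Ω → ℝ} {DV : Ω → H} (hV : IsCyl W V DV)
    (h : H) (hm : MemLp (fun ω => V ω • h) 2 P)
    (hm' : MemLp (fun ω => W h ω * V ω - ⟪DV ω, h⟫) 2 P) :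
    ⟪p.2, hm.toLp⟫ = ⟪p.1, hm'.toLp⟫ := by
  have hcl : IsClosed {p : Lp ℝ 2 P × Lp H 2 P | ⟪p.2, hm.toLp⟫ = ⟪p.1, hm'.toLp⟫} :=
    isClosed_eq (by fun_prop) (by fun_prop)
  refine closure_minimal (fun p hp => ?_) hcl hp
  obtain ⟨U, DU, hU, h1, h2⟩ := mem_cylindricalGraph_iff.1 hp
  change ⟪p.2, hm.toLp⟫ = ⟪p.1, hm'.toLp⟫
  rw [L2.inner_def, L2.inner_def]
  obtain ⟨D1, hD1⟩ := hU.inner_deriv h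
  obtain ⟨D2, hD2⟩ := hV.inner_deriv h
  have e1 : ∫ ω, ⟪p.2 ω, hm.toLp _ ω⟫ ∂P = ∫ ω, V ω * ⟪DU ω, h⟫ ∂P := by
    refine integral_congr_ae ?_
    filter_upwards [h2, hm.coeFn_toLp] with ω h3 h4
    rw [h3, h4, inner_smul_right]
  have e2 : ∫ ω, ⟪p.1 ω, hm'.toLp _ ω⟫ ∂P
      = ∫ ω, (W h ω * (U ω * V ω) - U ω * ⟪DV ω, h⟫) ∂P := by
    refine integral_congr_ae ?_
    filter_upwards [h1, hm'.coeFn_toLp] with ω h3 h4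
    rw [h3, h4]
    simp; ring
  rw [e1, e2, integral_sub (((IsCyl.of_apply h).mul (hU.mul hV)).integrable hW)
    ((hU.mul hD2).integrable hW), (hU.mul hV).stein hW h]
  simp_rw [inner_add_left, inner_smul_left]
  rw [integral_add]
  · simp
  · simpa using (hU.mul hD2).integrable hW
  · simpa using (hV.mul hD1).integrable hW

/-- The Malliavin derivative is closable. -/
lemma closure_cylindricalGraph_unique [CompleteSpace H] [TopologicalSpace.SeparableSpace H]
    (hW : IsIsonormal W P) {F : Lp ℝ 2 P} {U U' : Lp H 2 P}
    (h : (F, U) ∈ closure (cylindricalGraph W P)) (h' : (F, U') ∈ closure (cylindricalGraph W P)) :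
    U = U' := by
  set Z := U - U' with hZ
  -- Density of the test fields is avoided. With R the map z ↦ ⟨x, z⟩ x, the field R(DV) = ⟨DV, x⟩ x
  -- is an admissible test field for cylindrical V, and against it U and U' have the same pairing.
  -- Hence Z is orthogonal to R X for every X in the range of the closure.
  have key : ∀ x : H, ∀ X : Lp H 2 P, (∃ G, (G, X) ∈ closure (cylindricalGraph W P)) →
      ⟪Z, ((ContinuousLinearMap.toSpanSingleton ℝ x).comp (innerSL ℝ x)).compLp X⟫ = 0 := by
    rintro x X ⟨G, hG⟩
    have hcl : IsClosed {p : Lp ℝ 2 P × Lp H 2 P | ⟪Z,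
        ((ContinuousLinearMap.toSpanSingleton ℝ x).comp (innerSL ℝ x)).compLpL 2 P p.2⟫ = 0} :=
      isClosed_eq (by fun_prop) (by fun_prop)
    refine closure_minimal (fun p hp => ?_) hcl hG
    obtain ⟨V, DV, hV, h1, h2⟩ := mem_cylindricalGraph_iff.1 hp
    obtain ⟨D, hD⟩ := hV.inner_deriv x
    obtain ⟨D', hD'⟩ := hD.inner_deriv x
    have hm : MemLp (fun ω => ⟪DV ω, x⟫ • x) 2 P :=
      (ContinuousLinearMap.toSpanSingleton ℝ x).comp_memLp' (hD.memLp hW (by simp))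
    have hm' : MemLp (fun ω => W x ω * ⟪DV ω, x⟫ - ⟪D ω, x⟫) 2 P :=
      (((IsCyl.of_apply x).mul hD).memLp hW (by simp)).sub (hD'.memLp hW (by simp))
    have e : ((ContinuousLinearMap.toSpanSingleton ℝ x).comp (innerSL ℝ x)).compLpL 2 P p.2
        = hm.toLp := by
      refine Lp.ext ?_
      filter_upwards [ContinuousLinearMap.coeFn_compLpL
        ((ContinuousLinearMap.toSpanSingleton ℝ x).comp (innerSL ℝ x)) p.2, h2,
        hm.coeFn_toLp] with ω h3 h4 h5
      rw [h3, h4, h5]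
      simp [real_inner_comm]
    change ⟪Z, ((ContinuousLinearMap.toSpanSingleton ℝ x).comp (innerSL ℝ x)).compLpL 2 P p.2⟫ = 0
    rw [e, hZ, inner_sub_left, inner_of_mem_closure hW h hD x hm hm',
      inner_of_mem_closure hW h' hD x hm hm', sub_self]
  -- Z is itself a difference of two such X, so E⟨x, Z⟩² = ⟨Z, R Z⟩ = 0.
  have h0 : ∀ x : H, ∀ᵐ ω ∂P, ⟪x, Z ω⟫ = 0 := by
    intro x
    set R := (ContinuousLinearMap.toSpanSingleton ℝ x).comp (innerSL ℝ x)
    have h1 : ⟪Z, R.compLpL 2 P Z⟫ = 0 := by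
      conv_lhs => rw [hZ, map_sub, inner_sub_right]
      have a1 := key x U ⟨F, h⟩
      have a2 := key x U' ⟨F, h'⟩
      change ⟪Z, R.compLpL 2 P U⟫ = 0 at a1
      change ⟪Z, R.compLpL 2 P U'⟫ = 0 at a2
      rw [a1, a2, sub_zero]
    rw [L2.inner_def] at h1
    have e : (fun ω => ⟪Z ω, R.compLpL 2 P Z ω⟫) =ᵐ[P] fun ω => ⟪x, Z ω⟫ ^ 2 := by
      filter_upwards [ContinuousLinearMap.coeFn_compLpL R Z] with ω h3
      rw [h3]
      simp [R, inner_smul_right, real_inner_comm, pow_two]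
    rw [integral_congr_ae e] at h1
    have hi : Integrable (fun ω => ⟪x, Z ω⟫ ^ 2) P :=
      MemLp.integrable_sq ((innerSL ℝ x).comp_memLp' (Lp.memLp Z))
    filter_upwards [(integral_eq_zero_iff_of_nonneg (fun ω => sq_nonneg _) hi).1 h1] with ω hω
    simpa using hω
  have h1 : Z = 0 := by
    refine Lp.ext ?_
    have := ae_eq_zero_of_forall_inner (𝕜 := ℝ) (f := Z) h0
    filter_upwards [this, Lp.coeFn_zero H 2 P] with ω h2 h3
    rw [h2, h3]
  exact sub_eq_zero.1 h1

lemma malliavinDeriv_eq [CompleteSpace H] [TopologicalSpace.SeparableSpace H]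
    (hW : IsIsonormal W P) {F : Lp ℝ 2 P} {U : Lp H 2 P}
    (h : (F, U) ∈ closure (cylindricalGraph W P)) : malliavinDeriv W P F = U := by
  have hex : ∃ U : Lp H 2 P, (F, U) ∈ closure (cylindricalGraph W P) := ⟨U, h⟩
  rw [malliavinDeriv, dif_pos hex]
  exact closure_cylindricalGraph_unique hW hex.choose_spec h

/-- The derivative of `H_q(W(h))`, as an element of `L⁴(P; H)`. -/
noncomputable def derivHermite (hW : IsIsonormal W P) (q : ℕ) (h : H) : Lp H 4 P :=
  ((IsCyl.hermite q h).memLp_deriv hW (p := 4) (by simp)).toLp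

lemma coeFn_derivHermite (hW : IsIsonormal W P) (q : ℕ) (h : H) :
    derivHermite hW q h =ᵐ[P] fun ω => (q * hermiteFun (q - 1) (W h ω)) • h := MemLp.coeFn_toLp _

/-- Linear combinations of generators, as elements of the closed sum of chaoses. -/
noncomputable def combine (hW : IsIsonormal W P) (n : ℕ) :
    (GenIdx H n →₀ ℝ) →ₗ[ℝ] chaosLE hW n :=
  Finsupp.linearCombination ℝ fun p =>
    ⟨gen hW n p, hermiteL2_mem_chaosLE hW p.2.1 p.2.2⟩

lemma coe_combine (hW : IsIsonormal W P) (n : ℕ) (a : GenIdx H n →₀ ℝ) :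
    (combine hW n a : Lp ℝ 2 P) = Finsupp.linearCombination ℝ (gen hW n) a := by
  rw [combine, Finsupp.linearCombination_apply, Finsupp.linearCombination_apply, Finsupp.sum,
    Finsupp.sum]
  simp

lemma denseRange_combine (hW : IsIsonormal W P) (n : ℕ) : DenseRange (combine hW n) := by
  intro x
  rw [closure_subtype]
  have hx : (x : Lp ℝ 2 P) ∈ closure (Submodule.span ℝ (Set.range (gen hW n)) : Set (Lp ℝ 2 P)) :=
    x.2
  refine closure_mono ?_ hx
  intro y hy
  rw [← Finsupp.range_linearCombination] at hy
  obtain ⟨a, rfl⟩ := hy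
  exact ⟨combine hW n a, ⟨a, rfl⟩, coe_combine hW n a⟩

/-- The derivative on linear combinations of generators. -/
noncomputable def combineDeriv (hW : IsIsonormal W P) (n : ℕ) :
    (GenIdx H n →₀ ℝ) →ₗ[ℝ] Lp H 4 P :=
  Finsupp.linearCombination ℝ fun p => derivHermite hW p.1.1 p.1.2

lemma coeFn_linearCombination {ι V : Type*} [NormedAddCommGroup V] [NormedSpace ℝ V]
    {p : ENNReal} [Fact (1 ≤ p)] (G : ι → Lp V p P) {G' : ι → Ω → V} (h : ∀ i, G i =ᵐ[P] G' i)
    (a : ι →₀ ℝ) :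
    Finsupp.linearCombination ℝ G a =ᵐ[P] fun ω => ∑ i ∈ a.support, a i • G' i ω := by
  have h1 : ∀ᵐ ω ∂P, ∀ i ∈ a.support, (a i • G i : Lp V p P) ω = a i • G' i ω := by
    rw [Finset.eventually_all]
    intro i _
    filter_upwards [h i, Lp.coeFn_smul (a i) (G i)] with ω h2 h3
    rw [h3, Pi.smul_apply, h2]
  rw [Finsupp.linearCombination_apply, Finsupp.sum]
  filter_upwards [h1, Lp.coeFn_fun_finsetSum a.support fun i => (a i • G i : Lp V p P)] with ω h2 h3
  rw [h3]
  exact Finset.sum_congr rfl h2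

/-- The derivative is an H-valued Hermite sum of order k, so its L⁴ norm is controlled by its L²
norm, and the latter by the norm of the variable of order k + 1. -/
lemma norm_combineDeriv_le_of_degree (hW : IsIsonormal W P) {n k : ℕ} (a : GenIdx H n →₀ ℝ)
    (ha : ∀ p ∈ a.support, p.1.1 = k + 1) :
    ‖combineDeriv hW n a‖ ≤ 3 ^ k * (k + 1) * ‖combine hW n a‖ := by
  have hu : ∀ p ∈ a.support, ‖p.1.2‖ = 1 := fun p hp =>
    p.2.2.resolve_left (by rw [ha p hp]; omega)
  have e1 : combineDeriv hW n a =ᵐ[P] fun ω => ∑ p ∈ a.support,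
      hermiteFun k (W p.1.2 ω) • (((k + 1 : ℝ) * a p) • p.1.2) := by
    filter_upwards [coeFn_linearCombination _ (fun p : GenIdx H n =>
      coeFn_derivHermite hW p.1.1 p.1.2) a] with ω h
    rw [combineDeriv, h]
    refine Finset.sum_congr rfl fun p hp => ?_
    rw [ha p hp, smul_smul, smul_smul]
    congr 1
    simp; ring
  have e2 : (combine hW n a : Lp ℝ 2 P) =ᵐ[P] fun ω => ∑ p ∈ a.support,
      hermiteFun (k + 1) (W p.1.2 ω) • a p := by
    rw [coe_combine]
    filter_upwards [coeFn_linearCombination _ (fun p : GenIdx H n =>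
      coeFn_hermiteL2 hW p.1.1 p.1.2) a] with ω h
    rw [show Finsupp.linearCombination ℝ (gen hW n) a = _ from rfl] at *
    refine h.trans (Finset.sum_congr rfl fun p hp => ?_)
    rw [ha p hp, smul_eq_mul, smul_eq_mul, mul_comm]
  have hm : ∀ v : GenIdx H n → H,
      MemLp (fun ω => ∑ p ∈ a.support, hermiteFun k (W p.1.2 ω) • v p) 2 P := by
    intro v
    refine memLp_finsetSum _ fun p _ => ?_
    have hm : MemLp (fun ω => hermiteFun k (W p.1.2 ω)) 2 P :=
      (IsCyl.hermite k _).memLp hW (by simp)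
    exact (ContinuousLinearMap.toSpanSingleton ℝ (v p)).comp_memLp' hm
  have n1 : ‖combineDeriv hW n a‖ ≤ 3 ^ k * ‖(hm fun p => ((k + 1 : ℝ) * a p) • p.1.2).toLp‖ := by
    rw [Lp.norm_def, Lp.norm_toLp, eLpNorm_congr_ae e1]
    have := eLpNorm_four_hermite_le hW a.support (fun p => p.1.2) hu k
      (fun p => ((k + 1 : ℝ) * a p) • p.1.2)
    have h2 := ENNReal.toReal_mono (ENNReal.mul_ne_top (by simp)
      (hm fun p => ((k + 1 : ℝ) * a p) • p.1.2).eLpNorm_ne_top) this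
    rwa [ENNReal.toReal_mul, ENNReal.toReal_ofReal (by positivity)] at h2
  have n2 : ‖(hm fun p => ((k + 1 : ℝ) * a p) • p.1.2).toLp‖ ≤ (k + 1) * ‖combine hW n a‖ := by
    rw [← abs_of_nonneg (show (0 : ℝ) ≤ (k + 1) * ‖combine hW n a‖ by positivity), ← abs_norm,
      ← sq_le_sq, mul_pow]
    have h1 : ‖(hm fun p => ((k + 1 : ℝ) * a p) • p.1.2).toLp‖ ^ 2 = (k + 1) ^ 2 *
        ∫ ω, ‖∑ p ∈ a.support, hermiteFun k (W p.1.2 ω) • (a p • p.1.2)‖ ^ 2 ∂P := by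
      rw [← real_inner_self_eq_norm_sq, inner_toLp_toLp, ← integral_const_mul]
      congr 1; ext ω
      have : ∑ p ∈ a.support, hermiteFun k (W p.1.2 ω) • (((k + 1 : ℝ) * a p) • p.1.2)
          = (k + 1 : ℝ) • ∑ p ∈ a.support, hermiteFun k (W p.1.2 ω) • (a p • p.1.2) := by
        rw [Finset.smul_sum]
        refine Finset.sum_congr rfl fun p _ => ?_
        simp only [smul_smul]; congr 1; ring
      rw [this, real_inner_self_eq_norm_sq, norm_smul, mul_pow]
      simp
    have h2 : ‖combine hW n a‖ ^ 2
        = ∫ ω, ‖∑ p ∈ a.support, hermiteFun (k + 1) (W p.1.2 ω) • a p‖ ^ 2 ∂P := by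
      rw [Submodule.coe_norm, ← real_inner_self_eq_norm_sq, L2.inner_def]
      refine integral_congr_ae ?_
      filter_upwards [e2] with ω h
      rw [h, real_inner_self_eq_norm_sq]
    -- For scalar coefficients the tensor product of H with ℝ is H itself.
    have h3 := integral_norm_sq_hermite_succ hW (V := ℝ) (V' := H) (t := fun x c => c • x)
      (by intro x y b c; simp [inner_smul_left, inner_smul_right]; ring)
      a.support (fun p => p.1.2) hu a k
    rw [h1, h2, h3]
    have h4 : 0 ≤ ∫ ω, ‖∑ p ∈ a.support, hermiteFun k (W p.1.2 ω) • (a p • p.1.2)‖ ^ 2 ∂P :=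
      integral_nonneg fun ω => by positivity
    have h5 : (1 : ℝ) ≤ k + 1 := by simp
    gcongr
    exact le_mul_of_one_le_left h4 h5
  calc _ ≤ _ := n1
    _ ≤ 3 ^ k * ((k + 1) * ‖combine hW n a‖) := by gcongr
    _ = _ := by ring

/-- Selecting the generators of one order is an orthogonal projection of the sum, hence does not
increase its norm. -/
lemma combine_filter (hW : IsIsonormal W P) {n : ℕ} (q : ℕ) (a : GenIdx H n →₀ ℝ) :
    (combine hW n (a.filter fun p => p.1.1 = q) : Lp ℝ 2 P)
      = (chaos W P q).starProjection (combine hW n a) := by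
  induction a using Finsupp.induction_linear with
  | zero => simp [Finsupp.filter_zero]
  | add a b ha hb => simp [Finsupp.filter_add, ha, hb]
  | single p c =>
    simp only [coe_combine]
    by_cases h : p.1.1 = q
    · rw [Finsupp.filter_single_of_pos (fun p : GenIdx H n => p.1.1 = q) h]
      have := starProjection_chaos_hermiteL2 hW q p.1.1 p.2.2
      rw [if_pos h] at this
      simp [gen, this]
    · rw [Finsupp.filter_single_of_neg (fun p : GenIdx H n => p.1.1 = q) h]
      simp [gen, starProjection_chaos_hermiteL2 hW q _ p.2.2, h]

/-- Split by order and add the bounds. Besides continuity, the estimate shows that D does not depend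
on the representation by generators, which is far from unique. -/
lemma exists_norm_combineDeriv_le (hW : IsIsonormal W P) (n : ℕ) :
    ∃ C, ∀ a, ‖combineDeriv hW n a‖ ≤ C * ‖combine hW n a‖ := by
  refine ⟨∑ q ∈ Finset.range (n + 1), 3 ^ q * (q + 1), fun a => ?_⟩
  have hs : a = ∑ q ∈ Finset.range (n + 1), a.filter fun p => p.1.1 = q := by
    ext p
    simp only [Finsupp.finsetSum_apply, Finsupp.filter_apply]
    rw [Finset.sum_ite_eq, if_pos]
    simpa using Nat.lt_succ_of_le p.2.1
  conv_lhs => rw [hs]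
  rw [map_sum, Finset.sum_mul]
  refine (norm_sum_le _ _).trans (Finset.sum_le_sum fun q _ => ?_)
  have hle : ‖combine hW n (a.filter fun p => p.1.1 = q)‖ ≤ ‖combine hW n a‖ := by
    rw [Submodule.coe_norm, Submodule.coe_norm, combine_filter]
    exact Submodule.norm_starProjection_apply_le _ _
  rcases q with _ | k
  · have : combineDeriv hW n (a.filter fun p => p.1.1 = 0) = 0 := by
      rw [combineDeriv, Finsupp.linearCombination_apply, Finsupp.sum]
      refine Finset.sum_eq_zero fun p hp => ?_
      have hp0 : p.1.1 = 0 := by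
        by_contra h
        simp [h] at hp
      have : derivHermite hW p.1.1 p.1.2 = 0 := by
        refine Lp.ext ?_
        filter_upwards [coeFn_derivHermite hW p.1.1 p.1.2, Lp.coeFn_zero H 4 P] with ω h1 h2
        rw [h1, h2, hp0]; simp
      rw [this, smul_zero]
    rw [this, norm_zero]; positivity
  · refine (norm_combineDeriv_le_of_degree hW (k := k) _ fun p hp => ?_).trans ?_
    · by_contra h
      simp [h] at hp
    · have h1 : (3 : ℝ) ^ k ≤ 3 ^ (k + 1) := pow_le_pow_right₀ (by norm_num) (by omega)
      push_cast
      gcongr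
      linarith

/-- The Malliavin derivative on a finite sum of chaoses, as a bounded operator to `L⁴(P; H)`. -/
noncomputable def derivCLM [CompleteSpace H] (hW : IsIsonormal W P) (n : ℕ) :
    Lp ℝ 2 P →L[ℝ] Lp H 4 P :=
  ((combineDeriv hW n).extendOfNorm (combine hW n)).comp (chaosLE hW n).orthogonalProjectionOnto

lemma derivCLM_hermiteL2 [CompleteSpace H] (hW : IsIsonormal W P) {n q : ℕ} (hq : q ≤ n) {h : H}
    (hh : q = 0 ∨ ‖h‖ = 1) : derivCLM hW n (hermiteL2 hW q h) = derivHermite hW q h := by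
  let p : GenIdx H n := ⟨(q, h), hq, hh⟩
  have e : (chaosLE hW n).orthogonalProjectionOnto (hermiteL2 hW q h)
      = combine hW n (Finsupp.single p 1) := by
    rw [Submodule.orthogonalProjectionOnto_mem_subspace_eq_self
      (⟨hermiteL2 hW q h, hermiteL2_mem_chaosLE hW hq hh⟩ : chaosLE hW n)]
    ext1
    rw [coe_combine]
    simp [gen, p]
  rw [derivCLM, ContinuousLinearMap.comp_apply, e, LinearMap.extendOfNorm_eq
    (denseRange_combine hW n) (exists_norm_combineDeriv_le hW n)]
  simp [combineDeriv, p]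

end Derivative


/-! ### Products of Hermite variables stay in finite sums of chaoses. -/

section Products

/-- If a polynomial path stays in a subspace, so do its coefficients. -/
lemma coeff_mem_of_path_mem {E : Type*} [AddCommGroup E] [Module ℝ E] (S : Submodule ℝ E) (N : ℕ)
    (w : ℕ → E) (h : ∀ t : ℝ, ∑ i ∈ Finset.range (N + 1), t ^ i • w i ∈ S) {i : ℕ} (hi : i ≤ N) :
    w i ∈ S := by
  by_contra hw
  -- A linear functional vanishing on S but not at the coefficient turns the path into a real
  -- polynomial that is identically zero.
  obtain ⟨f, hf, hS⟩ := Submodule.exists_le_ker_of_notMem hw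
  apply hf
  have : (∑ i ∈ Finset.range (N + 1), Polynomial.monomial i (f (w i)) : ℝ[X]) = 0 := by
    refine Polynomial.funext fun t => ?_
    have h1 : f (∑ i ∈ Finset.range (N + 1), t ^ i • w i) = 0 := hS (h t)
    rw [eval_finsetSum, eval_zero, ← h1, map_sum]
    refine Finset.sum_congr rfl fun j _ => ?_
    simp [mul_comm]
  have h2 := congrArg (fun p => p.coeff i) this
  simpa [Polynomial.finsetSum_coeff, Polynomial.coeff_monomial, Nat.lt_succ_of_le hi] using h2

/-- Multiplication by x raises the order by at most one: x H_i = H_{i+1} + i H_{i-1}. -/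
lemma pow_mem_span_hermiteFun (j : ℕ) :
    (fun x : ℝ => x ^ j) ∈ Submodule.span ℝ {f | ∃ i ≤ j, f = hermiteFun i} := by
  induction j with
  | zero => exact Submodule.subset_span ⟨0, le_rfl, by ext; simp⟩
  | succ j ih =>
    have key : ∀ f ∈ Submodule.span ℝ {f | ∃ i ≤ j, f = hermiteFun i},
        (fun x : ℝ => x * f x) ∈ Submodule.span ℝ {f | ∃ i ≤ j + 1, f = hermiteFun i} := by
      intro f hf
      induction hf using Submodule.span_induction with
      | mem f hf =>
        obtain ⟨i, hi, rfl⟩ := hf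
        have : (fun x : ℝ => x * hermiteFun i x)
            = hermiteFun (i + 1) + (i : ℝ) • hermiteFun (i - 1) := by
          ext x; simp [hermiteFun_succ]
        rw [this]
        exact Submodule.add_mem _ (Submodule.subset_span ⟨i + 1, by omega, rfl⟩)
          (Submodule.smul_mem _ _ (Submodule.subset_span ⟨i - 1, by omega, rfl⟩))
      | zero =>
        convert Submodule.zero_mem (Submodule.span ℝ {f | ∃ i ≤ j + 1, f = hermiteFun i}) using 1
        ext x; simp
      | add f g _ _ hf hg =>
        convert Submodule.add_mem _ hf hg using 1
        ext x; simp [mul_add]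
      | smul c f _ hf =>
        have := Submodule.smul_mem _ c hf
        convert this using 1
        ext x; simp; ring
    have := key _ ih
    convert this using 1
    ext x; ring

universe u

variable {Ω : Type*} {H : Type u} {mΩ : MeasurableSpace Ω} [NormedAddCommGroup H]
  [InnerProductSpace ℝ H] {P : Measure Ω} {W : H → Ω → ℝ}

/-- The functions whose class lies in the closed sum of the chaoses of order at most `n`. -/
noncomputable def chaosFun (hW : IsIsonormal W P) (n : ℕ) : Submodule ℝ (Ω → ℝ) where
  carrier := {U | ∃ X ∈ chaosLE hW n, X =ᵐ[P] U}
  zero_mem' := ⟨0, zero_mem _, Lp.coeFn_zero ℝ 2 P⟩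
  add_mem' := by
    rintro U V ⟨X, hX, h1⟩ ⟨Y, hY, h2⟩
    exact ⟨X + Y, add_mem hX hY, (Lp.coeFn_add X Y).trans (h1.add h2)⟩
  smul_mem' := by
    rintro c U ⟨X, hX, h1⟩
    exact ⟨c • X, Submodule.smul_mem _ c hX, (Lp.coeFn_smul c X).trans (h1.const_smul c)⟩

lemma chaosFun_congr (hW : IsIsonormal W P) {n : ℕ} {U V : Ω → ℝ} (hU : U ∈ chaosFun hW n)
    (h : U =ᵐ[P] V) : V ∈ chaosFun hW n := by
  obtain ⟨X, hX, h1⟩ := hU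
  exact ⟨X, hX, h1.trans h⟩

lemma chaosFun_mono (hW : IsIsonormal W P) {m n : ℕ} (hmn : m ≤ n) :
    chaosFun hW m ≤ chaosFun hW n := by
  rintro U ⟨X, hX, h⟩
  exact ⟨X, chaosLE_mono hW hmn hX, h⟩

lemma pow_mem_chaosFun (hW : IsIsonormal W P) (n : ℕ) (h : H) :
    (fun ω => W h ω ^ n) ∈ chaosFun hW n := by
  rcases eq_or_ne h 0 with rfl | hh
  · have h0 : W (0 : H) =ᵐ[P] fun _ => 0 := by simpa using hW.smul_ae (0 : H) 0
    rcases n with _ | n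
    · refine ⟨hermiteL2 hW 0 0, hermiteL2_mem_chaosLE hW le_rfl (.inl rfl), ?_⟩
      filter_upwards [coeFn_hermiteL2 hW 0 (0 : H)] with ω h1
      simp [h1]
    · refine ⟨0, zero_mem _, ?_⟩
      filter_upwards [Lp.coeFn_zero ℝ 2 P, h0] with ω h1 h2
      rw [h1, h2]; simp
  · have hu : ∀ f ∈ Submodule.span ℝ {f | ∃ i ≤ n, f = hermiteFun i},
        (fun ω => f (W (‖h‖⁻¹ • h) ω)) ∈ chaosFun hW n := by
      intro f hf
      induction hf using Submodule.span_induction with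
      | mem f hf =>
        obtain ⟨i, hi, rfl⟩ := hf
        exact ⟨_, hermiteL2_mem_chaosLE hW hi (.inr (norm_smul_inv_norm (𝕜 := ℝ) hh)),
          coeFn_hermiteL2 hW i _⟩
      | zero => exact Submodule.zero_mem _
      | add f g _ _ hf hg => exact Submodule.add_mem _ hf hg
      | smul c f _ hf => exact Submodule.smul_mem _ c hf
    have h1 := Submodule.smul_mem _ (‖h‖ ^ n) (hu _ (pow_mem_span_hermiteFun n))
    refine chaosFun_congr hW h1 ?_
    filter_upwards [hW.smul_ae h ‖h‖⁻¹] with ω h2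
    have : ‖h‖ ≠ 0 := by simpa using hh
    simp only [Pi.smul_apply, h2, smul_eq_mul]
    rw [← mul_pow, ← mul_assoc, mul_inv_cancel₀ this, one_mul]

/-- Polarisation: W(u)^a W(v)^b is, up to a binomial coefficient, the coefficient of t^b in W(u + t
v)^(a+b), and pure powers are already covered. -/
lemma pow_mul_pow_mem_chaosFun (hW : IsIsonormal W P) (a b : ℕ) (u v : H) :
    (fun ω => W u ω ^ a * W v ω ^ b) ∈ chaosFun hW (a + b) := by
  have key := coeff_mem_of_path_mem (chaosFun hW (a + b)) (a + b)
    (fun i => ((a + b).choose i : ℝ) • fun ω => W u ω ^ (a + b - i) * W v ω ^ i)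
    (fun t => by
      refine chaosFun_congr hW (pow_mem_chaosFun hW (a + b) (u + t • v)) ?_
      filter_upwards [hW.add_smul_ae u v t] with ω h
      rw [h, add_comm, add_pow, Finset.sum_apply]
      refine Finset.sum_congr rfl fun i _ => ?_
      simp only [Pi.smul_apply, smul_eq_mul]
      ring) (i := b) (by omega)
  have h0 : ((a + b).choose b : ℝ) ≠ 0 := by
    exact_mod_cast (Nat.choose_pos (by omega)).ne'
  rw [Submodule.smul_mem_iff _ h0] at key
  simpa using key

lemma hermite_mul_hermite_mem_chaosFun (hW : IsIsonormal W P) (a b : ℕ) (u v : H) :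
    (fun ω => hermiteFun a (W u ω) * hermiteFun b (W v ω)) ∈ chaosFun hW (a + b) := by
  have h1 : ∀ (q : ℕ) (x : ℝ), hermiteFun q x
      = ∑ j ∈ Finset.range (q + 1), ((hermite q).coeff j : ℝ) * x ^ j := by
    intro q x
    rw [hermiteFun, aeval_eq_sum_range, natDegree_hermite]
    simp
  have h2 : (fun ω => hermiteFun a (W u ω) * hermiteFun b (W v ω))
      = ∑ i ∈ Finset.range (a + 1), ∑ j ∈ Finset.range (b + 1),
        (((hermite a).coeff i : ℝ) * (hermite b).coeff j) • fun ω => W u ω ^ i * W v ω ^ j := by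
    ext ω
    rw [h1, h1, Finset.sum_mul_sum]
    simp only [Finset.sum_apply, Pi.smul_apply, smul_eq_mul]
    refine Finset.sum_congr rfl fun i _ => Finset.sum_congr rfl fun j _ => by ring
  rw [h2]
  refine Submodule.sum_mem _ fun i hi => Submodule.sum_mem _ fun j hj =>
    Submodule.smul_mem _ _ (chaosFun_mono hW ?_ (pow_mul_pow_mem_chaosFun hW i j u v))
  simp at hi hj
  omega

end Products

/-! ### Γ as a bounded bilinear map and its effect on the order. -/

section Gamma

universe u

variable {Ω : Type*} {H : Type u} {mΩ : MeasurableSpace Ω} [NormedAddCommGroup H]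
  [InnerProductSpace ℝ H] {P : Measure Ω} {W : H → Ω → ℝ}

instance : ENNReal.HolderTriple 4 4 2 := ⟨by
  rw [← two_mul, show (4 : ENNReal) = 2 * 2 by norm_num,
    ENNReal.mul_inv (by simp) (by simp), ← mul_assoc, ENNReal.mul_inv_cancel (by simp) (by simp),
    one_mul]⟩

/-- The inclusion of `L⁴` into `L²` for a probability measure. -/
noncomputable def inclL2 (V : Type*) [NormedAddCommGroup V] [NormedSpace ℝ V]
    (P : Measure Ω) [IsProbabilityMeasure P] : Lp V 4 P →L[ℝ] Lp V 2 P :=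
  LinearMap.mkContinuous
    { toFun f := ((Lp.memLp f).mono_exponent (p := 2)
        (show (2 : ENNReal) ≤ 4 by norm_num)).toLp f
      map_add' f g := by
        refine Lp.ext ?_
        filter_upwards [MemLp.coeFn_toLp ((Lp.memLp (f + g)).mono_exponent (p := 2)
          (show (2 : ENNReal) ≤ 4 by norm_num)), Lp.coeFn_add f g,
          MemLp.coeFn_toLp ((Lp.memLp f).mono_exponent (p := 2)
            (show (2 : ENNReal) ≤ 4 by norm_num)),
          MemLp.coeFn_toLp ((Lp.memLp g).mono_exponent (p := 2)
            (show (2 : ENNReal) ≤ 4 by norm_num)),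
          Lp.coeFn_add (((Lp.memLp f).mono_exponent (p := 2)
            (show (2 : ENNReal) ≤ 4 by norm_num)).toLp f) (((Lp.memLp g).mono_exponent (p := 2)
            (show (2 : ENNReal) ≤ 4 by norm_num)).toLp g)] with ω h1 h2 h3 h4 h5
        rw [h1, h2, h5, Pi.add_apply, Pi.add_apply, h3, h4]
      map_smul' c f := by
        refine Lp.ext ?_
        filter_upwards [MemLp.coeFn_toLp ((Lp.memLp (c • f)).mono_exponent (p := 2)
          (show (2 : ENNReal) ≤ 4 by norm_num)), Lp.coeFn_smul c f,
          MemLp.coeFn_toLp ((Lp.memLp f).mono_exponent (p := 2)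
            (show (2 : ENNReal) ≤ 4 by norm_num)),
          Lp.coeFn_smul c (((Lp.memLp f).mono_exponent (p := 2)
            (show (2 : ENNReal) ≤ 4 by norm_num)).toLp f)] with ω h1 h2 h3 h5
        rw [RingHom.id_apply, h1, h2, h5, Pi.smul_apply, Pi.smul_apply, h3] }
    1 (fun f => by
      rw [one_mul]
      change ‖((Lp.memLp f).mono_exponent (p := 2)
        (show (2 : ENNReal) ≤ 4 by norm_num)).toLp f‖ ≤ _
      rw [Lp.norm_toLp, Lp.norm_def]
      exact ENNReal.toReal_mono (Lp.eLpNorm_ne_top f)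
        (eLpNorm_le_eLpNorm_of_exponent_le (by norm_num) (Lp.aestronglyMeasurable f)))

lemma coeFn_inclL2 {V : Type*} [NormedAddCommGroup V] [NormedSpace ℝ V]
    [IsProbabilityMeasure P] (f : Lp V 4 P) : inclL2 V P f =ᵐ[P] f :=
  MemLp.coeFn_toLp ((Lp.memLp f).mono_exponent (p := 2) (show (2 : ENNReal) ≤ 4 by norm_num))

/-- An element of the linear span of the generators is a cylindrical variable. -/
lemma exists_isCyl_of_mem_span [CompleteSpace H] (hW : IsIsonormal W P) {n : ℕ}
    {F : Lp ℝ 2 P} (hF : F ∈ Submodule.span ℝ (Set.range (gen hW n))) :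
    ∃ U DU, IsCyl W U DU ∧ F =ᵐ[P] U ∧ derivCLM hW n F =ᵐ[P] DU := by
  rw [← Finsupp.range_linearCombination] at hF
  obtain ⟨a, rfl⟩ := hF
  have hD : derivCLM hW n (Finsupp.linearCombination ℝ (gen hW n) a) = combineDeriv hW n a := by
    rw [combineDeriv, Finsupp.linearCombination_apply, Finsupp.linearCombination_apply,
      map_finsuppSum]
    refine Finsupp.sum_congr fun p _ => ?_
    rw [map_smul, gen, derivCLM_hermiteL2 hW p.2.1 p.2.2]
  refine ⟨_, _, IsCyl.sum a.support fun p _ =>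
    (IsCyl.hermite (W := W) p.1.1 p.1.2).const_mul (a p), ?_, ?_⟩
  · exact coeFn_linearCombination _ (fun p : GenIdx H n => coeFn_hermiteL2 hW p.1.1 p.1.2) a
  · rw [hD]
    exact coeFn_linearCombination _
      (fun p : GenIdx H n => coeFn_derivHermite hW p.1.1 p.1.2) a

/-- Clear on the span of the generators, where the variables are cylindrical; it persists in the
limit because the operator is continuous. With uniqueness, this identifies D on finite sums of
chaoses. -/
lemma derivCLM_mem_closure [CompleteSpace H] [IsProbabilityMeasure P] (hW : IsIsonormal W P)
    {n : ℕ} {F : Lp ℝ 2 P} (hF : F ∈ chaosLE hW n) :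
    (F, inclL2 H P (derivCLM hW n F)) ∈ closure (cylindricalGraph W P) := by
  have hcl : IsClosed {F : Lp ℝ 2 P | (F, inclL2 H P (derivCLM hW n F)) ∈
      closure (cylindricalGraph W P)} :=
    isClosed_closure.preimage (by fun_prop)
  refine closure_minimal (fun F hF => ?_) hcl hF
  obtain ⟨U, DU, hU, hFU, hDU⟩ := exists_isCyl_of_mem_span hW hF
  exact subset_closure (mem_cylindricalGraph_iff.2
    ⟨U, DU, hU, hFU, (coeFn_inclL2 _).trans hDU⟩)

lemma coeFn_malliavinDeriv [CompleteSpace H] [TopologicalSpace.SeparableSpace H]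
    (hW : IsIsonormal W P)
    {n : ℕ} {F : Lp ℝ 2 P} (hF : F ∈ chaosLE hW n) :
    malliavinDeriv W P F =ᵐ[P] derivCLM hW n F := by
  have := hW.isProbabilityMeasure
  rw [malliavinDeriv_eq hW (derivCLM_mem_closure hW hF)]
  exact coeFn_inclL2 _

/-- The bilinear map `(F, G) ↦ ⟨DF, -D L⁻¹ G⟩` on finite sums of chaoses. -/
noncomputable def gammaCLM [CompleteSpace H] (hW : IsIsonormal W P) (n m : ℕ) :
    Lp ℝ 2 P →L[ℝ] Lp ℝ 2 P →L[ℝ] Lp ℝ 2 P :=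
  ((innerSL ℝ : H →L[ℝ] H →L[ℝ] ℝ).holderL P 4 4 2).bilinearComp (derivCLM hW n)
    (-((derivCLM hW m).comp (invGen W P m)))

lemma coeFn_gammaCLM [CompleteSpace H] (hW : IsIsonormal W P) (n m : ℕ) (F G : Lp ℝ 2 P) :
    gammaCLM hW n m F G =ᵐ[P]
      fun ω => ⟪derivCLM hW n F ω, -(derivCLM hW m (invGen W P m G) ω)⟫ := by
  have h1 := (innerSL ℝ : H →L[ℝ] H →L[ℝ] ℝ).coeFn_holder (r := 2) (derivCLM hW n F)
    (-(derivCLM hW m (invGen W P m G)))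
  filter_upwards [h1, Lp.coeFn_neg (derivCLM hW m (invGen W P m G))] with ω h2 h3
  refine Eq.trans h2 ?_
  rw [h3]; rfl

/-- On finite sums of chaoses none of the default values in the definition of `Gam` occurs, and Γ is
the bounded bilinear map. -/
lemma toL2_eq [CompleteSpace H] [TopologicalSpace.SeparableSpace H]
    (hW : IsIsonormal W P) {n m : ℕ} {F G : Lp ℝ 2 P} (hF : F ∈ chaosLE hW n)
    (hG : G ∈ chaosLE hW m) :
    toL2 (fun ω => ⟪malliavinDeriv W P F ω, -(malliavinDeriv W P (pseudoInverse W P G) ω)⟫)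
      = gammaCLM hW n m F G := by
  have hae : (fun ω => ⟪malliavinDeriv W P F ω,
      -(malliavinDeriv W P (pseudoInverse W P G) ω)⟫) =ᵐ[P] gammaCLM hW n m F G := by
    rw [pseudoInverse_eq hW hG]
    filter_upwards [coeFn_malliavinDeriv hW hF, coeFn_malliavinDeriv hW (invGen_mem hW (m := m) hG),
      coeFn_gammaCLM hW n m F G] with ω h1 h2 h3
    rw [h1, h2, h3]
  have hm : MemLp (fun ω => ⟪malliavinDeriv W P F ω,
      -(malliavinDeriv W P (pseudoInverse W P G) ω)⟫) 2 P :=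
    (memLp_congr_ae hae).2 (Lp.memLp _)
  rw [toL2, dif_pos hm]
  exact Lp.ext (hm.coeFn_toLp.trans hae)

/-- The factor q / q combines the q of the derivative with the 1 / q of L⁻¹; it is 1 except for q =
0, where it is 0. -/
lemma gammaCLM_hermiteL2 [CompleteSpace H] (hW : IsIsonormal W P) {n m p q : ℕ} (hp : p ≤ n)
    (hq : q ≤ m) {u v : H} (hu : p = 0 ∨ ‖u‖ = 1) (hv : q = 0 ∨ ‖v‖ = 1) :
    gammaCLM hW n m (hermiteL2 hW p u) (hermiteL2 hW q v) =ᵐ[P]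
      fun ω => (p * ((q : ℝ) / q) * ⟪u, v⟫) *
        (hermiteFun (p - 1) (W u ω) * hermiteFun (q - 1) (W v ω)) := by
  refine (coeFn_gammaCLM hW n m _ _).trans ?_
  rw [invGen_hermiteL2 hW hq hv, map_smul, derivCLM_hermiteL2 hW hp hu, derivCLM_hermiteL2 hW hq hv]
  filter_upwards [coeFn_derivHermite hW p u, coeFn_derivHermite hW q v,
    Lp.coeFn_smul (-(1 / (q : ℝ))) (derivHermite hW q v)] with ω h1 h2 h3
  rw [h1, h3, Pi.smul_apply, h2]
  simp only [inner_smul_left, inner_smul_right, inner_neg_right, RCLike.conj_to_real]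
  ring

lemma mem_chaosLE_of_coeFn (hW : IsIsonormal W P) {n : ℕ} {X : Lp ℝ 2 P} {U : Ω → ℝ}
    (hU : U ∈ chaosFun hW n) (h : X =ᵐ[P] U) : X ∈ chaosLE hW n := by
  obtain ⟨Y, hY, h1⟩ := hU
  rwa [show X = Y from Lp.ext (h.trans h1.symm)]

lemma chaosLE_map₂_mem (hW : IsIsonormal W P) {n m : ℕ} {E : Type*} [NormedAddCommGroup E]
    [NormedSpace ℝ E] {B : Lp ℝ 2 P →L[ℝ] Lp ℝ 2 P →L[ℝ] E} {S : Submodule ℝ E}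
    (hS : IsClosed (S : Set E))
    (h : ∀ p ≤ n, ∀ u : H, (p = 0 ∨ ‖u‖ = 1) → ∀ q ≤ m, ∀ v : H, (q = 0 ∨ ‖v‖ = 1) →
      B (hermiteL2 hW p u) (hermiteL2 hW q v) ∈ S)
    {F G : Lp ℝ 2 P} (hF : F ∈ chaosLE hW n) (hG : G ∈ chaosLE hW m) : B F G ∈ S := by
  have := chaosLE_map_mem hW (T := B.flip G) hS (fun p hp u hu => by
    rw [ContinuousLinearMap.flip_apply]
    exact chaosLE_map_mem hW (T := B (hermiteL2 hW p u)) hS (fun q hq v hv =>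
      h p hp u hu q hq v hv) hG) hF
  rwa [ContinuousLinearMap.flip_apply] at this

lemma chaosLE_ext₂ (hW : IsIsonormal W P) {n m : ℕ} {E : Type*} [NormedAddCommGroup E]
    [NormedSpace ℝ E] {B B' : Lp ℝ 2 P →L[ℝ] Lp ℝ 2 P →L[ℝ] E}
    (h : ∀ p ≤ n, ∀ u : H, (p = 0 ∨ ‖u‖ = 1) → ∀ q ≤ m, ∀ v : H, (q = 0 ∨ ‖v‖ = 1) →
      B (hermiteL2 hW p u) (hermiteL2 hW q v) = B' (hermiteL2 hW p u) (hermiteL2 hW q v))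
    {F G : Lp ℝ 2 P} (hF : F ∈ chaosLE hW n) (hG : G ∈ chaosLE hW m) : B F G = B' F G := by
  have := chaosLE_map₂_mem hW (B := B - B') (S := ⊥) isClosed_singleton
    (fun p hp u hu q hq v hv => by simp [h p hp u hu q hq v hv]) hF hG
  simpa [sub_eq_zero] using this

/-- Each derivative lowers the order by one. The truncated difference is safe because Γ vanishes
when one argument is constant. -/
lemma gammaCLM_mem [CompleteSpace H] (hW : IsIsonormal W P) {n m : ℕ} {F G : Lp ℝ 2 P}
    (hF : F ∈ chaosLE hW n) (hG : G ∈ chaosLE hW m) :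
    gammaCLM hW n m F G ∈ chaosLE hW (n + m - 2) := by
  refine chaosLE_map₂_mem hW (isClosed_chaosLE hW _) (fun p hp u hu q hq v hv => ?_) hF hG
  have key := gammaCLM_hermiteL2 hW hp hq hu hv
  refine mem_chaosLE_of_coeFn hW ?_ key
  rcases p with _ | p
  · convert Submodule.zero_mem (chaosFun hW (n + m - 2)) using 1
    ext ω; simp
  rcases q with _ | q
  · convert Submodule.zero_mem (chaosFun hW (n + m - 2)) using 1
    ext ω; simp
  exact Submodule.smul_mem _ (((p + 1 : ℕ) : ℝ) * (((q + 1 : ℕ) : ℝ) / ((q + 1 : ℕ) : ℝ)) * ⟪u, v⟫)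
    (chaosFun_mono hW (by omega) (hermite_mul_hermite_mem_chaosFun hW p q u v))

end Gamma


/-! ### Orders of the iterates and the leading symbol of Γ. -/

section GammaChain

universe u

variable {Ω : Type*} {H : Type u} {mΩ : MeasurableSpace Ω} [NormedAddCommGroup H]
  [InnerProductSpace ℝ H] {P : Measure Ω} {W : H → Ω → ℝ}

lemma Gam_mem [CompleteSpace H] [TopologicalSpace.SeparableSpace H] (hW : IsIsonormal W P) {n : ℕ}
    (hn : 2 ≤ n) {F : Lp ℝ 2 P} (hF : F ∈ chaosLE hW n) (i : ℕ) :
    Gam W P F i ∈ chaosLE hW (n + i * (n - 2)) := by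
  induction i with
  | zero => simpa [Gam] using hF
  | succ i ih =>
    rw [Gam, toL2_eq hW hF ih]
    have := gammaCLM_mem hW hF ih
    rwa [show n + (n + i * (n - 2)) - 2 = n + (i + 1) * (n - 2) by
      rw [Nat.add_mul]; omega] at this

lemma Gam_succ [CompleteSpace H] [TopologicalSpace.SeparableSpace H] (hW : IsIsonormal W P) {n : ℕ}
    (hn : 2 ≤ n) {F : Lp ℝ 2 P} (hF : F ∈ chaosLE hW n) (i : ℕ) :
    Gam W P F (i + 1) = gammaCLM hW n (n + i * (n - 2)) F (Gam W P F i) := by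
  rw [Gam, toL2_eq hW hF (Gam_mem hW hn hF i)]

lemma inner_hermiteL2_eq_zero_of_lt (hW : IsIsonormal W P) {m n : ℕ} (hmn : m < n) {h : H}
    (hh : ‖h‖ = 1) {F : Lp ℝ 2 P} (hF : F ∈ chaosLE hW m) : ⟪hermiteL2 hW n h, F⟫ = 0 := by
  have := chaosLE_ext hW (T := innerSL ℝ (hermiteL2 hW n h)) (S := 0) (fun q hq g _ => by
    rw [innerSL_apply_apply, inner_hermiteL2_of_le hW (by omega) (.inr hh), if_neg (by omega)]
    simp) hF
  simpa using this

lemma norm_sq_hermiteL2 (hW : IsIsonormal W P) (n : ℕ) {h : H} (hh : ‖h‖ = 1) :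
    ‖hermiteL2 hW n h‖ ^ 2 = n.factorial := by
  rw [← real_inner_self_eq_norm_sq, inner_hermiteL2_of_le hW le_rfl (.inr hh), if_pos rfl,
    real_inner_self_eq_norm_sq, hh]
  simp

lemma norm_hermiteL2 (hW : IsIsonormal W P) (n : ℕ) {h : H} (hh : ‖h‖ = 1) :
    ‖hermiteL2 hW n h‖ = √n.factorial := by
  rw [← norm_sq_hermiteL2 hW n hh, Real.sqrt_sq (norm_nonneg _)]

/-- The bilinear map `(Z, F) ↦ E[Z DF]`. -/
noncomputable def gradCLM [CompleteSpace H] [IsProbabilityMeasure P] (hW : IsIsonormal W P)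
    (n : ℕ) : Lp ℝ 2 P →L[ℝ] Lp ℝ 2 P →L[ℝ] H :=
  (ContinuousLinearMap.compL ℝ (Lp ℝ 2 P) (Lp H 1 P) H L1.integralCLM).comp
    (((ContinuousLinearMap.lsmul ℝ ℝ : ℝ →L[ℝ] H →L[ℝ] H).holderL P 2 2 1).bilinearComp (.id ℝ _)
      ((inclL2 H P).comp (derivCLM hW n)))

lemma gradCLM_apply [CompleteSpace H] [IsProbabilityMeasure P] (hW : IsIsonormal W P)
    (n : ℕ) (Z F : Lp ℝ 2 P) : gradCLM hW n Z F = ∫ ω, Z ω • derivCLM hW n F ω ∂P := by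
  have h1 := (ContinuousLinearMap.lsmul ℝ ℝ : ℝ →L[ℝ] H →L[ℝ] H).coeFn_holder (r := 1) Z
    (inclL2 H P (derivCLM hW n F))
  change L1.integralCLM _ = _
  rw [← L1.integral_eq, L1.integral_eq_integral]
  refine integral_congr_ae ?_
  filter_upwards [h1, coeFn_inclL2 (derivCLM hW n F)] with ω h2 h3
  refine Eq.trans h2 ?_
  rw [h3]; rfl

lemma gradCLM_hermiteL2 [CompleteSpace H] [IsProbabilityMeasure P] (hW : IsIsonormal W P)
    {n p : ℕ} (hp : p ≤ n) {u : H} (hu : p = 0 ∨ ‖u‖ = 1) (Z : Lp ℝ 2 P) :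
    gradCLM hW n Z (hermiteL2 hW p u) = (p * ⟪hermiteL2 hW (p - 1) u, Z⟫) • u := by
  have h1 : ∫ ω, (p * (hermiteL2 hW (p - 1) u ω * Z ω)) ∂P = p * ⟪hermiteL2 hW (p - 1) u, Z⟫ := by
    rw [integral_const_mul, L2.inner_def]
    simp [mul_comm]
  rw [gradCLM_apply, derivCLM_hermiteL2 hW hp hu, ← h1, ← integral_smul_const]
  refine integral_congr_ae ?_
  filter_upwards [coeFn_derivHermite hW p u, coeFn_hermiteL2 hW (p - 1) u] with ω h2 h3
  rw [h2, h3, smul_smul]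
  congr 1
  ring

/-- For p = q + 1 the value is 1 / (q + 1) times the gradient at h of the symbol p! ⟨u, h⟩^p. This
normalisation is why no factor appears in Euler's identity below. -/
lemma gradCLM_hermiteL2_hermiteL2 [CompleteSpace H] [IsProbabilityMeasure P]
    (hW : IsIsonormal W P) {n p q : ℕ} (hp : p ≤ n) {u h : H} (hu : p = 0 ∨ ‖u‖ = 1)
    (hh : q = 0 ∨ ‖h‖ = 1) :
    gradCLM hW n (hermiteL2 hW q h) (hermiteL2 hW p u)
      = (if p = q + 1 then p.factorial * ⟪u, h⟫ ^ q else 0 : ℝ) • u := by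
  rw [gradCLM_hermiteL2 hW hp hu]
  congr 1
  rcases p with _ | p
  · simp
  have hu' : p = 0 ∨ ‖u‖ = 1 := .inr (hu.resolve_left (by omega))
  simp only [Nat.add_sub_cancel, add_left_inj]
  split_ifs with h1
  · subst h1
    rw [real_inner_comm, inner_hermiteL2_of_le hW le_rfl hh, if_pos rfl, Nat.factorial_succ]
    push_cast; ring
  · rw [inner_hermiteL2_of_ne hW h1 hu' hh, mul_zero]

/-- Euler's identity for the leading symbol. -/
lemma inner_gradCLM_self [CompleteSpace H] [IsProbabilityMeasure P] (hW : IsIsonormal W P)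
    {q : ℕ} {h : H} (hh : ‖h‖ = 1) {F : Lp ℝ 2 P} (hF : F ∈ chaosLE hW (q + 1)) :
    ⟪h, gradCLM hW (q + 1) (hermiteL2 hW q h) F⟫ = ⟪hermiteL2 hW (q + 1) h, F⟫ := by
  refine chaosLE_ext hW (T := (innerSL ℝ h).comp (gradCLM hW (q + 1) (hermiteL2 hW q h)))
    (S := innerSL ℝ (hermiteL2 hW (q + 1) h)) (fun p hp u hu => ?_) hF
  rw [ContinuousLinearMap.comp_apply, innerSL_apply_apply, innerSL_apply_apply,
    gradCLM_hermiteL2_hermiteL2 hW hp hu (.inr hh), inner_hermiteL2_of_le hW hp (.inr hh),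
    inner_smul_right]
  split_ifs with h1
  · subst h1
    rw [real_inner_comm]; ring
  · simp

/-- The leading symbol of `Γ(F, G)` is a multiple of the inner product of the gradients of the
leading symbols of `F` and `G`. -/
lemma inner_hermiteL2_gammaCLM [CompleteSpace H] [IsProbabilityMeasure P] (hW : IsIsonormal W P)
    {p q : ℕ} {h : H} (hh : ‖h‖ = 1) {F G : Lp ℝ 2 P} (hF : F ∈ chaosLE hW (p + 1))
    (hG : G ∈ chaosLE hW (q + 1)) :
    ⟪hermiteL2 hW (p + q) h, gammaCLM hW (p + 1) (q + 1) F G⟫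
      = (p + q).factorial / (p.factorial * (q + 1).factorial) *
        ⟪gradCLM hW (p + 1) (hermiteL2 hW p h) F, gradCLM hW (q + 1) (hermiteL2 hW q h) G⟫ := by
  -- The constant is read off from Hermite variables of orders p + 1 and q + 1: the left side
  -- carries (p + 1) (p + q)!, the gradients carry (p + 1)! (q + 1)!.
  set c : ℝ := (p + q).factorial / (p.factorial * (q + 1).factorial) with hc
  refine chaosLE_ext₂ hW
    (B := (ContinuousLinearMap.compL ℝ (Lp ℝ 2 P) (Lp ℝ 2 P) ℝ
      (innerSL ℝ (hermiteL2 hW (p + q) h))).comp (gammaCLM hW (p + 1) (q + 1)))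
    (B' := c • (innerSL ℝ : H →L[ℝ] H →L[ℝ] ℝ).bilinearComp
      (gradCLM hW (p + 1) (hermiteL2 hW p h)) (gradCLM hW (q + 1) (hermiteL2 hW q h)))
    (fun a ha u hu b hb v hv => ?_) hF hG
  have h1 : ⟪hermiteL2 hW (p + q) h,
      gammaCLM hW (p + 1) (q + 1) (hermiteL2 hW a u) (hermiteL2 hW b v)⟫
      = (a * ((b : ℝ) / b) * ⟪u, v⟫) * if a - 1 + (b - 1) = p + q then
        (p + q).factorial * ⟪u, h⟫ ^ (a - 1) * ⟪v, h⟫ ^ (b - 1) else 0 := by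
    rw [← integral_hermite_triple hW hh u v (p + q) (a - 1) (b - 1) (by omega),
      ← integral_const_mul, L2.inner_def]
    refine integral_congr_ae ?_
    filter_upwards [gammaCLM_hermiteL2 hW ha hb hu hv, coeFn_hermiteL2 hW (p + q) h] with ω h1 h2
    rw [h1, h2]
    simp only [RCLike.inner_apply, conj_trivial]
    ring
  have h2 : ⟪gradCLM hW (p + 1) (hermiteL2 hW p h) (hermiteL2 hW a u),
      gradCLM hW (q + 1) (hermiteL2 hW q h) (hermiteL2 hW b v)⟫ =
      (if a = p + 1 then a.factorial * ⟪u, h⟫ ^ p else 0 : ℝ) *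
      ((if b = q + 1 then b.factorial * ⟪v, h⟫ ^ q else 0 : ℝ) * ⟪u, v⟫) := by
    rw [gradCLM_hermiteL2_hermiteL2 hW ha hu (.inr hh),
      gradCLM_hermiteL2_hermiteL2 hW hb hv (.inr hh), inner_smul_left, inner_smul_right]
    simp
  refine h1.trans (Eq.trans ?_ (congrArg (c * ·) h2).symm)
  rcases a with _ | a
  · simp
  rcases b with _ | b
  · simp
  by_cases h3 : a = p ∧ b = q
  · obtain ⟨rfl, rfl⟩ := h3
    simp only [Nat.add_sub_cancel, if_true, hc]
    have : (((b + 1 : ℕ) : ℝ)) ≠ 0 := by positivity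
    rw [Nat.factorial_succ a, Nat.factorial_succ b]
    push_cast at this ⊢
    field_simp
  · rw [if_neg (by omega)]
    rcases not_and_or.1 h3 with h4 | h4
    · rw [if_neg (show ¬ (a + 1 = p + 1) by omega)]; simp
    · rw [if_neg (show ¬ (b + 1 = q + 1) by omega)]; simp

end GammaChain


/-! ### Almost critical points of the leading symbol on the unit sphere. -/

section Symbol

universe u

variable {Ω : Type*} {H : Type u} {mΩ : MeasurableSpace Ω} [NormedAddCommGroup H]
  [InnerProductSpace ℝ H] {P : Measure Ω} {W : H → Ω → ℝ}

/-- The class of `H_q(W(h)) W(e)` in `L²(P)`. -/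
noncomputable def hermiteMulL2 (hW : IsIsonormal W P) (q : ℕ) (h e : H) : Lp ℝ 2 P :=
  (((IsCyl.hermite q h).mul (IsCyl.of_apply e)).memLp hW (p := 2) (by simp)).toLp

lemma inner_hermiteMulL2 (hW : IsIsonormal W P) (n q : ℕ) (g h e : H) :
    ⟪hermiteL2 hW n g, hermiteMulL2 hW q h e⟫
      = ∫ ω, hermiteFun n (W g ω) * (hermiteFun q (W h ω) * W e ω) ∂P := by
  rw [hermiteL2, hermiteMulL2, inner_toLp_toLp]
  simp [mul_comm]

lemma inner_hermiteMulL2_self (hW : IsIsonormal W P) (q : ℕ) {h e : H} (hh : ‖h‖ = 1)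
    (he : ‖e‖ = 1) (hhe : ⟪h, e⟫ = 0) :
    ⟪hermiteMulL2 hW q h e, hermiteMulL2 hW q h e⟫ = q.factorial := by
  have h1 := (((IsCyl.hermite (W := W) q h).mul (IsCyl.hermite q h)).mul
    (IsCyl.of_apply e)).stein hW e
  rw [hermiteMulL2, inner_toLp_toLp]
  have h2 : ∀ ω, ⟪hermiteFun q (W h ω) * W e ω, hermiteFun q (W h ω) * W e ω⟫
      = W e ω * (hermiteFun q (W h ω) * hermiteFun q (W h ω) * W e ω) := fun ω => by
    simp only [RCLike.inner_apply, conj_trivial]; ring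
  simp only [h2]
  rw [h1]
  have h3 := integral_hermite_mul hW hh h (le_refl q)
  rw [if_pos rfl, real_inner_self_eq_norm_sq, hh] at h3
  rw [show (q.factorial : ℝ) = q.factorial * (1 ^ 2) ^ q by simp, ← h3]
  refine integral_congr_ae (.of_forall fun ω => ?_)
  simp only [inner_add_left, inner_smul_left, hhe, real_inner_self_eq_norm_sq, he]
  simp

/-- In a direction e orthogonal to h, integration by parts against W(e) does not differentiate
H_q(W(h)). The tangential gradient is thus a pairing of F with one explicit variable. -/
lemma inner_gradCLM_eq [CompleteSpace H] [IsProbabilityMeasure P] (hW : IsIsonormal W P)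
    {n q : ℕ} {h e : H} (hhe : ⟪h, e⟫ = 0) {F : Lp ℝ 2 P} (hF : F ∈ chaosLE hW n) :
    ⟪e, gradCLM hW n (hermiteL2 hW q h) F⟫ = ⟪hermiteMulL2 hW q h e, F⟫ := by
  refine chaosLE_ext hW (T := (innerSL ℝ e).comp (gradCLM hW n (hermiteL2 hW q h)))
    (S := innerSL ℝ (hermiteMulL2 hW q h e)) (fun p hp u hu => ?_) hF
  rw [ContinuousLinearMap.comp_apply, innerSL_apply_apply, innerSL_apply_apply,
    gradCLM_hermiteL2 hW hp hu, real_inner_comm, inner_smul_left, real_inner_comm (hermiteL2 hW p u),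
    inner_hermiteMulL2, inner_hermiteL2]
  have h1 := ((IsCyl.hermite (W := W) p u).mul (IsCyl.hermite q h)).stein hW e
  have h2 : ∀ ω, hermiteFun p (W u ω) * (hermiteFun q (W h ω) * W e ω)
      = W e ω * (hermiteFun p (W u ω) * hermiteFun q (W h ω)) := fun ω => by ring
  simp only [h2]
  rw [h1, conj_trivial, ← integral_const_mul, ← integral_mul_const]
  refine integral_congr_ae (.of_forall fun ω => ?_)
  simp only [inner_add_left, inner_smul_left, hhe, conj_trivial]
  ring

/-- A first-order expansion of H_{q+1}(W(·)) along the great circle through h and e. All inner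
products are explicit, so the squared remainder equals (q+1)! (1 - c^(2q) (1 + q s²)), which
Bernoulli's inequality bounds by (q+1)! q² s⁴. -/
lemma norm_hermiteL2_sub_le (hW : IsIsonormal W P) (q : ℕ) {h e : H} (hh : ‖h‖ = 1)
    (he : ‖e‖ = 1) (hhe : ⟪h, e⟫ = 0) {c s : ℝ} (hcs : c ^ 2 + s ^ 2 = 1) :
    ‖hermiteL2 hW (q + 1) (c • h + s • e) - c ^ (q + 1) • hermiteL2 hW (q + 1) h
      - ((q + 1) * c ^ q * s) • hermiteMulL2 hW q h e‖ ≤ √(q + 1).factorial * q * s ^ 2 := by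
  have hinner : ⟪h, c • h + s • e⟫ = c := by
    rw [inner_add_right, inner_smul_right, inner_smul_right, hhe, real_inner_self_eq_norm_sq, hh]
    simp
  have hinner' : ⟪e, c • h + s • e⟫ = s := by
    rw [inner_add_right, inner_smul_right, inner_smul_right, real_inner_comm, hhe,
      real_inner_self_eq_norm_sq, he]
    simp
  have hg : ‖c • h + s • e‖ = 1 := by
    rw [← sq_eq_sq₀ (norm_nonneg _) zero_le_one, ← real_inner_self_eq_norm_sq, inner_add_left,
      inner_smul_left, inner_smul_left, hinner, hinner']
    simp only [conj_trivial]
    linarith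
  set g := c • h + s • e with hgdef
  set a := hermiteL2 hW (q + 1) g
  set b := hermiteL2 hW (q + 1) h
  set v := hermiteMulL2 hW q h e
  have haa : ⟪a, a⟫ = (q + 1).factorial := by
    rw [real_inner_self_eq_norm_sq, norm_sq_hermiteL2 hW _ hg]
  have hbb : ⟪b, b⟫ = (q + 1).factorial := by
    rw [real_inner_self_eq_norm_sq, norm_sq_hermiteL2 hW _ hh]
  have hab : ⟪a, b⟫ = (q + 1).factorial * c ^ (q + 1) := by
    rw [inner_hermiteL2_of_le hW le_rfl (.inr hg), if_pos rfl, hinner]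
  have hvv : ⟪v, v⟫ = q.factorial := inner_hermiteMulL2_self hW q hh he hhe
  have hav : ⟪a, v⟫ = (q + 1).factorial * c ^ q * s := by
    have := integral_hermite_triple hW hg h e (q + 1) q 1 le_rfl
    rw [if_pos rfl, hinner, hinner'] at this
    simp only [hermiteFun_one, pow_one] at this
    rw [← this]
    exact inner_hermiteMulL2 hW _ _ _ _ _
  have hbv : ⟪b, v⟫ = 0 := by
    have := integral_hermite_triple hW hh h e (q + 1) q 1 le_rfl
    rw [if_pos rfl, real_inner_comm h e, hhe] at this
    simp only [hermiteFun_one, pow_one, mul_zero] at this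
    rw [← this]
    exact inner_hermiteMulL2 hW _ _ _ _ _
  have hva : ⟪v, a⟫ = (q + 1).factorial * c ^ q * s := by rw [real_inner_comm, hav]
  have hvb : ⟪v, b⟫ = 0 := by rw [real_inner_comm, hbv]
  have hba : ⟪b, a⟫ = (q + 1).factorial * c ^ (q + 1) := by rw [real_inner_comm, hab]
  have hfac : ((q + 1).factorial : ℝ) = (q + 1) * q.factorial := by
    rw [Nat.factorial_succ]; push_cast; ring
  have hbern : 1 - q * s ^ 2 ≤ (c ^ 2) ^ q := by
    have := one_add_mul_le_pow (a := -s ^ 2) (by nlinarith [sq_nonneg c]) q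
    rw [show 1 + -s ^ 2 = c ^ 2 by linarith] at this
    linarith
  rw [← abs_of_nonneg (norm_nonneg _), ← abs_of_nonneg (a := √_ * _ * _) (by positivity),
    ← sq_le_sq, ← real_inner_self_eq_norm_sq]
  have key : ⟪a - c ^ (q + 1) • b - ((q + 1) * c ^ q * s) • v,
      a - c ^ (q + 1) • b - ((q + 1) * c ^ q * s) • v⟫
      = (q + 1).factorial * (1 - (c ^ 2) ^ q * (1 + q * s ^ 2)) := by
    simp only [inner_sub_left, inner_sub_right, inner_smul_left, inner_smul_right, conj_trivial,
      haa, hbb, hab, hvv, hav, hbv, hva, hvb, hba]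
    rw [hfac]
    have : c ^ 2 = 1 - s ^ 2 := by linarith
    have h3 : (c ^ (q + 1)) ^ 2 = (c ^ 2) ^ q * (1 - s ^ 2) := by rw [← this]; ring
    have h4 : (c ^ q) ^ 2 = (c ^ 2) ^ q := by ring
    linear_combination (-(q + 1) * q.factorial) * h3 - (q + 1) ^ 2 * s ^ 2 * q.factorial * h4
  rw [key, mul_pow, mul_pow, Real.sq_sqrt (by positivity), mul_assoc]
  refine mul_le_mul_of_nonneg_left ?_ (by positivity)
  have h5 : (0 : ℝ) ≤ 1 + q * s ^ 2 := by positivity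
  nlinarith [mul_le_mul_of_nonneg_right hbern h5]

lemma abs_inner_hermiteL2_sub_le [CompleteSpace H] [IsProbabilityMeasure P]
    (hW : IsIsonormal W P) (q : ℕ) {h e : H} (hh : ‖h‖ = 1)
    (he : ‖e‖ = 1) (hhe : ⟪h, e⟫ = 0) {c s : ℝ} (hcs : c ^ 2 + s ^ 2 = 1)
    {F : Lp ℝ 2 P} (hF : F ∈ chaosLE hW (q + 1)) :
    |⟪hermiteL2 hW (q + 1) (c • h + s • e), F⟫ - c ^ (q + 1) * ⟪hermiteL2 hW (q + 1) h, F⟫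
      - (q + 1) * c ^ q * s * ⟪e, gradCLM hW (q + 1) (hermiteL2 hW q h) F⟫|
      ≤ √(q + 1).factorial * q * s ^ 2 * ‖F‖ := by
  rw [inner_gradCLM_eq hW hhe hF]
  refine le_trans (le_of_eq ?_) ((abs_real_inner_le_norm _ _).trans
    (mul_le_mul_of_nonneg_right (norm_hermiteL2_sub_le hW q hh he hhe hcs) (norm_nonneg F)))
  simp only [inner_sub_left, inner_smul_left, conj_trivial]

/-- If `cos^(q+1) A + (q+1) cos^q sin T ≤ M + K sin²` at a small angle, where `A` is almost `M`,
then `T` is small. -/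
lemma tangential_le {q : ℕ} {n M K ε σ δ A T : ℝ} (hn : n = q + 1)
    (hσ0 : 0 < σ) (hσ1 : σ < 1) (hσ2 : n * σ ≤ 1 / 2)
    (hσ3 : (n * M + K) * σ ≤ ε / 4) (hδ0 : 0 < δ) (h9 : δ ≤ σ * ε / 4) (hδM : δ ≤ M / 2)
    (hlt : M - δ < A) (hT : 0 ≤ T)
    (h2 : √(1 - σ ^ 2) ^ (q + 1) * A + n * √(1 - σ ^ 2) ^ q * σ * T ≤ M + K * σ ^ 2) : T ≤ ε := by
  have hn1 : 1 ≤ n := by simp [hn]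
  set c := √(1 - σ ^ 2) with hc
  have hσsq : σ ^ 2 ≤ 1 := by nlinarith
  have hcsq : c ^ 2 = 1 - σ ^ 2 := Real.sq_sqrt (by linarith)
  have hc0 : 0 ≤ c := Real.sqrt_nonneg _
  have hcge : 1 - σ ^ 2 ≤ c := by
    have : c ≤ 1 := by nlinarith
    nlinarith
  have hcn : 1 - n * σ ^ 2 ≤ c ^ (q + 1) := by
    have h1 := one_add_mul_le_pow (a := -σ ^ 2) (by linarith) (q + 1)
    have h2 : (1 + -σ ^ 2) ^ (q + 1) ≤ c ^ (q + 1) :=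
      pow_le_pow_left₀ (by linarith) (by linarith) _
    push_cast at h1
    simp only [hn]
    linarith
  have hcq : 1 / 2 ≤ n * c ^ q := by
    have h1 := one_add_mul_le_pow (a := -σ ^ 2) (by linarith) q
    have h2 : (1 + -σ ^ 2) ^ q ≤ c ^ q :=
      pow_le_pow_left₀ (by linarith) (by linarith) _
    have h3 : (q : ℝ) * σ ^ 2 ≤ n * σ := by
      have : (q : ℝ) ≤ n := by simp [hn]
      have : (0 : ℝ) ≤ q := by positivity
      nlinarith
    nlinarith
  have h6 : (1 - n * σ ^ 2) * (M - δ) ≤ c ^ (q + 1) * A := by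
    have h7 : 0 ≤ M - δ := by linarith
    exact mul_le_mul hcn hlt.le h7 (by positivity)
  have h8 : σ * T / 2 ≤ n * c ^ q * σ * T := by
    have : 0 ≤ σ * T := by positivity
    nlinarith
  have h10 : 0 ≤ n * σ ^ 2 * δ := by positivity
  have h11 : σ * T / 2 ≤ σ * ε / 2 := by
    have : (n * M + K) * σ * σ ≤ ε / 4 * σ := mul_le_mul_of_nonneg_right hσ3 hσ0.le
    nlinarith
  have : σ * T ≤ σ * ε := by linarith
  exact le_of_mul_le_mul_left this hσ0

/-- Near a maximiser of the leading symbol on the unit sphere its tangential gradient is small. -/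
lemma exists_almost_critical [CompleteSpace H] [IsProbabilityMeasure P] (hW : IsIsonormal W P)
    {q : ℕ} {F : Lp ℝ 2 P} (hF : F ∈ chaosLE hW (q + 1)) {h₀ : H} (hh₀ : ‖h₀‖ = 1)
    (hne : ⟪hermiteL2 hW (q + 1) h₀, F⟫ ≠ 0) :
    ∃ m > 0, ∀ ε > 0, ∃ h : H, ‖h‖ = 1 ∧ m ≤ |⟪hermiteL2 hW (q + 1) h, F⟫| ∧
      ‖gradCLM hW (q + 1) (hermiteL2 hW q h) F - ⟪hermiteL2 hW (q + 1) h, F⟫ • h‖ ≤ ε := by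
  set f : H → ℝ := fun h => ⟪hermiteL2 hW (q + 1) h, F⟫ with hf
  set S : Set ℝ := {x | ∃ h : H, ‖h‖ = 1 ∧ x = |f h|} with hS
  have hbdd : BddAbove S := by
    refine ⟨√(q + 1).factorial * ‖F‖, ?_⟩
    rintro _ ⟨h, hh, rfl⟩
    rw [← norm_hermiteL2 hW (q + 1) hh]
    exact abs_real_inner_le_norm _ _
  set M := sSup S with hM
  have hle : ∀ h : H, ‖h‖ = 1 → |f h| ≤ M := fun h hh => le_csSup hbdd ⟨h, hh, rfl⟩
  have hMpos : 0 < M := (abs_pos.2 hne).trans_le (hle h₀ hh₀)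
  refine ⟨M / 2, by positivity, fun ε hε => ?_⟩
  set K := √(q + 1).factorial * q * ‖F‖ with hK
  have hK0 : 0 ≤ K := by positivity
  set n : ℝ := q + 1 with hn
  have hn1 : 1 ≤ n := by simp [hn]
  -- σ is the sine of the rotation angle, chosen so that the second-order loss (n M + K) σ² is at
  -- most σ ε / 4; the gap δ to the supremum is then made at most σ ε / 4 as well.
  obtain ⟨σ, hσ0, hσ1, hσ2, hσ3⟩ : ∃ σ : ℝ, 0 < σ ∧ σ < 1 ∧ n * σ ≤ 1 / 2 ∧
      (n * M + K) * σ ≤ ε / 4 := by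
    refine ⟨min (1 / (2 * n)) (min (1 / 2) (ε / (4 * (n * M + K)))), ?_, ?_, ?_, ?_⟩
    · have : 0 < n * M + K := by positivity
      have : 0 < n := by linarith
      positivity
    · exact ((min_le_right _ _).trans (min_le_left _ _)).trans_lt (by norm_num)
    · refine (mul_le_mul_of_nonneg_left (min_le_left _ _) (by linarith)).trans ?_
      have : n ≠ 0 := by linarith
      field_simp; rfl
    · have h1 : 0 < n * M + K := by positivity
      refine (mul_le_mul_of_nonneg_left ((min_le_right _ _).trans (min_le_right _ _)) h1.le).trans ?_
      field_simp; rfl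
  set δ := min (σ * ε / 4) (M / 2) with hδ
  have hδ0 : 0 < δ := by positivity
  obtain ⟨_, ⟨h, hh, rfl⟩, hlt⟩ := exists_lt_of_lt_csSup (s := S) ⟨_, h₀, hh₀, rfl⟩
    (show M - δ < sSup S by linarith)
  refine ⟨h, hh, ?_, ?_⟩
  · have := min_le_right (σ * ε / 4) (M / 2)
    change M / 2 ≤ |f h|
    linarith
  change ‖gradCLM hW (q + 1) (hermiteL2 hW q h) F - f h • h‖ ≤ ε
  set G := gradCLM hW (q + 1) (hermiteL2 hW q h) F with hG
  set T := ‖G - f h • h‖ with hT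
  rcases (norm_nonneg (G - f h • h)).eq_or_lt with h0 | hpos
  · rw [hT, ← h0]; exact hε.le
  have hperp : ⟪h, G - f h • h⟫ = 0 := by
    rw [inner_sub_right, inner_smul_right, real_inner_self_eq_norm_sq, hh,
      inner_gradCLM_self hW hh hF]
    simp [hf]
  -- By Euler's identity the radial part of G is f(h) h, so e is the unit vector along the
  -- tangential part.
  set e := T⁻¹ • (G - f h • h) with he
  have he1 : ‖e‖ = 1 := by
    rw [he, norm_smul, norm_inv, Real.norm_of_nonneg (norm_nonneg _), ← hT,
      inv_mul_cancel₀ hpos.ne']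
  have hhe : ⟪h, e⟫ = 0 := by rw [he, inner_smul_right, hperp, mul_zero]
  have heG : ⟪e, G⟫ = T := by
    have h1 : ⟪e, G - f h • h⟫ = T := by
      rw [he, inner_smul_left, real_inner_self_eq_norm_sq, ← hT]
      simp only [conj_trivial]
      field_simp
    rw [inner_sub_right, inner_smul_right, real_inner_comm h e, hhe] at h1
    linarith
  set c := √(1 - σ ^ 2) with hc
  have hσsq : σ ^ 2 ≤ 1 := by nlinarith
  have hcsq : c ^ 2 = 1 - σ ^ 2 := Real.sq_sqrt (by linarith)
  -- t is a sign of f(h): moving from h towards t e makes the first-order term increase |f|.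
  obtain ⟨t, ht, htf⟩ : ∃ t : ℝ, (t = 1 ∨ t = -1) ∧ t * f h = |f h| := by
    rcases le_total 0 (f h) with h1 | h1
    · exact ⟨1, .inl rfl, by rw [abs_of_nonneg h1, one_mul]⟩
    · exact ⟨-1, .inr rfl, by rw [abs_of_nonpos h1]; ring⟩
  have htt : t * t = 1 := by rcases ht with rfl | rfl <;> norm_num
  have hts : (t * σ) ^ 2 = σ ^ 2 := by linear_combination σ ^ 2 * htt
  have hcs : c ^ 2 + (t * σ) ^ 2 = 1 := by rw [hts, hcsq]; ring
  have main := abs_inner_hermiteL2_sub_le hW q hh he1 hhe hcs hF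
  rw [← hG, heG, hts] at main
  have hunit : ‖c • h + (t * σ) • e‖ = 1 := by
    rw [← sq_eq_sq₀ (norm_nonneg _) zero_le_one, norm_add_sq_real, norm_smul, norm_smul, hh, he1,
      inner_smul_left, inner_smul_right, hhe]
    simp only [mul_zero, mul_one, Real.norm_eq_abs, sq_abs, one_pow, add_zero]
    exact hcs
  have hub := hle _ hunit
  have h1 : t * f (c • h + (t * σ) • e) ≤ M := by
    rcases ht with rfl | rfl
    · rw [one_mul]; exact (le_abs_self _).trans hub
    · rw [neg_one_mul]; exact (neg_le_abs _).trans hub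
  have h2 : c ^ (q + 1) * |f h| + n * c ^ q * σ * T ≤ M + K * σ ^ 2 := by
    have h3 : -(K * σ ^ 2) ≤ t * (f (c • h + (t * σ) • e) - c ^ (q + 1) * f h
        - n * c ^ q * (t * σ) * T) := by
      have h4 : |f (c • h + (t * σ) • e) - c ^ (q + 1) * f h
        - n * c ^ q * (t * σ) * T| ≤ K * σ ^ 2 := by
        refine main.trans (le_of_eq ?_)
        rw [hK]; ring
      rw [abs_le] at h4
      rcases ht with rfl | rfl <;> linarith [h4.1, h4.2]
    have h5 : t * (f (c • h + (t * σ) • e) - c ^ (q + 1) * f h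
        - n * c ^ q * (t * σ) * T) = t * f (c • h + (t * σ) • e) - c ^ (q + 1) * |f h|
        - n * c ^ q * σ * T := by
      rw [← htf]; linear_combination (-(n * c ^ q * σ * T)) * htt
    linarith
  exact tangential_le hn hσ0 hσ1 hσ2 hσ3 hδ0 (min_le_left _ _) (min_le_right _ _) hlt
    hpos.le h2

end Symbol


/-! ### Coefficients of the target polynomial. -/

section TargetPoly

lemma eval_zero_iterate_derivative (p : ℝ[X]) (r : ℕ) :
    (derivative^[r] p).eval 0 = r.factorial * p.coeff r := by
  rw [← coeff_zero_eq_eval_zero, coeff_iterate_derivative]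
  simp [Nat.descFactorial_self]

lemma targetPoly_monic {k : ℕ} (α : Fin k → ℝ) : (targetPoly α).Monic :=
  monic_X.mul (monic_prod_of_monic _ _ fun i _ => monic_X_sub_C (α i))

lemma natDegree_targetPoly {k : ℕ} (α : Fin k → ℝ) : (targetPoly α).natDegree = k + 1 := by
  rw [targetPoly, Monic.natDegree_mul monic_X (monic_prod_of_monic _ _ fun i _ => monic_X_sub_C _),
    natDegree_prod_of_monic _ _ fun i _ => monic_X_sub_C _]
  simp [add_comm]

lemma coeff_targetPoly_succ {k : ℕ} (α : Fin k → ℝ) : (targetPoly α).coeff (k + 1) = 1 := by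
  rw [← natDegree_targetPoly α]; exact targetPoly_monic α

lemma coeff_targetPoly_zero {k : ℕ} (α : Fin k → ℝ) : (targetPoly α).coeff 0 = 0 := by
  simp [targetPoly]

end TargetPoly

/-! ### Descent to order at most two. -/

section Descent

universe u

variable {Ω : Type*} {H : Type u} {mΩ : MeasurableSpace Ω} [NormedAddCommGroup H]
  [InnerProductSpace ℝ H] {P : Measure Ω} {W : H → Ω → ℝ}

/-- At a point where the gradient of f is radial up to ε, the symbol of Γ_{i+1} is a positive
constant times f · (symbol of Γ_i), by Euler's identity, up to O(ε). The constants a and b must not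
depend on h or ε, since h is chosen only after ε. -/
lemma exists_le_abs_inner_Gam [CompleteSpace H] [TopologicalSpace.SeparableSpace H]
    [IsProbabilityMeasure P]
    (hW : IsIsonormal W P) {r : ℕ} {F : Lp ℝ 2 P} (hF : F ∈ chaosLE hW (r + 2)) {m : ℝ}
    (hm : 0 < m) (i : ℕ) :
    ∃ a > 0, ∃ b ≥ 0, ∀ ε ≥ 0, ∀ h : H, ‖h‖ = 1 → m ≤ |⟪hermiteL2 hW (r + 2) h, F⟫| →
      ‖gradCLM hW (r + 2) (hermiteL2 hW (r + 1) h) F - ⟪hermiteL2 hW (r + 2) h, F⟫ • h‖ ≤ ε →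
      a - b * ε ≤ |⟪hermiteL2 hW (r + 2 + i * r) h, Gam W P F i⟫| := by
  induction i with
  | zero =>
    refine ⟨m, hm, 0, le_rfl, fun ε hε h hh hmh _ => ?_⟩
    simpa [Gam] using hmh
  | succ i ih =>
    obtain ⟨a, ha, b, hb, hab⟩ := ih
    set d := r + 1 + i * r with hd
    have hdeg : r + 2 + i * r = d + 1 := by omega
    have hmem : Gam W P F i ∈ chaosLE hW (d + 1) := by
      have := Gam_mem hW (by omega) hF i
      rwa [Nat.add_sub_cancel, hdeg] at this
    have hsucc : Gam W P F (i + 1) = gammaCLM hW (r + 2) (d + 1) F (Gam W P F i) := by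
      have := Gam_succ hW (by omega) hF i
      rwa [Nat.add_sub_cancel, hdeg] at this
    set κ : ℝ := (r + 1 + d).factorial / ((r + 1).factorial * (d + 1).factorial) with hκ
    have hκ0 : 0 < κ := by positivity
    -- A bound, uniform over unit vectors h, for the gradient of the symbol of Γ_i.
    set B : ℝ := ‖gradCLM hW (d + 1)‖ * √d.factorial * ‖Gam W P F i‖ with hB
    have hB0 : 0 ≤ B := by positivity
    refine ⟨κ * (m * a), by positivity, κ * (m * b + B), by positivity,
      fun ε hε h hh hmh hgrad => ?_⟩
    have h1 := hab ε hε h hh hmh hgrad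
    rw [hdeg] at h1
    have h2 := inner_hermiteL2_gammaCLM hW hh hF hmem
    rw [show r + 2 + (i + 1) * r = r + 1 + d by rw [hd]; ring, hsucc, h2, ← hκ, abs_mul,
      abs_of_pos hκ0, mul_comm m a, mul_comm m b]
    have h3 := inner_gradCLM_self hW hh hmem
    have h4 : ‖gradCLM hW (d + 1) (hermiteL2 hW d h) (Gam W P F i)‖ ≤ B := by
      refine (ContinuousLinearMap.le_opNorm₂ _ _ _).trans (le_of_eq ?_)
      rw [norm_hermiteL2 hW d hh]
    set f := ⟪hermiteL2 hW (r + 2) h, F⟫ with hf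
    set G := gradCLM hW (r + 2) (hermiteL2 hW (r + 1) h) F with hG
    set V := gradCLM hW (d + 1) (hermiteL2 hW d h) (Gam W P F i) with hV
    set g := ⟪hermiteL2 hW (d + 1) h, Gam W P F i⟫ with hg
    have h5 : ⟪G, V⟫ = ⟪G - f • h, V⟫ + f * g := by
      rw [inner_sub_left, inner_smul_left, h3]; simp
    have h6 : |⟪G - f • h, V⟫| ≤ ε * B :=
      (abs_real_inner_le_norm _ _).trans (mul_le_mul hgrad h4 (norm_nonneg _) hε)
    have h7 : m * (a - b * ε) ≤ |f * g| := by
      rw [abs_mul]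
      exact (mul_le_mul_of_nonneg_left h1 hm.le).trans
        (mul_le_mul_of_nonneg_right hmh (abs_nonneg _))
    have h8 : |f * g| ≤ |⟪G, V⟫| + |⟪G - f • h, V⟫| := by
      rw [show f * g = ⟪G, V⟫ - ⟪G - f • h, V⟫ by rw [h5]; ring]
      exact abs_sub _ _
    have h9 : m * (a - b * ε) - ε * B ≤ |⟪G, V⟫| := by linarith
    calc _ = κ * (m * (a - b * ε) - ε * B) := by ring
      _ ≤ _ := mul_le_mul_of_nonneg_left h9 hκ0.le

/-- If the iterate `Γ_k` has vanishing leading symbol, so has `F`. -/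
lemma starProjection_eq_zero_of_Gam [CompleteSpace H] [TopologicalSpace.SeparableSpace H]
    [IsProbabilityMeasure P]
    (hW : IsIsonormal W P) {r : ℕ} {F : Lp ℝ 2 P} (hF : F ∈ chaosLE hW (r + 2)) (k : ℕ)
    (hk : ∀ h : H, ‖h‖ = 1 → ⟪hermiteL2 hW (r + 2 + k * r) h, Gam W P F k⟫ = 0) :
    (chaos W P (r + 2)).starProjection F = 0 := by
  have hzero : ∀ h : H, ‖h‖ = 1 → ⟪hermiteL2 hW (r + 2) h, F⟫ = 0 := by
    by_contra! hcon
    obtain ⟨h₀, hh₀, hne⟩ := hcon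
    obtain ⟨m, hm, hcrit⟩ := exists_almost_critical hW hF hh₀ hne
    obtain ⟨a, ha, b, hb, hab⟩ := exists_le_abs_inner_Gam hW hF hm k
    -- Small enough that a - b ε stays positive.
    have hε : 0 < a / (2 * (b + 1)) := by positivity
    obtain ⟨h, hh, h1, h2⟩ := hcrit _ hε
    have h3 := hab _ hε.le h hh h1 h2
    rw [hk h hh, abs_zero] at h3
    have h4 : b * (a / (2 * (b + 1))) < a := by
      rw [mul_div_assoc', div_lt_iff₀ (by positivity)]
      nlinarith
    linarith
  rw [Submodule.starProjection_apply_eq_zero_iff, Submodule.mem_orthogonal]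
  intro X hX
  have : chaos W P (r + 2) ≤ (Submodule.span ℝ {F})ᗮ :=
    chaos_le_of_closed hW (Submodule.isClosed_orthogonal _) fun g hg => by
      rw [Submodule.mem_orthogonal_singleton_iff_inner_left]
      exact hzero g (hg.resolve_left (by omega))
  exact Submodule.mem_orthogonal_singleton_iff_inner_left.1 (this hX)

/-- The relation between the iterates `Γ_r`, as an identity in `L²`. -/
def GamRelation (hW : IsIsonormal W P) (F : Lp ℝ 2 P) (p : ℝ[X]) (k : ℕ) : Prop :=
  ∑ i ∈ Finset.range (k + 1), (p.coeff (i + 1) / 2 ^ i) •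
    (Gam W P F i - (∫ ω, Gam W P F i ω ∂P) • hermiteL2 hW 0 (0 : H)) = 0

/-- P^(r)(0) / r! is the coefficient of order r, and r = i + 1. Constants are written as multiples
of H_0, so that the relation can be fed to bounded operators. -/
lemma gamRelation_of_integral [IsProbabilityMeasure P] (hW : IsIsonormal W P) {F : Lp ℝ 2 P}
    {p : ℝ[X]} {k : ℕ}
    (hGam : ∫ ω, (∑ r ∈ Finset.Icc 1 (k + 1),
      (derivative^[r] p).eval 0 / ((r.factorial : ℝ) * 2 ^ (r - 1)) *
        (Gam W P F (r - 1) ω - ∫ ω', Gam W P F (r - 1) ω' ∂P)) ^ 2 ∂P = 0) :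
    GamRelation hW F p k := by
  rw [GamRelation]
  set X := ∑ i ∈ Finset.range (k + 1), (p.coeff (i + 1) / 2 ^ i) •
    (Gam W P F i - (∫ ω, Gam W P F i ω ∂P) • hermiteL2 hW 0 (0 : H)) with hX
  have h0 : ∀ᵐ ω ∂P, hermiteL2 hW 0 (0 : H) ω = 1 := by
    filter_upwards [coeFn_hermiteL2 hW 0 (0 : H)] with ω h; simp [h]
  have hXae : ∀ᵐ ω ∂P, X ω = ∑ r ∈ Finset.Icc 1 (k + 1),
      (derivative^[r] p).eval 0 / ((r.factorial : ℝ) * 2 ^ (r - 1)) *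
        (Gam W P F (r - 1) ω - ∫ ω', Gam W P F (r - 1) ω' ∂P) := by
    have h1 : ∀ i, ∀ᵐ ω ∂P, ((p.coeff (i + 1) / 2 ^ i) •
        (Gam W P F i - (∫ ω, Gam W P F i ω ∂P) • hermiteL2 hW 0 (0 : H)) : Lp ℝ 2 P) ω
        = p.coeff (i + 1) / 2 ^ i * (Gam W P F i ω - ∫ ω', Gam W P F i ω' ∂P) := fun i => by
      filter_upwards [Lp.coeFn_smul (p.coeff (i + 1) / 2 ^ i)
        (Gam W P F i - (∫ ω, Gam W P F i ω ∂P) • hermiteL2 hW 0 (0 : H)),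
        Lp.coeFn_sub (Gam W P F i) ((∫ ω, Gam W P F i ω ∂P) • hermiteL2 hW 0 (0 : H)),
        Lp.coeFn_smul (∫ ω, Gam W P F i ω ∂P) (hermiteL2 hW 0 (0 : H)), h0] with ω e1 e2 e3 e4
      rw [e1, Pi.smul_apply, e2, Pi.sub_apply, e3, Pi.smul_apply, e4]
      simp
    filter_upwards [Lp.coeFn_fun_finsetSum (Finset.range (k + 1)) (fun i => (p.coeff (i + 1) / 2 ^ i) •
        (Gam W P F i - (∫ ω, Gam W P F i ω ∂P) • hermiteL2 hW 0 (0 : H))), ae_all_iff.2 h1]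
      with ω e1 e2
    rw [hX, e1, Finset.sum_congr rfl fun i _ => e2 i, ← Finset.Ico_add_one_right_eq_Icc,
      Finset.sum_Ico_eq_sum_range]
    refine Finset.sum_congr rfl fun i _ => ?_
    rw [show 1 + i - 1 = i by omega, eval_zero_iterate_derivative, add_comm 1 i]
    have : ((i + 1).factorial : ℝ) ≠ 0 := by positivity
    field_simp
  have h2 : ∫ ω, X ω ^ 2 ∂P = 0 := by
    rw [← hGam]
    refine integral_congr_ae ?_
    filter_upwards [hXae] with ω h; rw [h]
  have h3 : ⟪X, X⟫ = 0 := by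
    rw [L2.inner_def, ← h2]
    refine integral_congr_ae (.of_forall fun ω => ?_)
    simp [sq]
  exact inner_self_eq_zero.1 h3

/-- While the order is r + 2 with r ≥ 1, pairing the relation with Hermite variables of order r + 2
+ k r isolates Γ_k. Its symbol vanishes, so the top component of F vanishes and the order drops. -/
lemma mem_chaosLE_of_gamRelation [CompleteSpace H] [TopologicalSpace.SeparableSpace H]
    [IsProbabilityMeasure P] (hW : IsIsonormal W P) {F : Lp ℝ 2 P} {p : ℝ[X]} {k : ℕ}
    (hp : p.coeff (k + 1) ≠ 0) (hrel : GamRelation hW F p k) {n : ℕ} (hF : F ∈ chaosLE hW n) :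
    F ∈ chaosLE hW 2 := by
  induction n with
  | zero => exact chaosLE_mono hW (by omega) hF
  | succ n ih =>
    rcases Nat.lt_or_ge n 2 with hn | hn
    · exact chaosLE_mono hW (by omega) hF
    obtain ⟨r, rfl⟩ : ∃ r, n = r + 1 := ⟨n - 1, by omega⟩
    refine ih ?_
    have h1 := starProjection_eq_zero_of_Gam hW hF k fun h hh => ?_
    · have := sub_starProjection_chaos_mem hW hF
      rwa [h1, sub_zero] at this
    have h2 := congrArg (fun Y => ⟪hermiteL2 hW (r + 2 + k * r) h, Y⟫) hrel
    simp only [inner_sum, inner_smul_right, inner_sub_right, inner_zero_right] at h2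
    have hc : ⟪hermiteL2 hW (r + 2 + k * r) h, hermiteL2 hW 0 (0 : H)⟫ = 0 :=
      inner_hermiteL2_of_ne hW (by omega) (.inr hh) (.inl rfl)
    -- For i < k the order r + 2 + i r is strictly smaller because r ≥ 1; for r = 0 all iterates
    -- would have the same order and the argument stops.
    rw [Finset.sum_range_succ, Finset.sum_eq_zero] at h2
    · simp only [hc, mul_zero, sub_zero, zero_add] at h2
      exact (mul_eq_zero.1 h2).resolve_left (by positivity)
    · intro i hi
      have hi' : i < k := Finset.mem_range.1 hi
      have hlt : r + 2 + i * r < r + 2 + k * r := by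
        have : i * r < k * r := Nat.mul_lt_mul_of_pos_right hi' (by omega)
        omega
      have hmem : Gam W P F i ∈ chaosLE hW (r + 2 + i * r) := by
        have := Gam_mem hW (by omega) hF i
        rwa [show r + 1 + 1 - 2 = r by omega] at this
      rw [hc, inner_hermiteL2_eq_zero_of_lt hW hlt hh hmem]
      simp

end Descent


/-! ### Operator and vector attached to a variable of order at most two. -/

section SecondChaos

universe u

variable {Ω : Type*} {H : Type u} {mΩ : MeasurableSpace Ω} [NormedAddCommGroup H]
  [InnerProductSpace ℝ H] {P : Measure Ω} {W : H → Ω → ℝ}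

lemma coeFn_hermiteMulL2 (hW : IsIsonormal W P) (q : ℕ) (h e : H) :
    hermiteMulL2 hW q h e =ᵐ[P] fun ω => hermiteFun q (W h ω) * W e ω := MemLp.coeFn_toLp _

lemma inner_hermiteL2_one (hW : IsIsonormal W P) (x y : H) :
    ⟪hermiteL2 hW 1 x, hermiteL2 hW 1 y⟫ = ⟪x, y⟫ := by
  rw [inner_hermiteL2]
  simp only [hermiteFun_one]
  exact hW.covariance x y

/-- The isometry `h ↦ W(h)` from `H` to `L²(P)`. -/
noncomputable def wienerCLM (hW : IsIsonormal W P) : H →L[ℝ] Lp ℝ 2 P :=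
  LinearMap.mkContinuous
    { toFun := hermiteL2 hW 1
      map_add' x y := by
        refine Lp.ext ?_
        filter_upwards [coeFn_hermiteL2 hW 1 (x + y), coeFn_hermiteL2 hW 1 x,
          coeFn_hermiteL2 hW 1 y, hW.add_ae x y,
          Lp.coeFn_add (hermiteL2 hW 1 x) (hermiteL2 hW 1 y)] with ω h1 h2 h3 h4 h5
        rw [h1, h5, Pi.add_apply, h2, h3]
        simpa using h4
      map_smul' c x := by
        refine Lp.ext ?_
        filter_upwards [coeFn_hermiteL2 hW 1 (c • x), coeFn_hermiteL2 hW 1 x, hW.smul_ae x c,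
          Lp.coeFn_smul c (hermiteL2 hW 1 x)] with ω h1 h2 h4 h5
        rw [h1, RingHom.id_apply, h5, Pi.smul_apply, h2]
        simpa using h4 }
    1 (fun x => by
      rw [one_mul]
      change ‖hermiteL2 hW 1 x‖ ≤ _
      rw [← abs_of_nonneg (norm_nonneg _), ← abs_of_nonneg (norm_nonneg x), ← sq_le_sq,
        ← real_inner_self_eq_norm_sq, ← real_inner_self_eq_norm_sq, inner_hermiteL2_one])

/-- The operator `x ↦ E[W(x) DF] / 2` on `H`. -/
noncomputable def opCLM [CompleteSpace H] [IsProbabilityMeasure P] (hW : IsIsonormal W P) :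
    Lp ℝ 2 P →L[ℝ] H →L[ℝ] H :=
  (1 / 2 : ℝ) • ((ContinuousLinearMap.compL ℝ H (Lp ℝ 2 P) H).flip (wienerCLM hW)).comp
    (gradCLM hW 2).flip

lemma opCLM_apply [CompleteSpace H] [IsProbabilityMeasure P] (hW : IsIsonormal W P)
    (F : Lp ℝ 2 P) (x : H) :
    opCLM hW F x = (1 / 2 : ℝ) • gradCLM hW 2 (hermiteL2 hW 1 x) F := rfl

/-- The vector `E[DF]`. -/
noncomputable def vecCLM [CompleteSpace H] [IsProbabilityMeasure P] (hW : IsIsonormal W P) :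
    Lp ℝ 2 P →L[ℝ] H := gradCLM hW 2 (hermiteL2 hW 0 0)

/-- The factor 1/2 is chosen so that H_2(W(u)) corresponds to the projection u ⊗ u; orders 0 and 1
are killed. -/
lemma opCLM_hermiteL2 [CompleteSpace H] [IsProbabilityMeasure P] (hW : IsIsonormal W P) {p : ℕ}
    (hp : p ≤ 2) {u : H} (hu : p = 0 ∨ ‖u‖ = 1) (x : H) :
    opCLM hW (hermiteL2 hW p u) x = (if p = 2 then ⟪u, x⟫ else 0 : ℝ) • u := by
  rw [opCLM_apply, gradCLM_hermiteL2 hW hp hu, smul_smul]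
  congr 1
  interval_cases p
  · simp
  · rw [inner_hermiteL2]
    simp [hW.centered]
  · rw [inner_hermiteL2_one]
    simp

lemma vecCLM_hermiteL2 [CompleteSpace H] [IsProbabilityMeasure P] (hW : IsIsonormal W P) {p : ℕ}
    (hp : p ≤ 2) {u : H} (hu : p = 0 ∨ ‖u‖ = 1) :
    vecCLM hW (hermiteL2 hW p u) = (if p = 1 then 1 else 0 : ℝ) • u := by
  rw [vecCLM, gradCLM_hermiteL2 hW hp hu]
  congr 1
  interval_cases p
  · simp
  · rw [inner_hermiteL2]
    simp
  · rw [inner_hermiteL2]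
    simp [hW.centered]

lemma inner_gradCLM_one [CompleteSpace H] [IsProbabilityMeasure P] (hW : IsIsonormal W P)
    {n : ℕ} (x y : H) {F : Lp ℝ 2 P} (hF : F ∈ chaosLE hW n) :
    ⟪y, gradCLM hW n (hermiteL2 hW 1 x) F⟫
      = ⟪hermiteMulL2 hW 1 x y, F⟫ - ⟪x, y⟫ * ⟪hermiteL2 hW 0 (0 : H), F⟫ := by
  refine chaosLE_ext hW (T := (innerSL ℝ y).comp (gradCLM hW n (hermiteL2 hW 1 x)))
    (S := innerSL ℝ (hermiteMulL2 hW 1 x y) - ⟪x, y⟫ • innerSL ℝ (hermiteL2 hW 0 (0 : H)))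
    (fun p hp u hu => ?_) hF
  rw [ContinuousLinearMap.comp_apply, sub_apply, smul_apply, innerSL_apply_apply,
    innerSL_apply_apply, innerSL_apply_apply,
    gradCLM_hermiteL2 hW hp hu, real_inner_comm, inner_smul_left,
    real_inner_comm (hermiteL2 hW p u), real_inner_comm (hermiteL2 hW p u),
    inner_hermiteMulL2, inner_hermiteL2, inner_hermiteL2]
  have h1 := ((IsCyl.hermite (W := W) p u).mul (IsCyl.of_apply x)).stein hW y
  have h2 : ∀ ω, hermiteFun p (W u ω) * (W x ω * W y ω)
      = W y ω * (hermiteFun p (W u ω) * W x ω) := fun ω => by ring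
  simp only [hermiteFun_zero, mul_one, hermiteFun_one, h2]
  rw [h1]
  have i1 : Integrable (fun ω => hermiteFun p (W u ω)) P := (IsCyl.hermite p u).integrable hW
  have i2 : Integrable (fun ω => hermiteFun (p - 1) (W u ω) * W x ω) P :=
    ((IsCyl.hermite (p - 1) u).mul (IsCyl.of_apply x)).integrable hW
  have h3 : ∀ ω, ⟪hermiteFun p (W u ω) • x + W x ω • (p * hermiteFun (p - 1) (W u ω)) • u, y⟫
      = hermiteFun p (W u ω) * ⟪x, y⟫
        + (hermiteFun (p - 1) (W u ω) * W x ω) * (p * ⟪u, y⟫) := fun ω => by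
    simp only [inner_add_left, inner_smul_left, conj_trivial]; ring
  simp only [h3]
  rw [integral_add (i1.mul_const _) (i2.mul_const _), integral_mul_const, integral_mul_const]
  simp only [conj_trivial, smul_eq_mul]
  ring

lemma inner_vecCLM [CompleteSpace H] [IsProbabilityMeasure P] (hW : IsIsonormal W P)
    (y : H) {F : Lp ℝ 2 P} (hF : F ∈ chaosLE hW 2) :
    ⟪y, vecCLM hW F⟫ = ⟪hermiteL2 hW 1 y, F⟫ := by
  refine chaosLE_ext hW (T := (innerSL ℝ y).comp (vecCLM hW)) (S := innerSL ℝ (hermiteL2 hW 1 y))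
    (fun p hp u hu => ?_) hF
  rw [ContinuousLinearMap.comp_apply, innerSL_apply_apply, innerSL_apply_apply,
    vecCLM_hermiteL2 hW hp hu, inner_smul_right]
  interval_cases p
  · rw [inner_hermiteL2]
    simp [hW.centered]
  · rw [inner_hermiteL2_one]; simp
  · rw [real_inner_comm (hermiteL2 hW 2 u), inner_hermiteL2_of_le hW (show 1 ≤ 2 by norm_num) (.inr (hu.resolve_left (by simp)))]
    simp

/-- Wick's formula for at most four Gaussian factors, obtained by one integration by parts in W(y).
-/
lemma integral_hermite_mul_mul (hW : IsIsonormal W P) (u v x y : H) {i j : ℕ} (hi : i ≤ 1)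
    (hj : j ≤ 1) :
    ∫ ω, (W x ω * W y ω) * (hermiteFun i (W u ω) * hermiteFun j (W v ω)) ∂P
      = ⟪x, y⟫ * ∫ ω, hermiteFun i (W u ω) * hermiteFun j (W v ω) ∂P
        + if i = 1 ∧ j = 1 then ⟪u, x⟫ * ⟪v, y⟫ + ⟪v, x⟫ * ⟪u, y⟫ else 0 := by
  have h1 := ((IsCyl.of_apply (W := W) x).mul
    ((IsCyl.hermite (W := W) i u).mul (IsCyl.hermite j v))).stein hW y
  have h2 : ∀ ω, (W x ω * W y ω) * (hermiteFun i (W u ω) * hermiteFun j (W v ω))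
      = W y ω * (W x ω * (hermiteFun i (W u ω) * hermiteFun j (W v ω))) := fun ω => by ring
  simp only [h2]
  rw [h1]
  have i0 : Integrable (fun ω => hermiteFun i (W u ω) * hermiteFun j (W v ω)) P :=
    ((IsCyl.hermite i u).mul (IsCyl.hermite j v)).integrable hW
  have i1 : Integrable (fun ω => hermiteFun i (W u ω) * hermiteFun (j - 1) (W v ω) * W x ω) P :=
    (((IsCyl.hermite i u).mul (IsCyl.hermite (j - 1) v)).mul (IsCyl.of_apply x)).integrable hW
  have i2 : Integrable (fun ω => hermiteFun (i - 1) (W u ω) * hermiteFun j (W v ω) * W x ω) P :=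
    (((IsCyl.hermite (i - 1) u).mul (IsCyl.hermite j v)).mul (IsCyl.of_apply x)).integrable hW
  have h3 : ∀ ω, ⟪W x ω • (hermiteFun i (W u ω) • (j * hermiteFun (j - 1) (W v ω)) • v
      + hermiteFun j (W v ω) • (i * hermiteFun (i - 1) (W u ω)) • u)
      + (hermiteFun i (W u ω) * hermiteFun j (W v ω)) • x, y⟫
      = (hermiteFun i (W u ω) * hermiteFun (j - 1) (W v ω) * W x ω) * (j * ⟪v, y⟫)
        + (hermiteFun (i - 1) (W u ω) * hermiteFun j (W v ω) * W x ω) * (i * ⟪u, y⟫)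
        + (hermiteFun i (W u ω) * hermiteFun j (W v ω)) * ⟪x, y⟫ := fun ω => by
    simp only [inner_add_left, inner_smul_left, conj_trivial]; ring
  simp only [h3]
  have i3 : Integrable (fun ω => hermiteFun i (W u ω) * hermiteFun (j - 1) (W v ω) * W x ω *
      (j * ⟪v, y⟫) + hermiteFun (i - 1) (W u ω) * hermiteFun j (W v ω) * W x ω * (i * ⟪u, y⟫)) P :=
    (i1.mul_const _).add (i2.mul_const _)
  rw [integral_add i3 (i0.mul_const _), integral_add (i1.mul_const _) (i2.mul_const _),
    integral_mul_const, integral_mul_const, integral_mul_const]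
  interval_cases i <;> interval_cases j <;> simp [hW.centered, hW.covariance] <;> ring

lemma inner_gammaCLM_hermiteL2 [CompleteSpace H] (hW : IsIsonormal W P) {n m a b : ℕ} (ha : a ≤ n)
    (hb : b ≤ m) {u v : H} (hu : a = 0 ∨ ‖u‖ = 1) (hv : b = 0 ∨ ‖v‖ = 1) {Z : Lp ℝ 2 P} {z : Ω → ℝ}
    (hZ : Z =ᵐ[P] z) :
    ⟪Z, gammaCLM hW n m (hermiteL2 hW a u) (hermiteL2 hW b v)⟫ = (a * ((b : ℝ) / b) * ⟪u, v⟫) *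
      ∫ ω, z ω * (hermiteFun (a - 1) (W u ω) * hermiteFun (b - 1) (W v ω)) ∂P := by
  rw [← integral_const_mul, L2.inner_def]
  refine integral_congr_ae ?_
  filter_upwards [gammaCLM_hermiteL2 hW ha hb hu hv, hZ] with ω h1 h2
  rw [h1, h2]
  simp only [RCLike.inner_apply, conj_trivial]
  ring

/-- Among generators only two factors of order 2 contribute: Γ(H_2(W(u)), H_2(W(v))) = 2⟨u, v⟩ W(u)
W(v), whose operator is the anticommutator of u ⊗ u and v ⊗ v. -/
lemma opCLM_gammaCLM [CompleteSpace H] [IsProbabilityMeasure P] (hW : IsIsonormal W P)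
    {F G : Lp ℝ 2 P} (hF : F ∈ chaosLE hW 2) (hG : G ∈ chaosLE hW 2) :
    opCLM hW (gammaCLM hW 2 2 F G) = opCLM hW F * opCLM hW G + opCLM hW G * opCLM hW F := by
  have key := chaosLE_ext₂ hW
    (B := (ContinuousLinearMap.compL ℝ (Lp ℝ 2 P) (Lp ℝ 2 P) (H →L[ℝ] H) (opCLM hW)).comp
      (gammaCLM hW 2 2))
    (B' := (ContinuousLinearMap.mul ℝ (H →L[ℝ] H)).bilinearComp (opCLM hW) (opCLM hW)
      + ((ContinuousLinearMap.mul ℝ (H →L[ℝ] H)).bilinearComp (opCLM hW) (opCLM hW)).flip)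
    (fun a ha u hu b hb v hv => ?_) hF hG
  · exact key
  ext x
  refine ext_inner_left ℝ fun y => ?_
  change ⟪y, opCLM hW (gammaCLM hW 2 2 (hermiteL2 hW a u) (hermiteL2 hW b v)) x⟫
    = ⟪y, opCLM hW (hermiteL2 hW a u) (opCLM hW (hermiteL2 hW b v) x)
      + opCLM hW (hermiteL2 hW b v) (opCLM hW (hermiteL2 hW a u) x)⟫
  rw [opCLM_hermiteL2 hW ha hu, opCLM_hermiteL2 hW ha hu, opCLM_hermiteL2 hW hb hv,
    opCLM_hermiteL2 hW hb hv, opCLM_apply, inner_smul_right, inner_gradCLM_one hW x y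
      (gammaCLM_mem hW (n := 2) (m := 2) (hermiteL2_mem_chaosLE hW ha hu) (hermiteL2_mem_chaosLE hW hb hv))]
  have e1 := inner_gammaCLM_hermiteL2 hW ha hb hu hv (coeFn_hermiteMulL2 hW 1 x y)
  have e2 := inner_gammaCLM_hermiteL2 hW ha hb hu hv (coeFn_hermiteL2 hW 0 (0 : H))
  simp only [hermiteFun_one, hermiteFun_zero, one_mul] at e1 e2
  rw [e1, e2, integral_hermite_mul_mul hW u v x y (by omega) (by omega)]
  simp only [inner_add_right, inner_smul_right]
  rw [real_inner_comm u v, real_inner_comm u y, real_inner_comm v y]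
  by_cases hab : a = 2 ∧ b = 2
  · obtain ⟨rfl, rfl⟩ := hab
    norm_num
    ring
  · rcases not_and_or.1 hab with h | h
    · rw [if_neg h, if_neg h]
      rcases (show a = 0 ∨ a = 1 by omega) with rfl | rfl <;> simp; ring
    · rw [if_neg h, if_neg h]
      rcases (show b = 0 ∨ b = 1 by omega) with rfl | rfl <;> simp; ring

lemma integral_mul_mul_eq_zero (hW : IsIsonormal W P) (u v y : H) :
    ∫ ω, W y ω * (W u ω * W v ω) ∂P = 0 := by
  rw [((IsCyl.of_apply u).mul (IsCyl.of_apply v)).stein hW y]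
  simp only [inner_add_left, inner_smul_left, conj_trivial]
  rw [integral_add, integral_mul_const, integral_mul_const, hW.centered, hW.centered]
  · simp
  · exact ((IsCyl.of_apply u).integrable hW).mul_const _
  · exact ((IsCyl.of_apply v).integrable hW).mul_const _

/-- The asymmetry comes from L⁻¹ in the second slot: it halves the derivative of H_2(W(v)) there,
while H_2(W(u)) in the first slot keeps its factor 2. -/
lemma vecCLM_gammaCLM_hermiteL2 [CompleteSpace H] [IsProbabilityMeasure P] (hW : IsIsonormal W P)
    {a b : ℕ} (ha : a ≤ 2) (hb : b ≤ 2) {u v : H} (hu : a = 0 ∨ ‖u‖ = 1) (hv : b = 0 ∨ ‖v‖ = 1) :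
    vecCLM hW (gammaCLM hW 2 2 (hermiteL2 hW a u) (hermiteL2 hW b v))
      = (2 : ℝ) • opCLM hW (hermiteL2 hW a u) (vecCLM hW (hermiteL2 hW b v))
        + opCLM hW (hermiteL2 hW b v) (vecCLM hW (hermiteL2 hW a u)) := by
  refine ext_inner_left ℝ fun y => ?_
  have e1 := inner_vecCLM hW y
    (gammaCLM_mem hW (n := 2) (m := 2) (hermiteL2_mem_chaosLE hW ha hu) (hermiteL2_mem_chaosLE hW hb hv))
  have e2 := inner_gammaCLM_hermiteL2 hW ha hb hu hv (coeFn_hermiteL2 hW 1 y)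
  rw [opCLM_hermiteL2 hW ha hu, opCLM_hermiteL2 hW hb hv, vecCLM_hermiteL2 hW ha hu,
    vecCLM_hermiteL2 hW hb hv, e1, e2]
  simp only [hermiteFun_one, inner_add_right, inner_smul_right]
  rw [real_inner_comm u v]
  interval_cases a <;> interval_cases b <;>
    simp [hW.centered, hW.covariance, integral_mul_mul_eq_zero hW, mul_assoc]

lemma vecCLM_gammaCLM [CompleteSpace H] [IsProbabilityMeasure P] (hW : IsIsonormal W P)
    {F G : Lp ℝ 2 P} (hF : F ∈ chaosLE hW 2) (hG : G ∈ chaosLE hW 2) :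
    vecCLM hW (gammaCLM hW 2 2 F G)
      = (2 : ℝ) • opCLM hW F (vecCLM hW G) + opCLM hW G (vecCLM hW F) := by
  set B : Lp ℝ 2 P →L[ℝ] Lp ℝ 2 P →L[ℝ] H :=
    (ContinuousLinearMap.id ℝ (H →L[ℝ] H)).bilinearComp (opCLM hW) (vecCLM hW) with hB
  have hBa : ∀ X Y, B X Y = opCLM hW X (vecCLM hW Y) := fun X Y => rfl
  set B₁ : Lp ℝ 2 P →L[ℝ] Lp ℝ 2 P →L[ℝ] H :=
    (ContinuousLinearMap.compL ℝ (Lp ℝ 2 P) (Lp ℝ 2 P) H (vecCLM hW)).comp (gammaCLM hW 2 2)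
    with hB₁
  have hB₁a : ∀ X Y, B₁ X Y = vecCLM hW (gammaCLM hW 2 2 X Y) := fun X Y => rfl
  clear_value B B₁
  have key := chaosLE_ext₂ hW (B := B₁) (B' := (2 : ℝ) • B + B.flip)
    (fun a ha u hu b hb v hv => by
      rw [hB₁a, vecCLM_gammaCLM_hermiteL2 hW ha hb hu hv, add_apply, add_apply, smul_apply,
        smul_apply, ContinuousLinearMap.flip_apply, hBa, hBa]) hF hG
  rwa [hB₁a, add_apply, add_apply, smul_apply, smul_apply, ContinuousLinearMap.flip_apply, hBa,
    hBa] at key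

end SecondChaos


/-! ### Coprimality of the two annihilating polynomials. -/

section Algebra

/-- With `p = x Q(x)`, `Q` with simple nonzero roots, the polynomials `p` and `2 Q + x Q'` are
coprime. -/
lemma isCoprime_targetPoly {k : ℕ} {α : Fin k → ℝ} (hα0 : ∀ i, α i ≠ 0)
    (hα : Function.Injective α) :
    IsCoprime (targetPoly α)
      (2 * ∏ i, (X - C (α i)) + X * derivative (∏ i, (X - C (α i)))) := by
  set Q : ℝ[X] := ∏ i, (X - C (α i)) with hQ
  have hsep : IsCoprime Q (derivative Q) := separable_prod_X_sub_C_iff.2 hα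
  have hXQ : IsCoprime X Q := by
    refine IsCoprime.prod_right fun i _ => ?_
    have := pairwise_coprime_X_sub_C (K := ℝ) (s := (id : ℝ → ℝ)) Function.injective_id
      (hα0 i).symm
    simpa [Function.onFun] using this
  have h2 : IsUnit (2 : ℝ[X]) := by
    rw [show (2 : ℝ[X]) = C 2 from (map_ofNat C 2).symm]
    exact isUnit_C.2 (by norm_num)
  refine IsCoprime.mul_left ?_ ?_
  · refine IsCoprime.add_mul_left_right ?_ _
    exact (isCoprime_mul_unit_left_right h2 _ _).2 hXQ
  · rw [mul_comm 2 Q, add_comm]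
    exact IsCoprime.add_mul_left_right (hXQ.symm.mul_right hsep) _

lemma divX_targetPoly {k : ℕ} (α : Fin k → ℝ) : divX (targetPoly α) = ∏ i, (X - C (α i)) := by
  ext n
  rw [targetPoly, coeff_divX, coeff_X_mul]

end Algebra

/-! ### Vanishing of the component in the first chaos. -/

section SecondChaos

universe u

variable {Ω : Type*} {H : Type u} {mΩ : MeasurableSpace Ω} [NormedAddCommGroup H]
  [InnerProductSpace ℝ H] {P : Measure Ω} {W : H → Ω → ℝ}

lemma opCLM_Gam [CompleteSpace H] [TopologicalSpace.SeparableSpace H] [IsProbabilityMeasure P]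
    (hW : IsIsonormal W P) {F : Lp ℝ 2 P} (hF : F ∈ chaosLE hW 2) (i : ℕ) :
    opCLM hW (Gam W P F i) = (2 : ℝ) ^ i • opCLM hW F ^ (i + 1) := by
  induction i with
  | zero => simp [Gam]
  | succ i ih =>
    have hmem := Gam_mem hW le_rfl hF i
    have hsucc := Gam_succ hW le_rfl hF i
    simp only [Nat.sub_self, mul_zero, add_zero] at hmem hsucc
    rw [hsucc, opCLM_gammaCLM hW hF hmem, ih, mul_smul_comm, smul_mul_assoc, ← pow_succ, ← pow_succ',
      ← two_smul ℝ, smul_smul, pow_succ (2 : ℝ), mul_comm]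

/-- The coefficients c_i of A^i v satisfy c_{i+1} = 2 c_i + 2^i with c_0 = 1. -/
lemma vecCLM_Gam [CompleteSpace H] [TopologicalSpace.SeparableSpace H] [IsProbabilityMeasure P]
    (hW : IsIsonormal W P) {F : Lp ℝ 2 P} (hF : F ∈ chaosLE hW 2) (i : ℕ) :
    vecCLM hW (Gam W P F i)
      = ((i + 2) / 2 * 2 ^ i : ℝ) • (opCLM hW F ^ i) (vecCLM hW F) := by
  induction i with
  | zero => simp [Gam]
  | succ i ih =>
    have hmem := Gam_mem hW le_rfl hF i
    have hsucc := Gam_succ hW le_rfl hF i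
    simp only [Nat.sub_self, mul_zero, add_zero] at hmem hsucc
    rw [hsucc, vecCLM_gammaCLM hW hF hmem, ih, opCLM_Gam hW hF, map_smul, smul_apply,
      ← mul_apply_eq_comp, ← pow_succ', smul_smul, ← add_smul]
    congr 1
    push_cast; ring

lemma opCLM_const [CompleteSpace H] [IsProbabilityMeasure P] (hW : IsIsonormal W P) :
    opCLM hW (hermiteL2 hW 0 (0 : H)) = 0 := by
  ext x
  rw [opCLM_hermiteL2 hW (by norm_num) (.inl rfl)]
  simp

lemma vecCLM_const [CompleteSpace H] [IsProbabilityMeasure P] (hW : IsIsonormal W P) :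
    vecCLM hW (hermiteL2 hW 0 (0 : H)) = 0 := by
  rw [vecCLM_hermiteL2 hW (by norm_num) (.inl rfl)]
  simp

lemma aeval_opCLM_eq_zero [CompleteSpace H] [TopologicalSpace.SeparableSpace H]
    [IsProbabilityMeasure P] (hW : IsIsonormal W P) {F : Lp ℝ 2 P} (hF : F ∈ chaosLE hW 2)
    {p : ℝ[X]} {k : ℕ} (hp : p.natDegree ≤ k + 1) (hp0 : p.coeff 0 = 0)
    (hrel : GamRelation hW F p k) : aeval (opCLM hW F) p = 0 := by
  have h1 := congrArg (opCLM hW) hrel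
  rw [map_sum, map_zero] at h1
  rw [aeval_eq_sum_range' (n := k + 1 + 1) (by omega), Finset.sum_range_succ', hp0, zero_smul,
    add_zero, ← h1]
  refine Finset.sum_congr rfl fun i _ => ?_
  rw [map_smul, map_sub, map_smul, opCLM_const, smul_zero, sub_zero, opCLM_Gam hW hF, smul_smul]
  congr 1
  field_simp

/-- The powers of 2 cancel, and twice the vector of the relation is the sum of (i + 2) p_{i+1} A^i
v. Here (i + 1) p_{i+1} comes from the derivative and p_{i+1} from division by x. -/
lemma aeval_opCLM_vecCLM_eq_zero [CompleteSpace H] [TopologicalSpace.SeparableSpace H]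
    [IsProbabilityMeasure P] (hW : IsIsonormal W P) {F : Lp ℝ 2 P} (hF : F ∈ chaosLE hW 2)
    {p : ℝ[X]} {k : ℕ} (hp : p.natDegree ≤ k + 1)
    (hrel : GamRelation hW F p k) :
    aeval (opCLM hW F) (derivative p + divX p) (vecCLM hW F) = 0 := by
  have h1 := congrArg (vecCLM hW) hrel
  rw [map_sum, map_zero] at h1
  have hdeg : (derivative p + divX p).natDegree < k + 1 := by
    refine (natDegree_add_le _ _).trans_lt (max_lt ?_ ?_)
    · have := natDegree_derivative_le p; omega
    · rw [natDegree_divX_eq_natDegree_tsub_one]; omega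
  have h2 := congrArg ((2 : ℝ) • ·) h1
  simp only [smul_zero] at h2
  have h3 : aeval (opCLM hW F) (derivative p + divX p) (vecCLM hW F)
      = ∑ i ∈ Finset.range (k + 1), (p.coeff (i + 1) * (i + 2)) • (opCLM hW F ^ i) (vecCLM hW F) := by
    rw [aeval_eq_sum_range' (n := k + 1) hdeg, sum_apply]
    refine Finset.sum_congr rfl fun i _ => ?_
    rw [smul_apply, coeff_add, coeff_derivative, coeff_divX]
    congr 1
    ring
  rw [h3, ← h2, Finset.smul_sum]
  refine Finset.sum_congr rfl fun i _ => ?_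
  rw [map_smul, map_sub, map_smul, vecCLM_const, smul_zero, sub_zero, vecCLM_Gam hW hF, smul_smul,
    smul_smul]
  congr 1
  field_simp

/-- A Bézout identity for two coprime polynomials in A, both of which annihilate v. -/
lemma vecCLM_eq_zero [CompleteSpace H] [TopologicalSpace.SeparableSpace H]
    [IsProbabilityMeasure P] (hW : IsIsonormal W P) {F : Lp ℝ 2 P} (hF : F ∈ chaosLE hW 2)
    {k : ℕ} {α : Fin k → ℝ} (hα0 : ∀ i, α i ≠ 0) (hα : Function.Injective α)
    (hrel : GamRelation hW F (targetPoly α) k) : vecCLM hW F = 0 := by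
  have h1 := aeval_opCLM_eq_zero hW hF (natDegree_targetPoly α).le (coeff_targetPoly_zero α) hrel
  have h2 := aeval_opCLM_vecCLM_eq_zero hW hF (natDegree_targetPoly α).le hrel
  obtain ⟨a, b, hab⟩ := isCoprime_targetPoly hα0 hα
  have h3 : derivative (targetPoly α) + divX (targetPoly α)
      = 2 * ∏ i, (X - C (α i)) + X * derivative (∏ i, (X - C (α i))) := by
    rw [divX_targetPoly, targetPoly, derivative_mul, derivative_X]
    ring
  rw [h3] at h2
  have h4 := congrArg (fun p => aeval (opCLM hW F) p (vecCLM hW F)) hab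
  simp only [map_add, map_mul, map_one] at h4 h2
  rw [h1, mul_zero, zero_add, mul_apply_eq_comp, h2, map_zero,
    one_apply_eq_self] at h4
  exact h4.symm

lemma starProjection_chaos_zero_eq_zero (hW : IsIsonormal W P) {M : ℕ} {F : Lp ℝ 2 P}
    (hF : F ∈ ⨆ q ∈ Finset.Icc 1 M, chaos W P q) : (chaos W P 0).starProjection F = 0 := by
  have : ⨆ q ∈ Finset.Icc 1 M, chaos W P q
      ≤ LinearMap.ker (chaos W P 0).starProjection.toLinearMap :=
    iSup₂_le fun q hq Y hY => starProjection_chaos_of_mem_ne hW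
      (by have := (Finset.mem_Icc.1 hq).1; omega) hY
  exact this hF

lemma integral_eq_zero_of_mem_iSup [IsProbabilityMeasure P] (hW : IsIsonormal W P) {M : ℕ}
    {F : Lp ℝ 2 P} (hF : F ∈ ⨆ q ∈ Finset.Icc 1 M, chaos W P q) : ∫ ω, F ω ∂P = 0 := by
  have h1 := (Submodule.starProjection_apply_eq_zero_iff _).1
    (starProjection_chaos_zero_eq_zero hW hF)
  have h2 := (Submodule.mem_orthogonal _ _).1 h1 _ (hermiteL2_mem_chaos hW (h := 0) (.inl rfl))
  rw [L2.inner_def] at h2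
  rw [← h2]
  refine integral_congr_ae ?_
  filter_upwards [coeFn_hermiteL2 hW 0 (0 : H)] with ω h
  simp [h]

/-- A variable in a finite sum of chaoses of positive order satisfying the relation between its
iterates `Γ_r` lies in the second chaos. -/
theorem mem_chaos_two [CompleteSpace H] [TopologicalSpace.SeparableSpace H]
    [IsProbabilityMeasure P] (hW : IsIsonormal W P) {k : ℕ} {α : Fin k → ℝ}
    (hα0 : ∀ i, α i ≠ 0) (hα : Function.Injective α) {M : ℕ} {F : Lp ℝ 2 P}
    (hF : F ∈ ⨆ q ∈ Finset.Icc 1 M, chaos W P q)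
    (hrel : GamRelation hW F (targetPoly α) k) : F ∈ chaos W P 2 := by
  have h2 : F ∈ chaosLE hW 2 := mem_chaosLE_of_gamRelation hW
    (by rw [coeff_targetPoly_succ]; exact one_ne_zero) hrel (iSup_chaos_le hW M hF)
  have hvec := vecCLM_eq_zero hW h2 hα0 hα hrel
  have h1 : (chaos W P 1).starProjection F = 0 := by
    rw [Submodule.starProjection_apply_eq_zero_iff, Submodule.mem_orthogonal]
    intro X hX
    have : chaos W P 1 ≤ (Submodule.span ℝ {F})ᗮ :=
      chaos_le_of_closed hW (Submodule.isClosed_orthogonal _) fun g hg => by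
        rw [Submodule.mem_orthogonal_singleton_iff_inner_left, ← inner_vecCLM hW g h2, hvec,
          inner_zero_right]
    exact Submodule.mem_orthogonal_singleton_iff_inner_left.1 (this hX)
  have h3 := sum_starProjection_chaos hW h2
  rw [Finset.sum_range_succ, Finset.sum_range_succ, Finset.sum_range_one,
    starProjection_chaos_zero_eq_zero hW hF, h1, zero_add, zero_add] at h3
  rw [← h3]
  exact Submodule.starProjection_apply_mem _ _

end SecondChaos


/-! ### Sine and cosine as admissible test functions. -/

section Trigonometric

lemma temperate_sin : Real.sin.HasTemperateGrowth :=
  ⟨Real.contDiff_sin, fun n => ⟨0, 1, fun x => by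
    rw [norm_iteratedFDeriv_eq_norm_iteratedDeriv]
    simpa using Real.abs_iteratedDeriv_sin_le_one n x⟩⟩

lemma temperate_cos : Real.cos.HasTemperateGrowth :=
  ⟨Real.contDiff_cos, fun n => ⟨0, 1, fun x => by
    rw [norm_iteratedFDeriv_eq_norm_iteratedDeriv]
    simpa using Real.abs_iteratedDeriv_cos_le_one n x⟩⟩

lemma temperate_sin_mul (t : ℝ) : (fun x => Real.sin (t * x)).HasTemperateGrowth :=
  temperate_sin.comp ((Function.HasTemperateGrowth.const t).mul .id')

lemma temperate_cos_mul (t : ℝ) : (fun x => Real.cos (t * x)).HasTemperateGrowth :=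
  temperate_cos.comp ((Function.HasTemperateGrowth.const t).mul .id')

lemma hasDerivAt_sin_mul (t x : ℝ) :
    HasDerivAt (fun x => Real.sin (t * x)) (t * Real.cos (t * x)) x := by
  simpa [mul_comm] using ((hasDerivAt_id x).const_mul t).sin

lemma hasDerivAt_cos_mul (t x : ℝ) :
    HasDerivAt (fun x => Real.cos (t * x)) (-t * Real.sin (t * x)) x := by
  simpa [mul_comm] using ((hasDerivAt_id x).const_mul t).cos

lemma lipschitz_of_hasDerivAt {f f' : ℝ → ℝ} {c : ℝ} (hf : ∀ x, HasDerivAt f (f' x) x)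
    (hc : ∀ x, |f' x| ≤ c) : LipschitzWith c.toNNReal f :=
  lipschitzWith_of_nnnorm_deriv_le (fun x => (hf x).differentiableAt) fun x => by
    rw [(hf x).deriv, ← NNReal.coe_le_coe, coe_nnnorm, Real.norm_eq_abs,
      Real.coe_toNNReal _ ((abs_nonneg _).trans (hc x))]
    exact hc x

lemma lipschitz_sin_mul (t : ℝ) : LipschitzWith |t|.toNNReal fun x => Real.sin (t * x) :=
  lipschitz_of_hasDerivAt (hasDerivAt_sin_mul t) fun x => by
    rw [abs_mul]
    exact mul_le_of_le_one_right (abs_nonneg _) (Real.abs_cos_le_one _)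

lemma lipschitz_cos_mul (t : ℝ) : LipschitzWith |t|.toNNReal fun x => Real.cos (t * x) :=
  lipschitz_of_hasDerivAt (hasDerivAt_cos_mul t) fun x => by
    rw [abs_mul, abs_neg]
    exact mul_le_of_le_one_right (abs_nonneg _) (Real.abs_sin_le_one _)

end Trigonometric

/-! ### Covariance formula for functions of F. -/

section Duality

universe u

variable {Ω : Type*} {H : Type u} {mΩ : MeasurableSpace Ω} [NormedAddCommGroup H]
  [InnerProductSpace ℝ H] {P : Measure Ω} {W : H → Ω → ℝ}

/-- Composition with a Lipschitz function on `L²` of a probability measure. -/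
noncomputable def lipComp [IsProbabilityMeasure P] {c : NNReal} {φ : ℝ → ℝ}
    (hφ : LipschitzWith c φ) (F : Lp ℝ 2 P) : Lp ℝ 2 P :=
  (show LipschitzWith c fun x => φ x - φ 0 from fun x y => by
    simpa [edist_dist, Real.dist_eq] using hφ x y).compLp (by simp) F
    + (memLp_const (φ 0)).toLp

lemma coeFn_lipComp [IsProbabilityMeasure P] {c : NNReal} {φ : ℝ → ℝ}
    (hφ : LipschitzWith c φ) (F : Lp ℝ 2 P) : lipComp hφ F =ᵐ[P] fun ω => φ (F ω) := by
  have h : LipschitzWith c fun x => φ x - φ 0 := fun x y => by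
    simpa [edist_dist, Real.dist_eq] using hφ x y
  filter_upwards [Lp.coeFn_add (h.compLp (by simp) F) ((memLp_const (φ 0)).toLp),
    h.coeFn_compLp (by simp) F, (memLp_const (μ := P) (p := 2) (φ 0)).coeFn_toLp] with ω h1 h2 h3
  rw [lipComp, h1, Pi.add_apply, h2, h3]
  simp

lemma continuous_lipComp [IsProbabilityMeasure P] {c : NNReal} {φ : ℝ → ℝ}
    (hφ : LipschitzWith c φ) : Continuous (lipComp (P := P) hφ) := by
  have h : LipschitzWith c fun x => φ x - φ 0 := fun x y => by
    simpa [edist_dist, Real.dist_eq] using hφ x y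
  exact (h.continuous_compLp (by simp)).add continuous_const

/-- Integration by parts against the Hermite variable moves one derivative onto φ(F), while the
weight of L⁻¹ cancels the order produced by D. For q = 0 both sides are zero. -/
lemma duality_of_isCyl [CompleteSpace H] [IsProbabilityMeasure P] (hW : IsIsonormal W P)
    {n m : ℕ} {F : Lp ℝ 2 P} {U : Ω → ℝ} {DU : Ω → H} (hU : IsCyl W U DU) (hFU : F =ᵐ[P] U)
    (hDU : derivCLM hW n F =ᵐ[P] DU) {c c' : NNReal} {φ : ℝ → ℝ} (hφ : φ.HasTemperateGrowth)
    (hc : LipschitzWith c φ) (hc' : LipschitzWith c' (deriv φ))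
    {q : ℕ} (hq : q ≤ m) {v : H} (hv : q = 0 ∨ ‖v‖ = 1) :
    ⟪lipComp hc F, hermiteL2 hW q v⟫
      - ⟪lipComp hc F, hermiteL2 hW 0 (0 : H)⟫ * ⟪hermiteL2 hW 0 (0 : H), hermiteL2 hW q v⟫
      = ⟪lipComp hc' F, gammaCLM hW n m F (hermiteL2 hW q v)⟫ := by
  have hΓ : gammaCLM hW n m F (hermiteL2 hW q v) =ᵐ[P]
      fun ω => ((q : ℝ) / q) * (⟪DU ω, v⟫ * hermiteFun (q - 1) (W v ω)) := by
    refine (coeFn_gammaCLM hW n m _ _).trans ?_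
    rw [invGen_hermiteL2 hW hq hv, map_smul, derivCLM_hermiteL2 hW hq hv]
    filter_upwards [hDU, coeFn_derivHermite hW q v,
      Lp.coeFn_smul (-(1 / (q : ℝ))) (derivHermite hW q v)] with ω h1 h2 h3
    rw [h1, h3, Pi.smul_apply, h2]
    simp only [inner_smul_right, inner_neg_right]
    ring
  have hR : ⟪lipComp hc' F, gammaCLM hW n m F (hermiteL2 hW q v)⟫
      = ∫ ω, deriv φ (U ω) * (((q : ℝ) / q) * (⟪DU ω, v⟫ * hermiteFun (q - 1) (W v ω))) ∂P := by
    rw [L2.inner_def]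
    refine integral_congr_ae ?_
    filter_upwards [coeFn_lipComp hc' F, hΓ, hFU] with ω h1 h2 h3
    rw [h1, h2, h3]
    simp [mul_comm]
  rcases q with _ | q
  · rw [hR, hermiteL2_zero hW v 0, inner_hermiteL2]
    simp
  have hv' : ‖v‖ = 1 := hv.resolve_left (by omega)
  rw [inner_hermiteL2_of_ne hW (by omega) (.inl rfl) hv, mul_zero, sub_zero, hR]
  have h1 := (hU.comp hφ).stein_hermite hW hv' q
  have h2 : ⟪lipComp hc F, hermiteL2 hW (q + 1) v⟫
      = ∫ ω, hermiteFun (q + 1) (W v ω) * φ (U ω) ∂P := by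
    rw [L2.inner_def]
    refine integral_congr_ae ?_
    filter_upwards [coeFn_lipComp hc F, coeFn_hermiteL2 hW (q + 1) v, hFU] with ω h1 h2 h3
    rw [h1, h2, h3]
    simp
  rw [h2, h1]
  refine integral_congr_ae (.of_forall fun ω => ?_)
  have : ((q + 1 : ℕ) : ℝ) / ((q + 1 : ℕ) : ℝ) = 1 := div_self (by positivity)
  simp only [inner_smul_left, conj_trivial, this, Nat.add_sub_cancel]
  ring

/-- Integration by parts: `Cov(φ(F), G) = E[φ'(F) Γ(F, G)]`. -/
lemma duality [CompleteSpace H] [IsProbabilityMeasure P] (hW : IsIsonormal W P)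
    {n m : ℕ} {F G : Lp ℝ 2 P} (hF : F ∈ chaosLE hW n) (hG : G ∈ chaosLE hW m)
    {c c' : NNReal} {φ : ℝ → ℝ} (hφ : φ.HasTemperateGrowth)
    (hc : LipschitzWith c φ) (hc' : LipschitzWith c' (deriv φ)) :
    ⟪lipComp hc F, G⟫ - ⟪lipComp hc F, hermiteL2 hW 0 (0 : H)⟫ * ⟪hermiteL2 hW 0 (0 : H), G⟫
      = ⟪lipComp hc' F, gammaCLM hW n m F G⟫ := by
  -- In G both sides are bounded and linear, so G may be a generator. In F they are nonlinear but
  -- continuous, as φ and φ' are Lipschitz, so the identity passes from the span of the generators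
  -- to its closure.
  refine chaosLE_ext hW (T := innerSL ℝ (lipComp hc F)
      - ⟪lipComp hc F, hermiteL2 hW 0 (0 : H)⟫ • innerSL ℝ (hermiteL2 hW 0 (0 : H)))
    (S := (innerSL ℝ (lipComp hc' F)).comp (gammaCLM hW n m F)) (fun q hq v hv => ?_) hG
  change ⟪lipComp hc F, hermiteL2 hW q v⟫
      - ⟪lipComp hc F, hermiteL2 hW 0 (0 : H)⟫ * ⟪hermiteL2 hW 0 (0 : H), hermiteL2 hW q v⟫
      = ⟪lipComp hc' F, gammaCLM hW n m F (hermiteL2 hW q v)⟫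
  have hcont := continuous_lipComp (P := P) hc
  have hcont' := continuous_lipComp (P := P) hc'
  have hcl : IsClosed {F : Lp ℝ 2 P | ⟪lipComp hc F, hermiteL2 hW q v⟫
      - ⟪lipComp hc F, hermiteL2 hW 0 (0 : H)⟫ * ⟪hermiteL2 hW 0 (0 : H), hermiteL2 hW q v⟫
      = ⟪lipComp hc' F, gammaCLM hW n m F (hermiteL2 hW q v)⟫} := by
    have hg : Continuous fun F => gammaCLM hW n m F (hermiteL2 hW q v) :=
      ((gammaCLM hW n m).flip (hermiteL2 hW q v)).continuous
    exact isClosed_eq ((hcont.inner continuous_const).sub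
      ((hcont.inner continuous_const).mul continuous_const)) (hcont'.inner hg)
  refine closure_minimal (fun F hF => ?_) hcl hF
  obtain ⟨U, DU, hU, hFU, hDU⟩ := exists_isCyl_of_mem_span hW hF
  exact duality_of_isCyl hW hU hFU hDU hφ hc hc' hq hv

lemma integrable_mul_lipschitz [IsProbabilityMeasure P] (F X : Lp ℝ 2 P) {c : NNReal} {φ : ℝ → ℝ}
    (hc : LipschitzWith c φ) : Integrable (fun ω => X ω * φ (F ω)) P :=
  (L2.integrable_inner (𝕜 := ℝ) (lipComp hc F) X).congr (by
    filter_upwards [coeFn_lipComp hc F] with ω h1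
    rw [h1]; simp)

lemma inner_lipComp [IsProbabilityMeasure P] (F X : Lp ℝ 2 P) {c : NNReal} {φ : ℝ → ℝ}
    (hc : LipschitzWith c φ) : ⟪lipComp hc F, X⟫ = ∫ ω, X ω * φ (F ω) ∂P := by
  rw [L2.inner_def]
  refine integral_congr_ae ?_
  filter_upwards [coeFn_lipComp hc F] with ω h1
  rw [h1]; simp

lemma integral_mul_sub_lipschitz [CompleteSpace H] [IsProbabilityMeasure P] (hW : IsIsonormal W P)
    {n m : ℕ} {F G : Lp ℝ 2 P} (hF : F ∈ chaosLE hW n) (hG : G ∈ chaosLE hW m)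
    {c c' : NNReal} {φ : ℝ → ℝ} (hφ : φ.HasTemperateGrowth)
    (hc : LipschitzWith c φ) (hc' : LipschitzWith c' (deriv φ)) :
    ∫ ω, G ω * φ (F ω) ∂P - (∫ ω, G ω ∂P) * ∫ ω, φ (F ω) ∂P
      = ∫ ω, gammaCLM hW n m F G ω * deriv φ (F ω) ∂P := by
  have h0 : ∀ᵐ ω ∂P, hermiteL2 hW 0 (0 : H) ω = 1 := by
    filter_upwards [coeFn_hermiteL2 hW 0 (0 : H)] with ω h; simp [h]
  have h1 := duality hW hF hG hφ hc hc'
  rw [inner_lipComp, inner_lipComp, inner_lipComp, L2.inner_def] at h1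
  rw [← h1, mul_comm]
  congr 2
  · refine integral_congr_ae ?_
    filter_upwards [h0] with ω h; simp [h]
  · refine integral_congr_ae ?_
    filter_upwards [h0] with ω h; simp [h]

/-- `E[X e^{itF}]`. -/
noncomputable def expMean (P : Measure Ω) (F X : Lp ℝ 2 P) (t : ℝ) : ℂ :=
  ((∫ ω, X ω * Real.cos (t * F ω) ∂P : ℝ) : ℂ)
    + ((∫ ω, X ω * Real.sin (t * F ω) ∂P : ℝ) : ℂ) * Complex.I

lemma expMean_eq [IsProbabilityMeasure P] (F X : Lp ℝ 2 P) (t : ℝ) :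
    expMean P F X t = ∫ ω, (X ω : ℂ) * Complex.exp (t * F ω * Complex.I) ∂P := by
  have h1 : ∀ ω, (X ω : ℂ) * Complex.exp (t * F ω * Complex.I)
      = ((X ω * Real.cos (t * F ω) : ℝ) : ℂ)
        + ((X ω * Real.sin (t * F ω) : ℝ) : ℂ) * Complex.I := fun ω => by
    rw [Complex.exp_mul_I]; push_cast; ring
  simp only [h1]
  rw [integral_add, integral_mul_const, integral_complex_ofReal, integral_complex_ofReal, expMean]
  · exact (integrable_mul_lipschitz F X (lipschitz_cos_mul t)).ofReal
  · exact (integrable_mul_lipschitz F X (lipschitz_sin_mul t)).ofReal.mul_const _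

lemma expMean_gammaCLM [CompleteSpace H] [IsProbabilityMeasure P] (hW : IsIsonormal W P)
    {n m : ℕ} {F G : Lp ℝ 2 P} (hF : F ∈ chaosLE hW n) (hG : G ∈ chaosLE hW m) (t : ℝ) :
    expMean P F G t - (∫ ω, G ω ∂P : ℝ) * expMean P F (hermiteL2 hW 0 (0 : H)) t
      = t * Complex.I * expMean P F (gammaCLM hW n m F G) t := by
  have h0 : ∀ᵐ ω ∂P, hermiteL2 hW 0 (0 : H) ω = 1 := by
    filter_upwards [coeFn_hermiteL2 hW 0 (0 : H)] with ω h; simp [h]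
  have h1 : ∀ f : ℝ → ℝ, ∫ ω, hermiteL2 hW 0 (0 : H) ω * f (F ω) ∂P = ∫ ω, f (F ω) ∂P := fun f =>
    integral_congr_ae (by filter_upwards [h0] with ω h; simp [h])
  have hds : deriv (fun x => Real.sin (t * x)) = fun x => t * Real.cos (t * x) :=
    funext fun x => (hasDerivAt_sin_mul t x).deriv
  have hdc : deriv (fun x => Real.cos (t * x)) = fun x => -t * Real.sin (t * x) :=
    funext fun x => (hasDerivAt_cos_mul t x).deriv
  have hls : LipschitzWith (|t| * |t|).toNNReal (deriv fun x => Real.sin (t * x)) := by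
    rw [hds]
    refine lipschitz_of_hasDerivAt (fun x => (hasDerivAt_cos_mul t x).const_mul t) fun x => ?_
    rw [abs_mul, abs_mul, abs_neg, ← mul_assoc]
    exact mul_le_of_le_one_right (by positivity) (Real.abs_sin_le_one _)
  have hlc : LipschitzWith (|t| * |t|).toNNReal (deriv fun x => Real.cos (t * x)) := by
    rw [hdc]
    refine lipschitz_of_hasDerivAt (fun x => (hasDerivAt_sin_mul t x).const_mul (-t)) fun x => ?_
    rw [abs_mul, abs_mul, abs_neg, ← mul_assoc]
    exact mul_le_of_le_one_right (by positivity) (Real.abs_cos_le_one _)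
  have hs := integral_mul_sub_lipschitz hW hF hG (temperate_sin_mul t) (lipschitz_sin_mul t) hls
  have hc := integral_mul_sub_lipschitz hW hF hG (temperate_cos_mul t) (lipschitz_cos_mul t) hlc
  rw [hds] at hs
  rw [hdc] at hc
  have hs' : ∫ ω, gammaCLM hW n m F G ω * (t * Real.cos (t * F ω)) ∂P
      = t * ∫ ω, gammaCLM hW n m F G ω * Real.cos (t * F ω) ∂P := by
    rw [← integral_const_mul]; congr 1; ext ω; ring
  have hc' : ∫ ω, gammaCLM hW n m F G ω * (-t * Real.sin (t * F ω)) ∂P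
      = -t * ∫ ω, gammaCLM hW n m F G ω * Real.sin (t * F ω) ∂P := by
    rw [← integral_const_mul]; congr 1; ext ω; ring
  rw [hs'] at hs
  rw [hc'] at hc
  simp only [expMean]
  rw [h1 fun x => Real.cos (t * x), h1 fun x => Real.sin (t * x)]
  have hs2 := congrArg (fun x : ℝ => (x : ℂ)) hs
  have hc2 := congrArg (fun x : ℝ => (x : ℂ)) hc
  push_cast at hs2 hc2 ⊢
  linear_combination hc2 + Complex.I * hs2 - t * (∫ ω, gammaCLM hW n m F G ω * Real.sin (t * F ω) ∂P : ℝ) * Complex.I_sq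

end Duality


/-! ### Coefficients of the differential equation. -/

section Polynomials

/-- The denominator of the derivative of the logarithm of the characteristic function. -/
noncomputable def denomPoly (p : ℝ[X]) (k : ℕ) : ℝ[X] :=
  ∑ j ∈ Finset.range (k + 1), C (p.coeff (j + 1) / 2 ^ j) * X ^ (k - j)

/-- The numerator of the derivative of the logarithm of the characteristic function. -/
noncomputable def numPoly (p : ℝ[X]) (k : ℕ) (E : ℕ → ℝ) : ℝ[X] :=
  ∑ j ∈ Finset.range (k + 1), C (p.coeff (j + 1) / 2 ^ j) *
    ∑ l ∈ Finset.range (j + 1), C (E l) * X ^ (k - j + l)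

lemma natDegree_numPoly_le (p : ℝ[X]) (k : ℕ) (E : ℕ → ℝ) : (numPoly p k E).natDegree ≤ k := by
  refine natDegree_sum_le_of_forall_le _ _ fun j hj => ?_
  refine (natDegree_C_mul_le _ _).trans (natDegree_sum_le_of_forall_le _ _ fun l hl => ?_)
  refine (natDegree_C_mul_X_pow_le _ _).trans ?_
  rw [Finset.mem_range] at hj hl
  omega

lemma coeff_zero_numPoly (p : ℝ[X]) (k : ℕ) {E : ℕ → ℝ} (hE : E 0 = 0) :
    (numPoly p k E).coeff 0 = 0 := by
  rw [numPoly, finsetSum_coeff]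
  refine Finset.sum_eq_zero fun j _ => ?_
  rw [coeff_C_mul, finsetSum_coeff, Finset.sum_eq_zero, mul_zero]
  intro l _
  rw [coeff_C_mul_X_pow]
  split_ifs with h
  · rw [show l = 0 by omega, hE]
  · rfl

/-- With Q = P/x, the polynomial is the reversal s^k Q(1/(2s)), and each factor s (1/(2s) - α_i) is
1/2 - s α_i. On the imaginary axis these have real part 1/2, so the equation has no singularity. -/
lemma aeval_denomPoly_targetPoly {k : ℕ} (α : Fin k → ℝ) (s : ℂ) :
    aeval s (denomPoly (targetPoly α) k) = ∏ i, (1 / 2 - s * (α i : ℂ)) := by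
  have h1 : ∀ j, (targetPoly α).coeff (j + 1) = (∏ i, (X - C (α i))).coeff j := fun j => by
    rw [targetPoly, coeff_X_mul]
  have hdeg : (∏ i, (X - C (α i)) : ℝ[X]).natDegree = k := by
    rw [natDegree_prod_of_monic _ _ fun i _ => monic_X_sub_C _]
    simp
  rw [denomPoly, map_sum]
  simp only [map_mul, map_pow, aeval_C, aeval_X, h1]
  rcases eq_or_ne s 0 with rfl | hs
  · rw [Finset.sum_range_succ, Finset.sum_eq_zero]
    · have : (∏ i, (X - C (α i)) : ℝ[X]).coeff k = 1 := by
        rw [← h1, coeff_targetPoly_succ]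
      simp [this]
    · intro j hj
      rw [Finset.mem_range] at hj
      rw [zero_pow (by omega), mul_zero]
  · have h2 : aeval (1 / (2 * s)) (∏ i, (X - C (α i)) : ℝ[X])
        = ∏ i, (1 / (2 * s) - (α i : ℂ)) := by
      rw [map_prod]
      simp
    have h3 : ∏ i, (1 / 2 - s * (α i : ℂ)) = s ^ k * ∏ i, (1 / (2 * s) - (α i : ℂ)) := by
      rw [show s ^ k = ∏ _i : Fin k, s by simp, ← Finset.prod_mul_distrib]
      refine Finset.prod_congr rfl fun i _ => ?_
      field_simp
    rw [h3, ← h2, aeval_eq_sum_range' (n := k + 1) (by omega), Finset.mul_sum]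
    refine Finset.sum_congr rfl fun j hj => ?_
    rw [Finset.mem_range] at hj
    have h4 : s ^ k = s ^ (k - j) * s ^ j := by rw [← pow_add]; congr 1; omega
    rw [h4]
    simp only [Complex.coe_algebraMap, Complex.ofReal_div, Complex.ofReal_pow, Complex.ofReal_ofNat,
      Complex.real_smul, div_pow, mul_pow, one_pow]
    field_simp

lemma aeval_denomPoly_targetPoly_ne_zero {k : ℕ} (α : Fin k → ℝ) (t : ℝ) :
    aeval ((t : ℂ) * Complex.I) (denomPoly (targetPoly α) k) ≠ 0 := by
  rw [aeval_denomPoly_targetPoly, Finset.prod_ne_zero_iff]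
  intro i _ h
  have := congrArg Complex.re h
  norm_num at this

end Polynomials

/-! ### The equation for E[F e^{itF}]. -/

section Equation

universe u

variable {Ω : Type*} {H : Type u} {mΩ : MeasurableSpace Ω} [NormedAddCommGroup H]
  [InnerProductSpace ℝ H] {P : Measure Ω} {W : H → Ω → ℝ}

lemma expMean_eq_inner [IsProbabilityMeasure P] (F X : Lp ℝ 2 P) (t : ℝ) :
    expMean P F X t = ((⟪lipComp (lipschitz_cos_mul t) F, X⟫ : ℝ) : ℂ)
      + ((⟪lipComp (lipschitz_sin_mul t) F, X⟫ : ℝ) : ℂ) * Complex.I := by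
  rw [expMean, inner_lipComp, inner_lipComp]

lemma sum_expMean_eq_zero [IsProbabilityMeasure P] (hW : IsIsonormal W P) {F : Lp ℝ 2 P}
    {p : ℝ[X]} {k : ℕ} (hrel : GamRelation hW F p k) (t : ℝ) :
    ∑ j ∈ Finset.range (k + 1), ((p.coeff (j + 1) / 2 ^ j : ℝ) : ℂ) *
      (expMean P F (Gam W P F j) t - ((∫ ω, Gam W P F j ω ∂P : ℝ) : ℂ) *
        expMean P F (hermiteL2 hW 0 (0 : H)) t) = 0 := by
  have h1 : ∀ Z : Lp ℝ 2 P, ∑ j ∈ Finset.range (k + 1), (p.coeff (j + 1) / 2 ^ j) *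
      (⟪Z, Gam W P F j⟫ - (∫ ω, Gam W P F j ω ∂P) * ⟪Z, hermiteL2 hW 0 (0 : H)⟫) = 0 := fun Z => by
    have := congrArg (fun Y => ⟪Z, Y⟫) hrel
    simpa only [inner_sum, inner_smul_right, inner_sub_right, inner_zero_right] using this
  have h2 := congrArg (fun x : ℝ => (x : ℂ)) (h1 (lipComp (lipschitz_cos_mul t) F))
  have h3 := congrArg (fun x : ℝ => (x : ℂ)) (h1 (lipComp (lipschitz_sin_mul t) F))
  simp only [expMean_eq_inner]
  push_cast at h2 h3 ⊢
  have h4 := congrArg₂ (fun x y => x + y * Complex.I) h2 h3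
  simp only [zero_mul, add_zero] at h4
  rw [← h4, Finset.sum_mul, ← Finset.sum_add_distrib]
  refine Finset.sum_congr rfl fun j _ => ?_
  ring

/-- The differential equation for the characteristic function. -/
lemma aeval_denomPoly_mul_expMean [CompleteSpace H] [TopologicalSpace.SeparableSpace H]
    [IsProbabilityMeasure P] (hW : IsIsonormal W P) {F : Lp ℝ 2 P} {n : ℕ} (hn : 2 ≤ n)
    (hF : F ∈ chaosLE hW n) {p : ℝ[X]} {k : ℕ} (hrel : GamRelation hW F p k) (t : ℝ) :
    aeval ((t : ℂ) * Complex.I) (denomPoly p k) * expMean P F F t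
      = aeval ((t : ℂ) * Complex.I) (numPoly p k fun j => ∫ ω, Gam W P F j ω ∂P) *
        expMean P F (hermiteL2 hW 0 (0 : H)) t := by
  set s : ℂ := (t : ℂ) * Complex.I with hs
  set φ := expMean P F (hermiteL2 hW 0 (0 : H)) t with hφ
  set E : ℕ → ℝ := fun j => ∫ ω, Gam W P F j ω ∂P with hE
  have hstep : ∀ j, expMean P F (Gam W P F j) t - (E j : ℂ) * φ
      = s * expMean P F (Gam W P F (j + 1)) t := fun j => by
    rw [Gam_succ hW hn hF j]
    exact expMean_gammaCLM hW hF (Gam_mem hW hn hF j) t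
  -- Iterating the one-step formula expresses every E[Γ_j e^{itF}], after multiplication by s^j,
  -- through E[F e^{itF}] and φ.
  have hsum : ∀ j, s ^ j * (expMean P F (Gam W P F j) t - (E j : ℂ) * φ)
      = expMean P F F t - ∑ l ∈ Finset.range (j + 1), (E l : ℂ) * s ^ l * φ := fun j => by
    induction j with
    | zero => simp [Gam]
    | succ j ih =>
      rw [Finset.sum_range_succ, ← sub_sub, ← ih, hstep j]
      ring
  have hrel' := sum_expMean_eq_zero hW hrel t
  -- The factor s^k = s^(k-j) s^j supplies each summand with the s^j it needs; the remaining s^(k-j)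
  -- build the two polynomials. No division by s occurs, so t = 0 is included.
  have h1 : s ^ k * ∑ j ∈ Finset.range (k + 1), ((p.coeff (j + 1) / 2 ^ j : ℝ) : ℂ) *
      (expMean P F (Gam W P F j) t - (E j : ℂ) * φ) = 0 := by rw [hrel', mul_zero]
  have h2 : s ^ k * ∑ j ∈ Finset.range (k + 1), ((p.coeff (j + 1) / 2 ^ j : ℝ) : ℂ) *
      (expMean P F (Gam W P F j) t - (E j : ℂ) * φ)
      = aeval s (denomPoly p k) * expMean P F F t - aeval s (numPoly p k E) * φ := by
    rw [denomPoly, numPoly, map_sum, map_sum, Finset.mul_sum, Finset.sum_mul, Finset.sum_mul,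
      ← Finset.sum_sub_distrib]
    refine Finset.sum_congr rfl fun j hj => ?_
    rw [Finset.mem_range] at hj
    have h3 : s ^ k = s ^ (k - j) * s ^ j := by rw [← pow_add]; congr 1; omega
    rw [h3]
    simp only [map_mul, map_pow, map_sum, aeval_C, aeval_X, Complex.coe_algebraMap]
    have h4 : ∑ l ∈ Finset.range (j + 1), (E l : ℂ) * s ^ (k - j + l)
        = s ^ (k - j) * ∑ l ∈ Finset.range (j + 1), (E l : ℂ) * s ^ l := by
      rw [Finset.mul_sum]
      refine Finset.sum_congr rfl fun l _ => ?_
      rw [pow_add]; ring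
    rw [h4]
    have h5 := hsum j
    rw [← Finset.sum_mul] at h5
    linear_combination (((p.coeff (j + 1) / 2 ^ j : ℝ) : ℂ) * s ^ (k - j)) * h5
  exact sub_eq_zero.1 (h2.symm.trans h1)

end Equation


/-! ### Uniqueness for the equation, and cumulants as its data. -/

section CharFun

open Complex (I)
open Filter Topology

lemma hasDerivAt_aeval_mul_I (p : ℝ[X]) (t : ℝ) :
    HasDerivAt (fun t : ℝ => aeval ((t : ℂ) * I) p) (I * aeval ((t : ℂ) * I) (derivative p)) t := by
  have h1 : HasDerivAt (fun t : ℝ => (t : ℂ) * I) I t := by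
    simpa using (Complex.ofRealCLM.hasDerivAt (x := t)).mul_const I
  have h2 := (p.hasDerivAt_aeval ((t : ℂ) * I)).comp t h1
  rw [mul_comm]
  exact h2

lemma iteratedDeriv_aeval_mul_I (p : ℝ[X]) (n : ℕ) :
    iteratedDeriv n (fun t : ℝ => aeval ((t : ℂ) * I) p)
      = fun t : ℝ => I ^ n * aeval ((t : ℂ) * I) (derivative^[n] p) := by
  induction n with
  | zero => simp
  | succ n ih =>
    rw [iteratedDeriv_succ, ih]
    ext t
    rw [((hasDerivAt_aeval_mul_I (derivative^[n] p) t).const_mul (I ^ n)).deriv,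
      Function.iterate_succ_apply', pow_succ, mul_assoc]

lemma iteratedDeriv_aeval_mul_I_zero (p : ℝ[X]) (n : ℕ) :
    iteratedDeriv n (fun t : ℝ => aeval ((t : ℂ) * I) p) 0
      = I ^ n * ((n.factorial * p.coeff n : ℝ) : ℂ) := by
  rw [iteratedDeriv_aeval_mul_I, ← eval_zero_iterate_derivative]
  simp [aeval_def, eval₂_at_zero, coeff_zero_eq_eval_zero]

lemma contDiff_aeval_mul_I (p : ℝ[X]) (n : WithTop ℕ∞) :
    ContDiff ℝ n (fun t : ℝ => aeval ((t : ℂ) * I) p) := by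
  simp only [aeval_eq_sum_range]
  refine ContDiff.sum fun i _ => ?_
  have : ContDiff ℝ n (fun t : ℝ => (t : ℂ)) := Complex.ofRealCLM.contDiff
  fun_prop

/-- A solution of `a y' = i b y` for polynomials `a, b`. -/
structure SolvesODE (a b : ℝ[X]) (y : ℝ → ℂ) : Prop where
  ne_zero : ∀ t : ℝ, aeval ((t : ℂ) * I) a ≠ 0
  hasDerivAt : ∀ t : ℝ, HasDerivAt y
    (I * aeval ((t : ℂ) * I) b / aeval ((t : ℂ) * I) a * y t) t
  init : y 0 = 1

lemma continuous_ratio {a b : ℝ[X]} (ha : ∀ t : ℝ, aeval ((t : ℂ) * I) a ≠ 0) :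
    Continuous fun t : ℝ => I * aeval ((t : ℂ) * I) b / aeval ((t : ℂ) * I) a :=
  (continuous_const.mul (contDiff_aeval_mul_I b 0).continuous).div
    (contDiff_aeval_mul_I a 0).continuous ha

lemma SolvesODE.eq_exp {a b : ℝ[X]} {y : ℝ → ℂ} (h : SolvesODE a b y) (t : ℝ) :
    y t = Complex.exp (∫ x in (0 : ℝ)..t,
      I * aeval ((x : ℂ) * I) b / aeval ((x : ℂ) * I) a) := by
  set g : ℝ → ℂ := fun t => I * aeval ((t : ℂ) * I) b / aeval ((t : ℂ) * I) a with hg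
  have hcont : Continuous g := continuous_ratio h.ne_zero
  set G : ℝ → ℂ := fun t => ∫ x in (0 : ℝ)..t, g x with hG
  have hGd : ∀ t, HasDerivAt G (g t) t := fun t =>
    intervalIntegral.integral_hasDerivAt_right (hcont.intervalIntegrable _ _)
      hcont.aestronglyMeasurable.stronglyMeasurableAtFilter hcont.continuousAt
  have hd : ∀ t, HasDerivAt (fun t => y t * Complex.exp (-G t)) 0 t := fun t => by
    have := (h.hasDerivAt t).mul (hGd t).fun_neg.cexp
    convert! this using 1
    simp only [hg]
    ring
  have hconst := is_const_of_deriv_eq_zero (fun t => (hd t).differentiableAt)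
    (fun t => (hd t).deriv) t 0
  have hG0 : G 0 = 0 := by simp [hG]
  rw [hG0, h.init, neg_zero, Complex.exp_zero, mul_one, Complex.exp_neg] at hconst
  change y t = Complex.exp (G t)
  have := Complex.exp_ne_zero (G t)
  field_simp at hconst
  exact hconst

lemma SolvesODE.unique {a b : ℝ[X]} {y z : ℝ → ℂ} (hy : SolvesODE a b y) (hz : SolvesODE a b z) :
    y = z := by
  ext t
  rw [hy.eq_exp t, hz.eq_exp t]

/-- Near 0 the solution is close to 1, hence off the branch cut, and the derivative of its principal
logarithm is the ratio in the equation. -/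
lemma SolvesODE.iteratedDeriv_log {a b : ℝ[X]} {y : ℝ → ℂ} (h : SolvesODE a b y) (n : ℕ) :
    iteratedDeriv (n + 1) (fun t => Complex.log (y t)) 0
      = iteratedDeriv n (fun t : ℝ => I * aeval ((t : ℂ) * I) b / aeval ((t : ℂ) * I) a) 0 := by
  rw [iteratedDeriv_succ']
  refine Filter.EventuallyEq.iteratedDeriv_eq n ?_
  have hslit : ∀ᶠ t in 𝓝 (0 : ℝ), y t ∈ Complex.slitPlane := by
    refine (h.hasDerivAt 0).continuousAt.eventually_mem (Complex.isOpen_slitPlane.mem_nhds ?_)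
    rw [h.init]; exact Complex.one_mem_slitPlane
  filter_upwards [hslit] with t ht
  rw [((h.hasDerivAt t).clog_real ht).deriv, mul_div_cancel_right₀]
  exact Complex.slitPlane_ne_zero ht

/-- If enough cumulants agree, the numerators agree. -/
lemma SolvesODE.numerator_eq {a b b' : ℝ[X]} {y z : ℝ → ℂ} (hy : SolvesODE a b y)
    (hz : SolvesODE a b' z) {k : ℕ} (hb : b.natDegree ≤ k) (hb' : b'.natDegree ≤ k)
    (h0 : b.coeff 0 = b'.coeff 0)
    (hcum : ∀ r, 2 ≤ r → r ≤ k + 1 →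
      ((-I) ^ r * iteratedDeriv r (fun t => Complex.log (y t)) 0).re
        = ((-I) ^ r * iteratedDeriv r (fun t => Complex.log (z t)) 0).re) : b = b' := by
  set A : ℝ → ℂ := fun t => aeval ((t : ℂ) * I) a with hA
  set g : ℝ → ℂ := fun t => I * aeval ((t : ℂ) * I) b / aeval ((t : ℂ) * I) a with hg
  set g' : ℝ → ℂ := fun t => I * aeval ((t : ℂ) * I) b' / aeval ((t : ℂ) * I) a with hg'
  have hAc : ∀ n : ℕ, ContDiff ℝ n A := fun n => contDiff_aeval_mul_I a n
  have hgc : ∀ n : ℕ, ContDiff ℝ n g := fun n => by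
    simp only [hg, div_eq_mul_inv]
    exact (contDiff_const.mul (contDiff_aeval_mul_I b n)).mul ((hAc n).inv hy.ne_zero)
  have hgc' : ∀ n : ℕ, ContDiff ℝ n g' := fun n => by
    simp only [hg', div_eq_mul_inv]
    exact (contDiff_const.mul (contDiff_aeval_mul_I b' n)).mul ((hAc n).inv hy.ne_zero)
  set D : ℝ → ℂ := fun t => g t - g' t with hD
  have hDc : ∀ n : ℕ, ContDiff ℝ n D := fun n => (hgc n).sub (hgc' n)
  have hprod : (fun t => A t * D t) = fun t : ℝ => I * aeval ((t : ℂ) * I) (b - b') := by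
    ext t
    have := hy.ne_zero t
    simp only [hA, hD, hg, hg', map_sub]
    field_simp
  have hA0 : A 0 = ((a.coeff 0 : ℝ) : ℂ) := by
    simp [hA, aeval_def, eval₂_at_zero]
  have ha0 : a.coeff 0 ≠ 0 := fun h => by
    apply hy.ne_zero 0
    have := hA0
    rw [h, Complex.ofReal_zero] at this
    exact this
  -- Leibniz at 0 for A D = i (b - b')(it): once the lower derivatives of D vanish, the j-th
  -- derivative of D is a(0)⁻¹ times the j-th coefficient, up to nonzero factors. The cumulant of
  -- order j + 1 makes it vanish for j ≥ 1; j = 0 is covered by the assumption on constant terms.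
  have key : ∀ j ≤ k, (b - b').coeff j = 0 ∧ iteratedDeriv j D 0 = 0 := by
    intro j
    induction j using Nat.strong_induction_on with
    | _ j ih =>
      intro hj
      have h1 : iteratedDeriv j (fun t => A t * D t) 0 = A 0 * iteratedDeriv j D 0 := by
        rw [iteratedDeriv_fun_mul (hAc j).contDiffAt (hDc j).contDiffAt, Finset.sum_range_succ']
        rw [Finset.sum_eq_zero]
        · simp
        · intro i hi
          rw [Finset.mem_range] at hi
          rw [(ih (j - (i + 1)) (by omega) (by omega)).2, mul_zero]
      have h2 : iteratedDeriv j (fun t => A t * D t) 0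
          = I * (I ^ j * ((j.factorial * (b - b').coeff j : ℝ) : ℂ)) := by
        rw [hprod, iteratedDeriv_const_mul_field, iteratedDeriv_aeval_mul_I_zero]
      rw [h1, hA0] at h2
      have ha0' : ((a.coeff 0 : ℝ) : ℂ) ≠ 0 := by exact_mod_cast ha0
      have h3 : (b - b').coeff j = 0 := by
        rcases Nat.eq_zero_or_pos j with rfl | hjpos
        · rw [coeff_sub, h0, sub_self]
        have h4 := hcum (j + 1) (by omega) (by omega)
        rw [hy.iteratedDeriv_log, hz.iteratedDeriv_log, ← sub_eq_zero, ← Complex.sub_re, ← mul_sub,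
          ← iteratedDeriv_fun_sub (hgc j).contDiffAt (hgc' j).contDiffAt] at h4
        change ((-I) ^ (j + 1) * iteratedDeriv j D 0).re = 0 at h4
        -- The derivative is i^(j+1) times a real number, so nothing is lost in knowing only the
        -- real parts of the cumulant expressions.
        have h5 : iteratedDeriv j D 0
            = I ^ (j + 1) * ((j.factorial * (b - b').coeff j / a.coeff 0 : ℝ) : ℂ) := by
          push_cast
          push_cast at h2
          field_simp
          rw [mul_comm, h2]; ring
        rw [h5, ← mul_assoc, ← mul_pow, neg_mul, Complex.I_mul_I, neg_neg, one_pow, one_mul,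
          Complex.ofReal_re] at h4
        have h6 : (j.factorial : ℝ) ≠ 0 := by positivity
        field_simp at h4
        simpa [h6] using h4
      refine ⟨h3, ?_⟩
      rw [h3] at h2
      simpa [ha0'] using h2
  rw [← sub_eq_zero]
  ext j
  rcases Nat.lt_or_ge k j with hj | hj
  · rw [coeff_zero]
    exact coeff_eq_zero_of_natDegree_lt (((natDegree_sub_le _ _).trans (max_le hb hb')).trans_lt hj)
  · exact (key j hj).1

lemma hasDerivAt_charFun {μ : Measure ℝ} [IsFiniteMeasure μ] (hμ : Integrable id μ) (t : ℝ) :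
    HasDerivAt (charFun μ) (I * ∫ x, (x : ℂ) * Complex.exp (t * x * I) ∂μ) t := by
  have h1 : MemLp id ((1 : ℕ) : ENNReal) μ := by
    simpa using memLp_one_iff_integrable.2 hμ
  have h2 := ((contDiff_charFun h1).differentiable (by simp) t).hasDerivAt
  have h3 := iteratedDeriv_charFun (t := t) h1
  rw [iteratedDeriv_one] at h3
  rw [h3] at h2
  simpa using h2

lemma solvesODE_charFun {μ : Measure ℝ} [IsProbabilityMeasure μ] (hμ : Integrable id μ) {a b : ℝ[X]}
    (ha : ∀ t : ℝ, aeval ((t : ℂ) * I) a ≠ 0)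
    (h : ∀ t : ℝ, aeval ((t : ℂ) * I) a * ∫ x, (x : ℂ) * Complex.exp (t * x * I) ∂μ
      = aeval ((t : ℂ) * I) b * charFun μ t) : SolvesODE a b (charFun μ) where
  ne_zero := ha
  hasDerivAt t := by
    convert hasDerivAt_charFun hμ t using 1
    have h1 : ∫ x, (x : ℂ) * Complex.exp (t * x * I) ∂μ
        = aeval ((t : ℂ) * I) b * charFun μ t / aeval ((t : ℂ) * I) a := by
      rw [eq_div_iff (ha t), mul_comm, h t]
    rw [h1]
    ring
  init := by simp

end CharFun


/-! ### The equation for the target variable. -/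

section Target

open Complex (I)

lemma temperate_sq_sub_one (c : ℝ) : (fun x : ℝ => c * (x ^ 2 - 1)).HasTemperateGrowth :=
  (Function.HasTemperateGrowth.const c).mul
    ((Function.HasTemperateGrowth.id'.pow 2).sub (.const 1))

lemma integrable_gaussianReal_of_temperate (v : NNReal) {f : ℝ → ℝ} (hf : f.HasTemperateGrowth) :
    Integrable f (gaussianReal 0 v) :=
  memLp_one_iff_integrable.1 (memLp_of_temperate
    (IsGaussian.hasGaussianLaw_id : HasGaussianLaw (id : ℝ → ℝ) (gaussianReal 0 v)) hf (by simp))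

lemma hasDerivAt_sq_sub_one (c x : ℝ) :
    HasDerivAt (fun x : ℝ => c * (x ^ 2 - 1)) (c * (2 * x)) x := by
  simpa using (((hasDerivAt_id x).pow 2).sub_const 1).const_mul c

/-- Stein's identity for `x e^{i c (x² - 1)}`. -/
lemma integral_sq_mul_exp (c : ℝ) :
    (1 - 2 * c * I) * ∫ x : ℝ, (x : ℂ) ^ 2 * Complex.exp ((c * (x ^ 2 - 1) : ℝ) * I) ∂gaussianReal 0 1
      = ∫ x : ℝ, Complex.exp ((c * (x ^ 2 - 1) : ℝ) * I) ∂gaussianReal 0 1 := by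
  have tc : (fun x : ℝ => Real.cos (c * (x ^ 2 - 1))).HasTemperateGrowth :=
    temperate_cos.comp (temperate_sq_sub_one c)
  have ts : (fun x : ℝ => Real.sin (c * (x ^ 2 - 1))).HasTemperateGrowth :=
    temperate_sin.comp (temperate_sq_sub_one c)
  have tc1 : (fun x : ℝ => x * Real.cos (c * (x ^ 2 - 1))).HasTemperateGrowth :=
    Function.HasTemperateGrowth.id'.mul tc
  have ts1 : (fun x : ℝ => x * Real.sin (c * (x ^ 2 - 1))).HasTemperateGrowth :=
    Function.HasTemperateGrowth.id'.mul ts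
  have tc2 : (fun x : ℝ => x ^ 2 * Real.cos (c * (x ^ 2 - 1))).HasTemperateGrowth :=
    (Function.HasTemperateGrowth.id'.pow 2).mul tc
  have ts2 : (fun x : ℝ => x ^ 2 * Real.sin (c * (x ^ 2 - 1))).HasTemperateGrowth :=
    (Function.HasTemperateGrowth.id'.pow 2).mul ts
  have ic := integrable_gaussianReal_of_temperate 1 tc
  have is := integrable_gaussianReal_of_temperate 1 ts
  have ic2 := integrable_gaussianReal_of_temperate 1 tc2
  have is2 := integrable_gaussianReal_of_temperate 1 ts2
  have dc : deriv (fun x : ℝ => x * Real.cos (c * (x ^ 2 - 1)))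
      = fun x => Real.cos (c * (x ^ 2 - 1)) - 2 * c * (x ^ 2 * Real.sin (c * (x ^ 2 - 1))) := by
    ext x
    refine (((hasDerivAt_id x).mul (hasDerivAt_sq_sub_one c x).cos).deriv).trans ?_
    simp only [id]; ring
  have ds : deriv (fun x : ℝ => x * Real.sin (c * (x ^ 2 - 1)))
      = fun x => Real.sin (c * (x ^ 2 - 1)) + 2 * c * (x ^ 2 * Real.cos (c * (x ^ 2 - 1))) := by
    ext x
    refine (((hasDerivAt_id x).mul (hasDerivAt_sq_sub_one c x).sin).deriv).trans ?_
    simp only [id]; ring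
  have sc := stein_gaussianReal 1 tc1
  have ss := stein_gaussianReal 1 ts1
  rw [dc, integral_sub ic (is2.const_mul _), integral_const_mul] at sc
  rw [ds, integral_add is (ic2.const_mul _), integral_const_mul] at ss
  simp only [← mul_assoc, ← sq, NNReal.coe_one, one_mul] at sc ss
  have h1 : ∫ x : ℝ, Complex.exp ((c * (x ^ 2 - 1) : ℝ) * I) ∂gaussianReal 0 1
      = ((∫ x, Real.cos (c * (x ^ 2 - 1)) ∂gaussianReal 0 1 : ℝ) : ℂ)
        + ((∫ x, Real.sin (c * (x ^ 2 - 1)) ∂gaussianReal 0 1 : ℝ) : ℂ) * I := by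
    rw [← integral_complex_ofReal, ← integral_complex_ofReal, ← integral_mul_const, ← integral_add]
    · refine integral_congr_ae (.of_forall fun x => ?_)
      dsimp only
      rw [Complex.exp_mul_I, Complex.ofReal_cos, Complex.ofReal_sin]
    · exact ic.ofReal
    · exact is.ofReal.mul_const _
  have h2 : ∫ x : ℝ, (x : ℂ) ^ 2 * Complex.exp ((c * (x ^ 2 - 1) : ℝ) * I) ∂gaussianReal 0 1
      = ((∫ x, x ^ 2 * Real.cos (c * (x ^ 2 - 1)) ∂gaussianReal 0 1 : ℝ) : ℂ)
        + ((∫ x, x ^ 2 * Real.sin (c * (x ^ 2 - 1)) ∂gaussianReal 0 1 : ℝ) : ℂ) * I := by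
    rw [← integral_complex_ofReal, ← integral_complex_ofReal, ← integral_mul_const, ← integral_add]
    · refine integral_congr_ae (.of_forall fun x => ?_)
      dsimp only
      rw [Complex.exp_mul_I]
      push_cast
      ring
    · exact ic2.ofReal
    · exact is2.ofReal.mul_const _
  rw [h1, h2]
  have sc' := congrArg (fun x : ℝ => (x : ℂ)) sc
  have ss' := congrArg (fun x : ℝ => (x : ℂ)) ss
  push_cast at sc' ss'
  linear_combination sc' + I * ss' - 2 * c *
    ((∫ x, x ^ 2 * Real.sin (c * (x ^ 2 - 1)) ∂gaussianReal 0 1 : ℝ) : ℂ) * Complex.I_sq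

lemma one_sub_mul_I_ne_zero (c : ℝ) : (1 - 2 * c * I : ℂ) ≠ 0 := fun h => by
  have := congrArg Complex.re h
  norm_num at this

/-- The characteristic function of `c (N² - 1)`. -/
lemma hasDerivAt_charFun_sq_sub_one (c t : ℝ) :
    HasDerivAt (charFun ((gaussianReal 0 1).map fun x => c * (x ^ 2 - 1)))
      (I * (2 * c ^ 2 * (t * I) / (1 - 2 * c * (t * I))) *
        charFun ((gaussianReal 0 1).map fun x => c * (x ^ 2 - 1)) t) t := by
  have hmeas : Measurable fun x : ℝ => c * (x ^ 2 - 1) := by fun_prop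
  have : IsProbabilityMeasure ((gaussianReal 0 1).map fun x => c * (x ^ 2 - 1)) :=
    Measure.isProbabilityMeasure_map hmeas.aemeasurable
  have hint : Integrable id ((gaussianReal 0 1).map fun x => c * (x ^ 2 - 1)) :=
    (integrable_map_measure aestronglyMeasurable_id hmeas.aemeasurable).2
      (integrable_gaussianReal_of_temperate 1 (temperate_sq_sub_one c))
  convert hasDerivAt_charFun hint t using 1
  rw [charFun_apply_real, integral_map hmeas.aemeasurable (by fun_prop),
    integral_map hmeas.aemeasurable (by fun_prop)]
  have h1 : ∀ x : ℝ, Complex.exp (t * ((c * (x ^ 2 - 1) : ℝ) : ℂ) * I)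
      = Complex.exp (((t * c) * (x ^ 2 - 1) : ℝ) * I) := fun x => by
    push_cast; ring_nf
  simp only [h1]
  have h2 := integral_sq_mul_exp (t * c)
  have i0 : Integrable (fun x : ℝ => Complex.exp (((t * c) * (x ^ 2 - 1) : ℝ) * I))
      (gaussianReal 0 1) := by
    refine Integrable.of_bound (by fun_prop) 1 (.of_forall fun x => ?_)
    rw [Complex.norm_exp_ofReal_mul_I]
  have i2 : Integrable (fun x : ℝ => (x : ℂ) ^ 2 * Complex.exp (((t * c) * (x ^ 2 - 1) : ℝ) * I))
      (gaussianReal 0 1) := by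
    have h3 : Integrable (fun x : ℝ => x ^ 2) (gaussianReal 0 1) :=
      integrable_gaussianReal_of_temperate 1 (Function.HasTemperateGrowth.id'.pow 2)
    refine h3.norm.mono' (by fun_prop) (.of_forall fun x => ?_)
    rw [norm_mul, Complex.norm_exp_ofReal_mul_I, mul_one, norm_pow, norm_pow, Complex.norm_real]
  have h3 : ∫ x : ℝ, ((c * (x ^ 2 - 1) : ℝ) : ℂ) *
      Complex.exp (((t * c) * (x ^ 2 - 1) : ℝ) * I) ∂gaussianReal 0 1
      = c * (∫ x : ℝ, (x : ℂ) ^ 2 * Complex.exp (((t * c) * (x ^ 2 - 1) : ℝ) * I) ∂gaussianReal 0 1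
        - ∫ x : ℝ, Complex.exp (((t * c) * (x ^ 2 - 1) : ℝ) * I) ∂gaussianReal 0 1) := by
    rw [← integral_sub i2 i0, ← integral_const_mul]
    refine integral_congr_ae (.of_forall fun x => ?_)
    push_cast; ring
  rw [h3, ← h2]
  have h4 := one_sub_mul_I_ne_zero (t * c)
  have h5 : (1 - 2 * c * (t * I) : ℂ) = 1 - 2 * (t * c : ℝ) * I := by push_cast; ring
  rw [h5, mul_assoc, ← mul_assoc (_ / _), div_mul_cancel₀ _ h4]
  push_cast
  ring

/-- The numerator of the logarithmic derivative of the characteristic function of the target. -/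
noncomputable def targetNum {k : ℕ} (α : Fin k → ℝ) : ℝ[X] :=
  ∑ i, X * (C (α i ^ 2) * ∏ j ∈ Finset.univ.erase i, (C (1 / 2) - C (α j) * X))

lemma natDegree_targetNum_le {k : ℕ} (α : Fin k → ℝ) : (targetNum α).natDegree ≤ k := by
  refine natDegree_sum_le_of_forall_le _ _ fun i _ => ?_
  have h1 : (∏ j ∈ Finset.univ.erase i, (C (1 / 2) - C (α j) * X) : ℝ[X]).natDegree ≤ k - 1 := by
    refine (natDegree_prod_le _ _).trans ((Finset.sum_le_card_nsmul _ _ 1 fun j _ => ?_).trans ?_)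
    · refine (natDegree_sub_le _ _).trans (max_le (by simp) ?_)
      simpa using natDegree_C_mul_X_pow_le (α j) 1
    · simp
  have h2 := natDegree_mul_le (p := (X : ℝ[X]))
    (q := C (α i ^ 2) * ∏ j ∈ Finset.univ.erase i, (C (1 / 2) - C (α j) * X))
  have h3 := natDegree_C_mul_le (α i ^ 2)
    (∏ j ∈ Finset.univ.erase i, (C (1 / 2) - C (α j) * X))
  rw [natDegree_X] at h2
  have := i.pos
  omega

lemma coeff_zero_targetNum {k : ℕ} (α : Fin k → ℝ) : (targetNum α).coeff 0 = 0 := by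
  rw [targetNum, finsetSum_coeff]
  exact Finset.sum_eq_zero fun i _ => by rw [coeff_X_mul_zero]

/-- Partial fractions: 1 - 2 α_i s is twice the factor 1/2 - s α_i of the denominator. -/
lemma aeval_targetNum {k : ℕ} (α : Fin k → ℝ) (t : ℝ) :
    aeval ((t : ℂ) * I) (targetNum α) / aeval ((t : ℂ) * I) (denomPoly (targetPoly α) k)
      = ∑ i, 2 * (α i : ℂ) ^ 2 * (t * I) / (1 - 2 * α i * (t * I)) := by
  have hne := aeval_denomPoly_targetPoly_ne_zero α t
  rw [aeval_denomPoly_targetPoly] at hne ⊢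
  rw [targetNum, map_sum, Finset.sum_div]
  refine Finset.sum_congr rfl fun i _ => ?_
  rw [← Finset.mul_prod_erase _ _ (Finset.mem_univ i)] at hne ⊢
  simp only [map_mul, map_prod, map_sub, aeval_X, aeval_C, Complex.coe_algebraMap,
    Complex.ofReal_pow]
  have h1 : ∏ j ∈ Finset.univ.erase i, (((1 / 2 : ℝ) : ℂ) - (α j : ℂ) * (t * I))
      = ∏ j ∈ Finset.univ.erase i, (1 / 2 - t * I * (α j : ℂ)) := by
    refine Finset.prod_congr rfl fun j _ => ?_
    push_cast; ring
  rw [h1]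
  have h2 := (mul_ne_zero_iff.1 hne).1
  have h3 := (mul_ne_zero_iff.1 hne).2
  have h4 : (1 - 2 * α i * (t * I) : ℂ) ≠ 0 := by
    rw [show (1 - 2 * α i * (t * I) : ℂ) = 2 * (1 / 2 - t * I * (α i : ℂ)) by ring]
    exact mul_ne_zero two_ne_zero h2
  rw [div_eq_div_iff (mul_ne_zero h2 h3) h4]
  ring

/-- By independence the characteristic function is a product, so logarithmic derivatives add;
brought to a common denominator they give `targetNum`. -/
lemma solvesODE_target {Ω' : Type*} [MeasurableSpace Ω'] (P' : Measure Ω')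
    [IsProbabilityMeasure P'] (k : ℕ) (α : Fin k → ℝ) (N : Fin k → Ω' → ℝ)
    (hN : ∀ i, HasLaw (N i) (gaussianReal 0 1) P') (hNind : iIndepFun N P') :
    SolvesODE (denomPoly (targetPoly α) k) (targetNum α)
      (charFun (P'.map fun ω => ∑ i, α i * ((N i ω) ^ 2 - 1))) := by
  have hmeas : ∀ i, Measurable fun x : ℝ => α i * (x ^ 2 - 1) := fun i => by fun_prop
  have hae : ∀ i, AEMeasurable (fun ω => α i * ((N i ω) ^ 2 - 1)) P' := fun i =>
    (hmeas i).comp_aemeasurable (hN i).aemeasurable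
  have hind : iIndepFun (fun i ω => α i * ((N i ω) ^ 2 - 1)) P' :=
    hNind.comp (fun i x => α i * (x ^ 2 - 1)) hmeas
  have hlaw : ∀ i, P'.map (fun ω => α i * ((N i ω) ^ 2 - 1))
      = (gaussianReal 0 1).map fun x => α i * (x ^ 2 - 1) := fun i => by
    rw [← (hN i).map_eq, AEMeasurable.map_map_of_aemeasurable (hmeas i).aemeasurable
      (hN i).aemeasurable]
    rfl
  have hprob : IsProbabilityMeasure (P'.map fun ω => ∑ i, α i * ((N i ω) ^ 2 - 1)) :=
    Measure.isProbabilityMeasure_map (Finset.aemeasurable_fun_sum _ fun i _ => hae i)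
  refine ⟨aeval_denomPoly_targetPoly_ne_zero α, fun t => ?_, by simp⟩
  rw [hind.charFun_map_fun_sum_eq_prod hae, mul_div_assoc, aeval_targetNum]
  simp only [hlaw]
  refine (HasDerivAt.finsetProd fun i (_ : i ∈ Finset.univ) =>
    hasDerivAt_charFun_sq_sub_one (α i) t).congr_deriv ?_
  rw [Finset.mul_sum, Finset.sum_mul]
  refine Finset.sum_congr rfl fun i _ => ?_
  rw [Finset.prod_apply, ← Finset.mul_prod_erase _ _ (Finset.mem_univ i), smul_eq_mul]
  ring

end Target


/-! ### The equation for F, and the conclusion. -/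

section Law

universe u

variable {Ω : Type*} {H : Type u} {mΩ : MeasurableSpace Ω} [NormedAddCommGroup H]
  [InnerProductSpace ℝ H] {P : Measure Ω} {W : H → Ω → ℝ}

lemma solvesODE_of_gamRelation [CompleteSpace H] [TopologicalSpace.SeparableSpace H]
    [IsProbabilityMeasure P] (hW : IsIsonormal W P) {F : Lp ℝ 2 P} {n : ℕ} (hn : 2 ≤ n)
    (hF : F ∈ chaosLE hW n) {k : ℕ} {α : Fin k → ℝ} (hrel : GamRelation hW F (targetPoly α) k) :
    SolvesODE (denomPoly (targetPoly α) k)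
      (numPoly (targetPoly α) k fun j => ∫ ω, Gam W P F j ω ∂P) (charFun (P.map F)) := by
  have hF' : AEMeasurable F P := (Lp.aestronglyMeasurable F).aemeasurable
  have : IsProbabilityMeasure (P.map F) := Measure.isProbabilityMeasure_map hF'
  have hint : Integrable id (P.map F) :=
    (integrable_map_measure aestronglyMeasurable_id hF').2
      ((Lp.memLp F).integrable (by norm_num))
  refine solvesODE_charFun hint (aeval_denomPoly_targetPoly_ne_zero α) fun t => ?_
  have h := aeval_denomPoly_mul_expMean hW hn hF hrel t
  rw [expMean_eq, expMean_eq] at h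
  rw [charFun_apply_real, integral_map hF' (by fun_prop), integral_map hF' (by fun_prop), h]
  congr 1
  refine integral_congr_ae ?_
  filter_upwards [coeFn_hermiteL2 hW 0 (0 : H)] with ω h1
  simp [h1]

end Law

end WienerChaos

theorem propositionp
    {Ω Ω' H : Type*} [MeasurableSpace Ω] [MeasurableSpace Ω']
    [NormedAddCommGroup H] [InnerProductSpace ℝ H] [CompleteSpace H]
    [TopologicalSpace.SeparableSpace H]
    -- the isonormal Gaussian process `W` over `H`
    (P : Measure Ω) [IsProbabilityMeasure P]
    (W : H → Ω → ℝ) (hW : WienerChaos.IsIsonormal W P)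
    -- the target `F_∞ = ∑ i, α_i (N_i ^ 2 - 1)`
    (P' : Measure Ω') [IsProbabilityMeasure P']
    (k : ℕ) (α : Fin k → ℝ) (hα0 : ∀ i, α i ≠ 0) (hα : Function.Injective α)
    (N : Fin k → Ω' → ℝ) (hN : ∀ i, HasLaw (N i) (gaussianReal 0 1) P') (hNind : iIndepFun N P')
    (Finf : Ω' → ℝ) (hFinf : Finf = fun ω => ∑ i, α i * ((N i ω) ^ 2 - 1))
    -- the (automatically centered) random variable `F` in a finite sum of Wiener chaoses
    (M : ℕ) (F : Lp ℝ 2 P) (hF : F ∈ ⨆ q ∈ Finset.Icc 1 M, WienerChaos.chaos W P q)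
    (hcum : ∀ r, 2 ≤ r → r ≤ k + 1 →
      WienerChaos.cumulant F P r = WienerChaos.cumulant Finf P' r)
    (hGam : ∫ ω, (∑ r ∈ Finset.Icc 1 (k + 1),
      (Polynomial.derivative^[r] (WienerChaos.targetPoly α)).eval 0 /
          ((r.factorial : ℝ) * 2 ^ (r - 1)) *
        (WienerChaos.Gam W P F (r - 1) ω - ∫ ω', WienerChaos.Gam W P F (r - 1) ω' ∂P)) ^ 2 ∂P = 0) :
    IdentDistrib F Finf P P' ∧ F ∈ WienerChaos.chaos W P 2 := by
  have hrel := WienerChaos.gamRelation_of_integral hW hGam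
  have hF2 : F ∈ WienerChaos.chaosLE hW 2 := WienerChaos.mem_chaosLE_of_gamRelation hW
    (by rw [WienerChaos.coeff_targetPoly_succ]; exact one_ne_zero) hrel
    (WienerChaos.iSup_chaos_le hW M hF)
  refine ⟨?_, WienerChaos.mem_chaos_two hW hα0 hα hF hrel⟩
  have hFm : AEMeasurable F P := (Lp.aestronglyMeasurable F).aemeasurable
  have hFinfm : AEMeasurable Finf P' := by
    rw [hFinf]
    exact Finset.aemeasurable_fun_sum _ fun i _ =>
      (((hN i).aemeasurable.pow_const 2).sub_const 1).const_mul (α i)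
  refine ⟨hFm, hFinfm, ?_⟩
  have hy := WienerChaos.solvesODE_of_gamRelation hW le_rfl hF2 hrel
  have hz := WienerChaos.solvesODE_target P' k α N hN hNind
  rw [← hFinf] at hz
  -- Γ_0 is F itself. Its mean governs the constant term of the numerator, which the cumulants of
  -- order at least 2 do not see.
  have hE : ∫ ω, WienerChaos.Gam W P F 0 ω ∂P = 0 :=
    WienerChaos.integral_eq_zero_of_mem_iSup hW hF
  -- Both numerators have degree at most k and no constant term, so the k cumulants of orders 2 to k
  -- + 1 are exactly enough.
  have hnum := hy.numerator_eq hz (WienerChaos.natDegree_numPoly_le _ _ _)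
    (WienerChaos.natDegree_targetNum_le α)
    ((WienerChaos.coeff_zero_numPoly _ _ hE).trans (WienerChaos.coeff_zero_targetNum α).symm) hcum
  rw [hnum] at hy
  have : IsProbabilityMeasure (P.map F) := Measure.isProbabilityMeasure_map hFm
  have : IsProbabilityMeasure (P'.map Finf) := Measure.isProbabilityMeasure_map hFinfm
  exact Measure.ext_of_charFun (hy.unique hz)
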